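/- **Theorem (Limits in the Hoppe tree).** Let $\theta>0$, and let $J_1,J_2,\dots$ be independent random variables with $$\Pr(J_n=0)=\frac{\theta}{\theta+n-1},\qquad \Pr(J_n=k)=\frac{1}{\theta+n-1}\quad(1\le k\le n-1).$$ The Hoppe tree of size $n$ with parameter $\theta$ is the tree with vertices $0,\dots,n-1$, rooted at $0$, in which $J_k$ is the parent of $k$ for $1\le k\le n-1$; for $\theta=1$ it is the random recursive tree. Let $T'_n$ be its total path length (the sum over all vertices of the distance to the root), let $W'_n$ be its Wiener index (the sum of the distances over all unordered pairs of distinct vertices), and put $$\tilde W'_n=\frac{W'_n-\mathbb E W'_n}{n^2},\qquad \tilde T'_n=\frac{T'_n-\mathbb E T'_n}{n}.$$ For $\theta=1$ write $\tilde W_n,\tilde T_n$ for these variables. Let $\mathcal E(v)=v\log v+(1-v)\log(1-v)$, let $\Psi=\Gamma'/\Gamma$ be the digamma function, and put $$A(v)=\begin{pmatrix}(1-v)^2&v(1-v)\\0&1-v\end{pmatrix},\qquad B(v)=\begin{pmatrix}v^2&v(1-v)\\0&v\end{pmatrix}.$$ "Convergence with second moments" means that the second moments, pure and mixed, are finite and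 converge to those of the limit. *The random recursive tree.* There is exactly one centered probability distribution on $\mathbb R^2$ with finite second moments that is the law of a vector $(\tilde W,\tilde T)^t$ with $$\begin{pmatrix}\tilde W\\\tilde T\end{pmatrix}\overset{d}{=}A(V)\begin{pmatrix}\tilde W^*\\\tilde T^*\end{pmatrix}+B(V)\begin{pmatrix}\tilde W\\\tilde T\end{pmatrix}+\begin{pmatrix}3V(1-V)+\mathcal E(V)\\V+\mathcal E(V)\end{pmatrix},$$ where, on the right-hand side, $V$ is uniform on $[0,1]$, $(\tilde W^*,\tilde T^*)$ is distributed as $(\tilde W,\tilde T)$, and $V$, $(\tilde W^*,\tilde T^*)$, $(\tilde W,\tilde T)$ are independent. The vector $(\tilde W_n,\tilde T_n)$ converges in distribution and with second moments to $(\tilde W,\tilde T)$. *The Hoppe tree.* The vector $(\tilde W'_n,\tilde T'_n)$ converges in distribution and with second moments to a centered vector $(\tilde W',\tilde T')$ with finite second moments. The law of $(\tilde W',\tilde T')$ is the unique probability distribution on $\mathbb R^2$ satisfying $$\begin{pmatrix}\tilde W'\\\tilde T'\end{pmatrix}\overset{d}{=}A(V)\begin{pmatrix}\tilde W'\\\tilde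 T'\end{pmatrix}+B(V)\begin{pmatrix}\tilde W\\\tilde T\end{pmatrix}+b^*,$$ $$b^*=\begin{pmatrix}\left(\frac{\theta+5}{\theta+1}-\frac{2\theta+4}{\theta+1}V\right)V+\mathcal E(V)+\bigl(\Psi(\theta+1)-\Psi(2)\bigr)V\\[2pt]V+\mathcal E(V)+\bigl(\Psi(\theta+1)-\Psi(2)\bigr)V\end{pmatrix},$$ where, on the right-hand side, $V\sim\mathrm{Beta}(1,\theta)$, $(\tilde W,\tilde T)$ has the limit law of the random recursive tree given above, and $V$, $(\tilde W',\tilde T')$, $(\tilde W,\tilde T)$ are independent. -/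

import Mathlib

open MeasureTheory ProbabilityTheory Filter Topology

noncomputable section

namespace HoppeTree

/-- `J 1, J 2, …` are independent and `J n` is distributed on `{0, …, n - 1}` with mass
`θ / (θ + n - 1)` at `0` and mass `1 / (θ + n - 1)` at each `k ∈ {1, …, n - 1}`.
(The value `J 0` is not used.) -/
structure IsHoppeSequence {Ω : Type*} [MeasurableSpace Ω] (θ : ℝ) (J : ℕ → Ω → ℕ)
    (P : Measure Ω) : Prop where
  measurable : ∀ n, 1 ≤ n → Measurable (J n)
  indep : iIndepFun (fun n : ℕ => J (n + 1)) P
  prob_zero : ∀ n, 1 ≤ n → P.real {ω | J n ω = 0} = θ / (θ + n - 1)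
  prob_pos : ∀ n k, 1 ≤ k → k < n → P.real {ω | J n ω = k} = 1 / (θ + n - 1)

/-- The tree with vertices `0, …, n - 1` in which `p k` is the parent of `k`, for
`1 ≤ k ≤ n - 1`. -/
def tree (p : ℕ → ℕ) (n : ℕ) : SimpleGraph (Fin n) :=
  SimpleGraph.fromRel fun k j => 1 ≤ (k : ℕ) ∧ p k = j

/-- Total path length: the sum over all vertices of the distance to the root `0`. -/
def totalLength (p : ℕ → ℕ) (n : ℕ) : ℕ :=
  ∑ k : Fin n, (tree p n).dist ⟨0, k.pos⟩ k

/-- Wiener index: the sum of the distances over all unordered pairs of distinct vertices. -/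
def wienerIndex (p : ℕ → ℕ) (n : ℕ) : ℕ :=
  ∑ i : Fin n, ∑ j ∈ Finset.Ioi i, (tree p n).dist i j

/-- The standardized pair `((W_n - E W_n) / n², (T_n - E T_n) / n)` of the Wiener index `W_n` and
the total path length `T_n` of the random tree on `n` vertices in which `J k` is the parent of
`k`. -/
def standardized {Ω : Type*} [MeasurableSpace Ω] (J : ℕ → Ω → ℕ) (P : Measure Ω) (n : ℕ) (ω : Ω) :
    ℝ × ℝ :=
  (((wienerIndex (fun k => J k ω) n : ℝ) - ∫ ω', (wienerIndex (fun k => J k ω') n : ℝ) ∂P)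
      / (n : ℝ) ^ 2,
   ((totalLength (fun k => J k ω) n : ℝ) - ∫ ω', (totalLength (fun k => J k ω') n : ℝ) ∂P)
      / (n : ℝ))

/-- Centered laws on `ℝ²` with finite second moments. -/
structure IsCenteredL2 (μ : Measure (ℝ × ℝ)) : Prop where
  memLp_fst : MemLp Prod.fst 2 μ
  memLp_snd : MemLp Prod.snd 2 μ
  integral_fst : ∫ x, x.1 ∂μ = 0
  integral_snd : ∫ x, x.2 ∂μ = 0

/-- Convergence in distribution to the law `μ`, together with all (pure and mixed) second
moments, which are finite. -/
structure ConvergesWithSecondMoments {Ω : Type*} [MeasurableSpace Ω] (X : ℕ → Ω → ℝ × ℝ)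
    (P : Measure Ω) [IsProbabilityMeasure P] (μ : Measure (ℝ × ℝ)) [IsProbabilityMeasure μ] :
    Prop where
  inDistribution : TendstoInDistribution X atTop (id : ℝ × ℝ → ℝ × ℝ) (fun _ => P) μ
  memLp_fst : ∀ n, MemLp (fun ω => (X n ω).1) 2 P
  memLp_snd : ∀ n, MemLp (fun ω => (X n ω).2) 2 P
  memLp_limit_fst : MemLp Prod.fst 2 μ
  memLp_limit_snd : MemLp Prod.snd 2 μ
  moment_fst : Tendsto (fun n => ∫ ω, (X n ω).1 ^ 2 ∂P) atTop (𝓝 (∫ x, x.1 ^ 2 ∂μ))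
  moment_snd : Tendsto (fun n => ∫ ω, (X n ω).2 ^ 2 ∂P) atTop (𝓝 (∫ x, x.2 ^ 2 ∂μ))
  moment_mixed :
    Tendsto (fun n => ∫ ω, (X n ω).1 * (X n ω).2 ∂P) atTop (𝓝 (∫ x, x.1 * x.2 ∂μ))

/-- `v log v + (1 - v) log (1 - v)`. -/
def entropy (v : ℝ) : ℝ := v * Real.log v + (1 - v) * Real.log (1 - v)

/-- The digamma function `Γ' / Γ` on the real line. -/
def digamma (x : ℝ) : ℝ := logDeriv Real.Gamma x

/-- The matrix with rows `((1 - v)², v (1 - v))` and `(0, 1 - v)`, applied to `x`. -/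
def applyA (v : ℝ) (x : ℝ × ℝ) : ℝ × ℝ :=
  ((1 - v) ^ 2 * x.1 + v * (1 - v) * x.2, (1 - v) * x.2)

/-- The matrix with rows `(v², v (1 - v))` and `(0, v)`, applied to `x`. -/
def applyB (v : ℝ) (x : ℝ × ℝ) : ℝ × ℝ :=
  (v ^ 2 * x.1 + v * (1 - v) * x.2, v * x.2)

/-- The additive term in the equation for the random recursive tree. -/
def bRecursive (v : ℝ) : ℝ × ℝ :=
  (3 * v * (1 - v) + entropy v, v + entropy v)

/-- The additive term `b*` in the equation for the Hoppe tree. -/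
def bHoppe (θ v : ℝ) : ℝ × ℝ :=
  (((θ + 5) / (θ + 1) - (2 * θ + 4) / (θ + 1) * v) * v + entropy v
      + (digamma (θ + 1) - digamma 2) * v,
   v + entropy v + (digamma (θ + 1) - digamma 2) * v)

/-- The law of `A(V) X* + B(V) X + b(V)`, where `V`, `X*`, `X` are independent, `V` is uniform on
`[0, 1]`, and `X*` and `X` both have law `ν`. -/
def recursiveMap (ν : Measure (ℝ × ℝ)) : Measure (ℝ × ℝ) :=
  ((volume.restrict (Set.Icc (0 : ℝ) 1)).prod (ν.prod ν)).map
    fun q => applyA q.1 q.2.1 + applyB q.1 q.2.2 + bRecursive q.1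

/-- The law of `A(V) X' + B(V) X + b*(V)`, where `V`, `X'`, `X` are independent, `V` has the
Beta(1, θ) distribution, `X'` has law `μ`, and `X` has law `ν`. -/
def hoppeMap (θ : ℝ) (ν μ : Measure (ℝ × ℝ)) : Measure (ℝ × ℝ) :=
  ((betaMeasure 1 θ).prod (μ.prod ν)).map
    fun q => applyA q.1 q.2.1 + (applyB q.1 q.2.2 + bHoppe θ q.1)

end HoppeTree

end

/-! Cutting the edge between the two oldest vertices `0` and `1` splits the Hoppe tree on `m + 2`
vertices into a Hoppe tree containing `0` and a random recursive tree containing `1`, independent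
given their sizes (`shapeMean_succ_eq_urnMean`). The sizes follow a Pólya urn with initial weights
`θ` and `1`, whose second share tends in law to `V ~ Beta(1, θ)` (`tendsto_urnMean`). Path length
and Wiener index of the whole tree are affine in those of the parts; after scaling, the coefficients
are `A` and `B` at the share (`normShape_join`), and the toll, computed from the exact means, tends
to `b*` (`toll_fst`, `toll_snd`). So the limit law, once it exists, solves the fixed-point equation
(`IsL2Limit.hoppeMap_law`).

Existence of the limit comes from martingales. As vertices are attached one at a time, the path
length and the Wiener index, rescaled and centered (the Wiener index with a correction by the path
length when `θ ≠ 1`), have orthogonal centered increments. The variances of these are summable, by a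
second-moment bound on the depths of order `m log² m` (`IsRegularHoppe.integral_sqDepth_le`).
Convergence in `L²` yields convergence in distribution, of second moments and of mixed moments at
once, and the martingales also deliver the exact means. Expectations of functions of the shape
depend on `θ` alone (`IsRegularHoppe.integral_shape`), so a limit built on one probability space
serves all of them.

The two uniqueness statements need different contractions. In the Hoppe equation only the term with
`A(V)` is unknown; in the sup norm `A(v)` contracts by `1 - v`, whose mean is `θ / (θ + 1) < 1`. The
dual operator on bounded Lipschitz functions therefore shrinks Lipschitz constants, and no moment
assumption is required (`hoppeMap_fixedPoint_unique`). In the recursive equation both terms are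
unknown and the factors `1 - v` and `v` add up to `1`, so second moments are used instead: for a
coupling of two centered solutions the cross terms vanish, and the squared distance contracts by
`E(1 - V + V²) = 5/6` (`recursiveMap_fixedPoint_unique`). -/

noncomputable section
namespace HoppeTree

/-! ### Distances in the tree -/

/-- Distance matrix of the tree on `0, …, n - 1`, built by attaching the vertices one at a time. -/
def distMatrix (p : ℕ → ℕ) : ℕ → ℕ → ℕ → ℕ
  | 0, _, _ => 0
  | n + 1, i, j =>
    if i = n then (if j = n then 0 else distMatrix p n (p n) j + 1)
    else if j = n then distMatrix p n i (p n) + 1 else distMatrix p n i j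

/-- Every vertex `k ≥ 1` has a parent with a smaller label. -/
def IsParent (p : ℕ → ℕ) : Prop := ∀ k, 1 ≤ k → p k < k

variable {p : ℕ → ℕ}

lemma distMatrix_self (n i : ℕ) : distMatrix p n i i = 0 := by
  induction n with
  | zero => rfl
  | succ n ih => by_cases h : i = n <;> simp [distMatrix, h, ih]

lemma distMatrix_comm (n i j : ℕ) : distMatrix p n i j = distMatrix p n j i := by
  induction n generalizing i j with
  | zero => rfl
  | succ n ih =>
    simp only [distMatrix]
    split_ifs <;> simp_all

lemma distMatrix_succ_of_lt {n i j : ℕ} (hi : i < n) (hj : j < n) :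
    distMatrix p (n + 1) i j = distMatrix p n i j := by
  simp [distMatrix, hi.ne, hj.ne]

lemma distMatrix_succ_right {n i : ℕ} (hi : i < n) :
    distMatrix p (n + 1) i n = distMatrix p n i (p n) + 1 := by
  simp [distMatrix, hi.ne]

lemma distMatrix_succ_left {n j : ℕ} (hj : j < n) :
    distMatrix p (n + 1) n j = distMatrix p n (p n) j + 1 := by
  simp [distMatrix, hj.ne]

/-- The recursive distance is 1-Lipschitz along tree edges. This gives the lower bound on walk
lengths, while walks built along the recursion give the upper bound. -/
lemma distMatrix_parent (hp : IsParent p) {n i j : ℕ} (hi : i < n) (hj : 1 ≤ j) (hjn : j < n) :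
    distMatrix p n i j ≤ distMatrix p n i (p j) + 1 ∧
      distMatrix p n i (p j) ≤ distMatrix p n i j + 1 := by
  induction n generalizing i j with
  | zero => omega
  | succ n ih =>
    have hpj := hp j hj
    rcases Nat.lt_succ_iff_lt_or_eq.1 hi with hi' | rfl <;>
      rcases Nat.lt_succ_iff_lt_or_eq.1 hjn with hj' | rfl
    · rw [distMatrix_succ_of_lt hi' hj', distMatrix_succ_of_lt hi' (by omega)]
      exact ih hi' hj hj'
    · rw [distMatrix_succ_right hi', distMatrix_succ_of_lt hi' hpj]
      omega
    · rw [distMatrix_succ_left hj', distMatrix_succ_left (by omega)]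
      have := ih (hp i (by omega)) hj hj'
      omega
    · rw [distMatrix_self, distMatrix_succ_left hpj, distMatrix_self]
      omega

lemma tree_adj_parent (hp : IsParent p) {N : ℕ} {j : ℕ} (hj : 1 ≤ j) (hjN : j < N) :
    (tree p N).Adj ⟨j, hjN⟩ ⟨p j, (hp j hj).trans hjN⟩ := by
  rw [tree, SimpleGraph.fromRel_adj]
  refine ⟨?_, Or.inl ⟨hj, rfl⟩⟩
  have := hp j hj
  simp only [ne_eq, Fin.mk.injEq]
  omega

lemma exists_walk_length_eq_distMatrix (hp : IsParent p) {N n : ℕ} (hn : n ≤ N) {i j : ℕ}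
    (hi : i < n) (hj : j < n) :
    ∃ w : (tree p N).Walk ⟨i, hi.trans_le hn⟩ ⟨j, hj.trans_le hn⟩,
      w.length = distMatrix p n i j := by
  induction n generalizing i j with
  | zero => omega
  | succ n ih =>
    rcases Nat.lt_succ_iff_lt_or_eq.1 hi with hi' | rfl <;>
      rcases Nat.lt_succ_iff_lt_or_eq.1 hj with hj' | rfl
    · rw [distMatrix_succ_of_lt hi' hj']
      exact ih (by omega) hi' hj'
    · rw [distMatrix_succ_right hi']
      obtain ⟨w, hw⟩ := ih (by omega) hi' (hp j (by omega))
      exact ⟨w.concat (tree_adj_parent hp (by omega) hn).symm, by simp [hw]⟩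
    · rw [distMatrix_succ_left hj']
      obtain ⟨w, hw⟩ := ih (by omega) (hp i (by omega)) hj'
      exact ⟨w.cons (tree_adj_parent hp (by omega) hn), by simp [hw]⟩
    · exact ⟨.nil, by simp [distMatrix_self]⟩

lemma distMatrix_le_length (hp : IsParent p) {N : ℕ} {i a b : Fin N} (w : (tree p N).Walk a b) :
    distMatrix p N i b ≤ distMatrix p N i a + w.length := by
  induction w with
  | nil => simp
  | @cons u v w h q ih =>
    rw [SimpleGraph.Walk.length_cons]
    have : distMatrix p N i v ≤ distMatrix p N i u + 1 := by
      rw [tree, SimpleGraph.fromRel_adj] at h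
      rcases h.2 with ⟨h1, h2⟩ | ⟨h1, h2⟩
      · rw [← h2]
        exact (distMatrix_parent hp i.2 h1 u.2).2
      · rw [← h2]
        exact (distMatrix_parent hp i.2 h1 v.2).1
    omega

lemma tree_dist (hp : IsParent p) {N : ℕ} (i j : Fin N) :
    (tree p N).dist i j = distMatrix p N i j := by
  obtain ⟨w, hw⟩ := exists_walk_length_eq_distMatrix hp le_rfl i.2 j.2
  apply le_antisymm
  · rw [← hw]
    exact SimpleGraph.dist_le w
  · obtain ⟨w', hw'⟩ := SimpleGraph.Reachable.exists_walk_length_eq_dist ⟨w⟩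
    have := distMatrix_le_length (i := i) hp w'
    rw [distMatrix_self, hw'] at this
    simpa using this

lemma totalLength_eq (hp : IsParent p) (n : ℕ) :
    totalLength p n = ∑ k ∈ Finset.range n, distMatrix p n 0 k := by
  rw [totalLength, Finset.sum_range]
  exact Finset.sum_congr rfl fun k _ => tree_dist hp _ _

/-- Summing over ordered pairs avoids the order on labels, which the splitting of the tree does not
respect. -/
lemma two_mul_wienerIndex (hp : IsParent p) (n : ℕ) :
    2 * wienerIndex p n = ∑ i ∈ Finset.range n, ∑ j ∈ Finset.range n, distMatrix p n i j := by
  rw [wienerIndex, Finset.sum_range]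
  simp_rw [Finset.sum_range, tree_dist hp]
  have key : ∀ i : Fin n, ∑ j : Fin n, distMatrix p n i j =
      ∑ j ∈ Finset.Ioi i, distMatrix p n i j + ∑ j ∈ Finset.Iio i, distMatrix p n i j := by
    intro i
    have hd : Disjoint (Finset.Ioi i) (Finset.Iio i) := by
      rw [Finset.disjoint_left]
      intro x hx hy
      simp only [Finset.mem_Ioi, Finset.mem_Iio] at hx hy
      exact absurd hx hy.not_gt
    rw [← Finset.sum_union hd]
    refine (Finset.sum_subset (Finset.subset_univ _) fun x _ hx => ?_).symm
    have : x = i := by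
      simp only [Finset.mem_union, Finset.mem_Ioi, Finset.mem_Iio, not_or, not_lt] at hx
      exact le_antisymm hx.1 hx.2
    rw [this, distMatrix_self]
  rw [Finset.sum_congr rfl fun i _ => key i, Finset.sum_add_distrib, two_mul]
  congr 1
  rw [Finset.sum_comm' (t' := Finset.univ) (s' := fun j => Finset.Iio j) (by simp)]
  exact Finset.sum_congr rfl fun i _ => Finset.sum_congr rfl fun j _ => distMatrix_comm _ _ _

/-! ### Shapes: splitting a tree at the edge between its two oldest vertices -/

/-- Trees up to relabelling, encoded as binary trees whose leaves are the vertices: `join r s`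
is the tree in which the root of `s` is attached as the oldest child of the root of `r`. -/
inductive Shape
  | leaf : Shape
  | join : Shape → Shape → Shape

namespace Shape

/-- Number of vertices. -/
def size : Shape → ℝ
  | leaf => 1
  | join r s => size r + size s

/-- Total path length. -/
def pathLength : Shape → ℝ
  | leaf => 0
  | join r s => pathLength r + pathLength s + size s

/-- Wiener index. -/
def wiener : Shape → ℝ
  | leaf => 0
  | join r s => wiener r + wiener s + size s * pathLength r + size r * pathLength s
      + size r * size s

end Shape

/-- Shapes with labelled vertices. -/
inductive LTree
  | leaf : ℕ → LTree
  | join : LTree → LTree → LTree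

namespace LTree

/-- Forget the labels. -/
def shape : LTree → Shape
  | leaf _ => .leaf
  | join r s => .join r.shape s.shape

/-- The set of labels. -/
def labels : LTree → Finset ℕ
  | leaf a => {a}
  | join r s => r.labels ∪ s.labels

/-- The label of the root. -/
def root : LTree → ℕ
  | leaf a => a
  | join r _ => r.root

/-- All labels are distinct. -/
def Nodup : LTree → Prop
  | leaf _ => True
  | join r s => r.Nodup ∧ s.Nodup ∧ Disjoint r.labels s.labels

/-- Distance to the root. -/
def depth : LTree → ℕ → ℕ
  | leaf _, _ => 0
  | join r s, x => if x ∈ r.labels then r.depth x else s.depth x + 1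

/-- Distance between two vertices. -/
def dist : LTree → ℕ → ℕ → ℕ
  | leaf _, _, _ => 0
  | join r s, x, y =>
    if x ∈ r.labels then (if y ∈ r.labels then r.dist x y else r.depth x + s.depth y + 1)
    else (if y ∈ r.labels then r.depth y + s.depth x + 1 else s.dist x y)

/-- Attach a new vertex `b` to the vertex `a`. -/
def grow (a b : ℕ) : LTree → LTree
  -- The new edge is inserted at the bottom, so it becomes the youngest child; the outermost `join`
  -- stays the edge between the two oldest vertices forever.
  | leaf c => if c = a then join (leaf c) (leaf b) else leaf c
  | join r s => join (r.grow a b) (s.grow a b)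

lemma root_mem (t : LTree) : t.root ∈ t.labels := by
  induction t with
  | leaf a => simp [root, labels]
  | join r s ihr _ => exact Finset.mem_union_left _ ihr

/-- For distinct labels this means that attaching a vertex changes only one side of a `join`. -/
lemma grow_of_notMem {t : LTree} {a b : ℕ} (h : a ∉ t.labels) : t.grow a b = t := by
  induction t with
  | leaf c =>
    simp only [labels, Finset.mem_singleton] at h
    simp [grow, Ne.symm h]
  | join r s ihr ihs =>
    simp only [labels, Finset.mem_union, not_or] at h
    simp [grow, ihr h.1, ihs h.2]

lemma labels_grow {t : LTree} {a b : ℕ} (h : a ∈ t.labels) :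
    (t.grow a b).labels = insert b t.labels := by
  induction t with
  | leaf c =>
    simp only [labels, Finset.mem_singleton] at h
    subst h
    ext x
    simp [grow, labels, or_comm]
  | join r s ihr ihs =>
    ext x
    simp only [labels, Finset.mem_union] at h
    simp only [grow, labels, Finset.mem_union, Finset.mem_insert]
    by_cases hr : a ∈ r.labels <;> by_cases hs : a ∈ s.labels
    · rw [ihr hr, ihs hs]
      simp only [Finset.mem_insert]
      tauto
    · rw [ihr hr, grow_of_notMem hs]
      simp only [Finset.mem_insert]
      tauto
    · rw [ihs hs, grow_of_notMem hr]
      simp only [Finset.mem_insert]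
      tauto
    · tauto

lemma root_grow (t : LTree) (a b : ℕ) : (t.grow a b).root = t.root := by
  induction t with
  | leaf c => by_cases h : c = a <;> simp [grow, root, h]
  | join r s ihr _ => simpa [grow, root] using ihr

lemma Nodup.grow {t : LTree} {a b : ℕ} (ht : t.Nodup) (hb : b ∉ t.labels) :
    (t.grow a b).Nodup := by
  induction t with
  | leaf c =>
    by_cases h : c = a
    · subst h
      simp only [labels, Finset.mem_singleton] at hb
      simp [LTree.grow, Nodup, labels, Ne.symm hb]
    · simp [LTree.grow, h, Nodup]
  | join r s ihr ihs =>
    obtain ⟨h1, h2, h3⟩ := ht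
    simp only [labels, Finset.mem_union, not_or] at hb
    refine ⟨ihr h1 hb.1, ihs h2 hb.2, ?_⟩
    by_cases hr : a ∈ r.labels
    · have hs : a ∉ s.labels := Finset.disjoint_left.1 h3 hr
      rw [labels_grow hr, grow_of_notMem hs, Finset.disjoint_insert_left]
      exact ⟨hb.2, h3⟩
    · rw [grow_of_notMem hr]
      by_cases hs : a ∈ s.labels
      · rw [labels_grow hs, Finset.disjoint_insert_right]
        exact ⟨hb.1, h3⟩
      · rwa [grow_of_notMem hs]

lemma depth_grow {t : LTree} {a b x : ℕ} (hb : b ∉ t.labels) (hx : x ∈ t.labels) :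
    (t.grow a b).depth x = t.depth x := by
  induction t with
  | leaf c =>
    simp only [labels, Finset.mem_singleton] at hx
    by_cases h : c = a <;> simp [LTree.grow, h, depth, labels, hx]
  | join r s ihr ihs =>
    simp only [labels, Finset.mem_union, not_or] at hb hx
    have hxb : x ≠ b := by rintro rfl; tauto
    have hmem : x ∈ (r.grow a b).labels ↔ x ∈ r.labels := by
      by_cases hr : a ∈ r.labels
      · simp [labels_grow hr, hxb]
      · rw [grow_of_notMem hr]
    simp only [LTree.grow, depth, hmem]
    split_ifs with h
    · exact ihr hb.1 h
    · rw [ihs hb.2 (by tauto)]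

lemma depth_grow_new {t : LTree} {a b : ℕ} (ht : t.Nodup) (hb : b ∉ t.labels)
    (ha : a ∈ t.labels) : (t.grow a b).depth b = t.depth a + 1 := by
  induction t with
  | leaf c =>
    simp only [labels, Finset.mem_singleton] at hb ha
    subst ha
    simp [LTree.grow, depth, labels, hb]
  | join r s ihr ihs =>
    obtain ⟨h1, h2, h3⟩ := ht
    simp only [labels, Finset.mem_union, not_or] at hb ha
    simp only [LTree.grow, depth]
    by_cases hr : a ∈ r.labels
    · simp [labels_grow hr, hr, ihr h1 hb.1 hr]
    · simp [grow_of_notMem hr, hr, hb.1, ihs h2 hb.2 (by tauto)]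

lemma dist_grow {t : LTree} {a b x y : ℕ} (hb : b ∉ t.labels) (hx : x ∈ t.labels)
    (hy : y ∈ t.labels) : (t.grow a b).dist x y = t.dist x y := by
  induction t with
  | leaf c =>
    simp only [labels, Finset.mem_singleton] at hx hy
    by_cases h : c = a <;> simp [LTree.grow, h, dist, labels, hx, hy]
  | join r s ihr ihs =>
    simp only [labels, Finset.mem_union, not_or] at hb hx hy
    have hmem : ∀ z, z ≠ b → (z ∈ (r.grow a b).labels ↔ z ∈ r.labels) := by
      intro z hz
      by_cases hr : a ∈ r.labels
      · simp [labels_grow hr, hz]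
      · rw [grow_of_notMem hr]
    have hxb : x ≠ b := by rintro rfl; tauto
    have hyb : y ≠ b := by rintro rfl; tauto
    simp only [LTree.grow, dist, hmem x hxb, hmem y hyb]
    split_ifs with h1 h2 h2
    · exact ihr hb.1 h1 h2
    · rw [depth_grow hb.1 h1, depth_grow hb.2 (by tauto)]
    · rw [depth_grow hb.1 h2, depth_grow hb.2 (by tauto)]
    · exact ihs hb.2 (by tauto) (by tauto)

lemma dist_comm (t : LTree) (x y : ℕ) : t.dist x y = t.dist y x := by
  induction t with
  | leaf c => rfl
  | join r s ihr ihs =>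
    simp only [dist]
    split_ifs
    · exact ihr
    · rfl
    · rfl
    · exact ihs

lemma dist_self (t : LTree) (x : ℕ) : t.dist x x = 0 := by
  induction t with
  | leaf c => rfl
  | join r s ihr ihs =>
    simp only [dist]
    split_ifs
    · exact ihr
    · exact ihs

lemma depth_root (t : LTree) : t.depth t.root = 0 := by
  induction t with
  | leaf c => rfl
  | join r s ihr ihs => simp [depth, root, root_mem, ihr]

lemma dist_root (t : LTree) {x : ℕ} (hx : x ∈ t.labels) : t.dist t.root x = t.depth x := by
  induction t with
  | leaf c => rfl
  | join r s ihr ihs =>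
    simp only [dist, depth, root, root_mem, if_true]
    split_ifs with h
    · exact ihr h
    · rw [depth_root, zero_add]

/-- Every path to the new leaf passes through its parent. When `x` and `a` lie on different sides,
the extra edge shows up in the depth instead. -/
lemma dist_grow_new {t : LTree} {a b x : ℕ} (ht : t.Nodup) (hb : b ∉ t.labels)
    (ha : a ∈ t.labels) (hx : x ∈ t.labels) : (t.grow a b).dist x b = t.dist x a + 1 := by
  induction t with
  | leaf c =>
    simp only [labels, Finset.mem_singleton] at hb ha hx
    subst ha
    subst hx
    simp [LTree.grow, dist, labels, hb, depth]
  | join r s ihr ihs =>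
    obtain ⟨h1, h2, h3⟩ := ht
    simp only [labels, Finset.mem_union, not_or] at hb ha hx
    have hxb : x ≠ b := by rintro rfl; tauto
    simp only [LTree.grow, dist]
    by_cases hr : a ∈ r.labels
    · have hs : a ∉ s.labels := Finset.disjoint_left.1 h3 hr
      simp only [labels_grow hr, Finset.mem_insert, hxb, false_or, true_or, if_true, hr,
        grow_of_notMem hs]
      split_ifs with h
      · exact ihr h1 hb.1 hr h
      · rw [depth_grow_new h1 hb.1 hr]
        omega
    · simp only [grow_of_notMem hr, hb.1, hr, if_false]
      have hs : a ∈ s.labels := by tauto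
      split_ifs with h
      · rw [depth_grow_new h2 hb.2 hs]
        omega
      · exact ihs h2 hb.2 hs (by tauto)

lemma size_shape {t : LTree} (ht : t.Nodup) : t.shape.size = t.labels.card := by
  induction t with
  | leaf c => simp [shape, Shape.size, labels]
  | join r s ihr ihs =>
    obtain ⟨h1, h2, h3⟩ := ht
    simp [shape, Shape.size, labels, Finset.card_union_of_disjoint h3, ihr h1, ihs h2]

lemma pathLength_shape {t : LTree} (ht : t.Nodup) :
    t.shape.pathLength = ∑ x ∈ t.labels, (t.depth x : ℝ) := by
  induction t with
  | leaf c => simp [shape, Shape.pathLength, labels, depth]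
  | join r s ihr ihs =>
    obtain ⟨h1, h2, h3⟩ := ht
    simp only [shape, Shape.pathLength, labels, depth]
    rw [Finset.sum_union h3, ihr h1, ihs h2, size_shape h2]
    have e1 : ∀ x ∈ r.labels, ((if x ∈ r.labels then r.depth x else s.depth x + 1 : ℕ) : ℝ)
        = r.depth x := fun x hx => by simp [hx]
    have e2 : ∀ x ∈ s.labels, ((if x ∈ r.labels then r.depth x else s.depth x + 1 : ℕ) : ℝ)
        = s.depth x + 1 := fun x hx => by simp [Finset.disjoint_right.1 h3 hx]
    rw [Finset.sum_congr rfl e1, Finset.sum_congr rfl e2, Finset.sum_add_distrib]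
    simp [add_assoc]

/-- Pairs across the cut are joined through both roots, at distance `depth x + depth y + 1`; summing
these over all cross pairs gives the mixed terms of `Shape.wiener`. -/
lemma two_mul_wiener_shape {t : LTree} (ht : t.Nodup) :
    2 * t.shape.wiener = ∑ x ∈ t.labels, ∑ y ∈ t.labels, (t.dist x y : ℝ) := by
  induction t with
  | leaf c => simp [shape, Shape.wiener, labels, dist]
  | join r s ihr ihs =>
    obtain ⟨h1, h2, h3⟩ := ht
    have ihr := ihr h1
    have ihs := ihs h2
    have e1 : ∀ x ∈ r.labels, ∑ y ∈ r.labels ∪ s.labels, ((join r s).dist x y : ℝ)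
        = ∑ y ∈ r.labels, (r.dist x y : ℝ)
          + (s.labels.card * r.depth x + s.shape.pathLength + s.labels.card) := by
      intro x hx
      rw [Finset.sum_union h3]
      congr 1
      · exact Finset.sum_congr rfl fun y hy => by simp [dist, hx, hy]
      · rw [pathLength_shape h2, Finset.sum_congr rfl (g := fun y => (r.depth x : ℝ) + s.depth y + 1)
          fun y hy => by simp [dist, hx, Finset.disjoint_right.1 h3 hy]]
        simp [Finset.sum_add_distrib]
    have e2 : ∀ x ∈ s.labels, ∑ y ∈ r.labels ∪ s.labels, ((join r s).dist x y : ℝ)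
        = (r.labels.card * s.depth x + r.shape.pathLength + r.labels.card)
          + ∑ y ∈ s.labels, (s.dist x y : ℝ) := by
      intro x hx
      have hx' := Finset.disjoint_right.1 h3 hx
      rw [Finset.sum_union h3]
      congr 1
      · rw [pathLength_shape h1, Finset.sum_congr rfl (g := fun y => (r.depth y : ℝ) + s.depth x + 1)
          fun y hy => by simp [dist, hx', hy]]
        simp [Finset.sum_add_distrib]
        ring
      · exact Finset.sum_congr rfl fun y hy => by
          simp [dist, hx', Finset.disjoint_right.1 h3 hy]
    simp only [shape, Shape.wiener, labels]
    rw [Finset.sum_union h3, Finset.sum_congr rfl e1, Finset.sum_congr rfl e2]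
    simp only [Finset.sum_add_distrib, ← Finset.mul_sum, Finset.sum_const, nsmul_eq_mul,
      ← pathLength_shape h1, ← pathLength_shape h2, ← ihr, ← ihs, size_shape h1, size_shape h2]
    ring

end LTree

/-- The labelled shape of the tree on `0, …, n` with parent function `p`. -/
def ltree (p : ℕ → ℕ) : ℕ → LTree
  | 0 => .leaf 0
  | n + 1 => (ltree p n).grow (p (n + 1)) (n + 1)

/-- The shape of the tree on `0, …, n - 1` with parent function `p`. -/
def shapeOf (p : ℕ → ℕ) (n : ℕ) : Shape := (ltree p (n - 1)).shape

lemma ltree_labels (hp : IsParent p) (n : ℕ) : (ltree p n).labels = Finset.range (n + 1) := by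
  induction n with
  | zero => rfl
  | succ n ih =>
    have h := hp (n + 1) (by omega)
    rw [ltree, LTree.labels_grow (by rw [ih]; simpa using h), ih, ← Finset.range_add_one]

lemma ltree_root (n : ℕ) : (ltree p n).root = 0 := by
  induction n with
  | zero => rfl
  | succ n ih => rw [ltree, LTree.root_grow, ih]

lemma ltree_nodup (hp : IsParent p) (n : ℕ) : (ltree p n).Nodup := by
  induction n with
  | zero => trivial
  | succ n ih => exact ih.grow (by simp [ltree_labels hp])

/-- Both sides obey the same recursion when a vertex is attached. -/
lemma ltree_dist (hp : IsParent p) {n i j : ℕ} (hi : i < n + 1) (hj : j < n + 1) :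
    (ltree p n).dist i j = distMatrix p (n + 1) i j := by
  induction n generalizing i j with
  | zero =>
    obtain rfl : i = 0 := by omega
    obtain rfl : j = 0 := by omega
    simp [distMatrix_self, LTree.dist_self]
  | succ n ih =>
    have hpn := hp (n + 1) (by omega)
    have hmem : ∀ k, k < n + 1 → k ∈ (ltree p n).labels := fun k hk => by
      simpa [ltree_labels hp] using hk
    have hnew : n + 1 ∉ (ltree p n).labels := by simp [ltree_labels hp]
    rcases (show i ≤ n + 1 by omega).lt_or_eq with hi' | rfl <;>
      rcases (show j ≤ n + 1 by omega).lt_or_eq with hj' | rfl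
    · rw [distMatrix_succ_of_lt hi' hj', ltree, LTree.dist_grow hnew (hmem _ hi') (hmem _ hj'),
        ih hi' hj']
    · rw [distMatrix_succ_right hi', ltree, LTree.dist_grow_new (ltree_nodup hp n) hnew
        (hmem _ hpn) (hmem _ hi'), ih hi' hpn]
    · rw [distMatrix_succ_left hj', ltree, LTree.dist_comm, LTree.dist_grow_new (ltree_nodup hp n)
        hnew (hmem _ hpn) (hmem _ hj'), ih hj' hpn, distMatrix_comm]
    · rw [distMatrix_self, LTree.dist_self]

lemma pathLength_shapeOf (hp : IsParent p) {n : ℕ} (hn : 1 ≤ n) :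
    (shapeOf p n).pathLength = totalLength p n := by
  obtain ⟨n, rfl⟩ : ∃ m, n = m + 1 := ⟨n - 1, by omega⟩
  rw [shapeOf, Nat.add_sub_cancel, LTree.pathLength_shape (ltree_nodup hp n), totalLength_eq hp,
    ltree_labels hp, Nat.cast_sum]
  refine Finset.sum_congr rfl fun x hx => ?_
  rw [Finset.mem_range] at hx
  rw [← ltree_dist hp (by omega) hx, ← LTree.dist_root _ (by simpa [ltree_labels hp] using hx),
    ltree_root]

lemma wiener_shapeOf (hp : IsParent p) {n : ℕ} (hn : 1 ≤ n) :
    (shapeOf p n).wiener = wienerIndex p n := by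
  obtain ⟨n, rfl⟩ : ∃ m, n = m + 1 := ⟨n - 1, by omega⟩
  have h1 := LTree.two_mul_wiener_shape (ltree_nodup hp n)
  have h2 := congrArg (Nat.cast (R := ℝ)) (two_mul_wienerIndex hp (n + 1))
  push_cast at h2
  have h3 : 2 * (ltree p n).shape.wiener = 2 * wienerIndex p (n + 1) := by
    rw [h1, h2, ltree_labels hp]
    refine Finset.sum_congr rfl fun x hx => Finset.sum_congr rfl fun y hy => ?_
    rw [Finset.mem_range] at hx hy
    rw [ltree_dist hp hx hy]
  rw [shapeOf, Nat.add_sub_cancel]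
  linarith

/-! ### Expectations over the shape of a Hoppe tree -/

/-- Sum of `F` over all the ways to attach a new vertex, the root having weight `θ` and all other
vertices having weight `1`. -/
def growSum : Shape → ℝ → (Shape → ℝ) → ℝ
  | .leaf, θ, F => θ * F (.join .leaf .leaf)
  | .join r s, θ, F =>
    -- The root of `s` is an ordinary vertex of the joined tree, so it loses the special weight;
    -- this is why the second part is a random recursive tree.
    growSum r θ (fun t => F (.join t s)) + growSum s 1 (fun t => F (.join r t))

/-- Expectation of `F` over the shape of the Hoppe tree with `n + 1` vertices. -/
def shapeMean (θ : ℝ) : ℕ → (Shape → ℝ) → ℝ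
  | 0, F => F .leaf
  | n + 1, F => shapeMean θ n fun t => growSum t θ F / (θ + n)

/-- Expectation of `h` over the composition of the urn that starts with weights `θ` and `1`, after
`m` draws of which `i` are of the first and `j` of the second kind. -/
def urnMean (θ : ℝ) : ℕ → (ℕ → ℕ → ℝ) → ℝ
  | 0, h => h 0 0
  | m + 1, h =>
    urnMean θ m fun i j => ((θ + i) * h (i + 1) j + (j + 1) * h i (j + 1)) / (θ + m + 1)

lemma growSum_add (t : Shape) (θ : ℝ) (F G : Shape → ℝ) :
    growSum t θ (fun s => F s + G s) = growSum t θ F + growSum t θ G := by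
  induction t generalizing θ F G with
  | leaf => simp [growSum, mul_add]
  | join r s ihr ihs => simp only [growSum, ihr, ihs]; ring

lemma growSum_mul (t : Shape) (θ c : ℝ) (F : Shape → ℝ) :
    growSum t θ (fun s => c * F s) = c * growSum t θ F := by
  induction t generalizing θ F with
  | leaf => simp only [growSum]; ring
  | join r s ihr ihs => simp only [growSum, ihr, ihs]; ring

lemma shapeMean_add (θ : ℝ) (n : ℕ) (F G : Shape → ℝ) :
    shapeMean θ n (fun s => F s + G s) = shapeMean θ n F + shapeMean θ n G := by
  induction n generalizing F G with
  | zero => rfl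
  | succ n ih => simp only [shapeMean, growSum_add, add_div, ih]

lemma shapeMean_mul (θ : ℝ) (n : ℕ) (c : ℝ) (F : Shape → ℝ) :
    shapeMean θ n (fun s => c * F s) = c * shapeMean θ n F := by
  induction n generalizing F with
  | zero => rfl
  | succ n ih => simp only [shapeMean, growSum_mul, mul_div_assoc, ih]

/-- Interchange of two finite weighted sums; it lets growth of one part commute with averaging over
the other. -/
lemma growSum_shapeMean (r : Shape) (θ θ' : ℝ) (j : ℕ) (F : Shape → Shape → ℝ) :
    growSum r θ (fun r' => shapeMean θ' j (F r'))
      = shapeMean θ' j (fun s => growSum r θ fun r' => F r' s) := by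
  induction r generalizing θ F with
  | leaf => simp only [growSum, shapeMean_mul]
  | join r s ihr ihs => simp only [growSum, shapeMean_add, ihr, ihs]

lemma shapeMean_succ_mul {θ : ℝ} (hθ : 0 < θ) (n : ℕ) (F : Shape → ℝ) :
    (θ + n) * shapeMean θ (n + 1) F = shapeMean θ n fun t => growSum t θ F := by
  have : θ + n ≠ 0 := by positivity
  simp only [shapeMean, div_eq_inv_mul, shapeMean_mul]
  field_simp

lemma urnMean_add (θ : ℝ) (m : ℕ) (h g : ℕ → ℕ → ℝ) :
    urnMean θ m (fun i j => h i j + g i j) = urnMean θ m h + urnMean θ m g := by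
  induction m generalizing h g with
  | zero => rfl
  | succ m ih =>
    simp only [urnMean]
    rw [← ih]
    congr 1
    ext i j
    ring

lemma urnMean_mul (θ : ℝ) (m : ℕ) (c : ℝ) (h : ℕ → ℕ → ℝ) :
    urnMean θ m (fun i j => c * h i j) = c * urnMean θ m h := by
  induction m generalizing h with
  | zero => rfl
  | succ m ih =>
    simp only [urnMean]
    rw [← ih]
    congr 1
    ext i j
    ring

lemma urnMean_sum {ι : Type*} (θ : ℝ) (m : ℕ) (s : Finset ι) (h : ι → ℕ → ℕ → ℝ) :
    urnMean θ m (fun i j => ∑ a ∈ s, h a i j) = ∑ a ∈ s, urnMean θ m (h a) := by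
  classical
  induction s using Finset.induction_on with
  | empty => simpa using urnMean_mul θ m 0 (fun _ _ => 0)
  | insert a s ha ih => simp only [Finset.sum_insert ha, urnMean_add, ih]

lemma urnMean_mono {θ : ℝ} (hθ : 0 < θ) {m : ℕ} {h g : ℕ → ℕ → ℝ}
    (hg : ∀ i j, i + j = m → h i j ≤ g i j) : urnMean θ m h ≤ urnMean θ m g := by
  induction m generalizing h g with
  | zero => exact hg 0 0 rfl
  | succ m ih =>
    refine ih fun i j hij => ?_
    have h1 := hg (i + 1) j (by omega)
    have h2 := hg i (j + 1) (by omega)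
    gcongr

lemma urnMean_congr {θ : ℝ} (hθ : 0 < θ) {m : ℕ} {h g : ℕ → ℕ → ℝ}
    (hg : ∀ i j, i + j = m → h i j = g i j) : urnMean θ m h = urnMean θ m g :=
  le_antisymm (urnMean_mono hθ fun i j hij => (hg i j hij).le)
    (urnMean_mono hθ fun i j hij => (hg i j hij).ge)

lemma urnMean_const {θ : ℝ} (hθ : 0 < θ) (m : ℕ) (c : ℝ) :
    urnMean θ m (fun _ _ => c) = c := by
  induction m with
  | zero => rfl
  | succ m ih =>
    simp only [urnMean]
    refine (urnMean_congr hθ fun i j hij => ?_).trans ih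
    have : θ + m + 1 ≠ 0 := by positivity
    rw [← hij] at this ⊢
    push_cast at this ⊢
    field_simp
    ring

/-- Splitting the Hoppe tree at the edge between its two oldest vertices. -/
lemma shapeMean_succ_eq_urnMean {θ : ℝ} (hθ : 0 < θ) (m : ℕ) (F : Shape → ℝ) :
    shapeMean θ (m + 1) F = urnMean θ m fun i j =>
      shapeMean θ i fun r => shapeMean 1 j fun s => F (.join r s) := by
  induction m generalizing F with
  | zero =>
    simp only [shapeMean, growSum, urnMean, Nat.cast_zero, add_zero]
    field_simp
  | succ m ih =>
    rw [shapeMean, ih, urnMean]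
    refine urnMean_congr hθ fun i j _ => ?_
    -- The new vertex enters the first part with weight `θ + i` and the second with weight `1 + j`,
    -- which are the urn's transition weights; given the part, it is attached as in a tree of that
    -- kind.
    have e1 : shapeMean θ i (fun r => shapeMean 1 j fun s => growSum r θ fun r' => F (.join r' s))
        = (θ + i) * shapeMean θ (i + 1) fun r => shapeMean 1 j fun s => F (.join r s) := by
      rw [shapeMean_succ_mul hθ]
      congr 1
      ext r
      exact (growSum_shapeMean r θ 1 j _).symm
    have e2 : shapeMean θ i (fun r => shapeMean 1 j fun s => growSum s 1 fun s' => F (.join r s'))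
        = (j + 1) * shapeMean θ i fun r => shapeMean 1 (j + 1) fun s => F (.join r s) := by
      simp_rw [← shapeMean_succ_mul one_pos, shapeMean_mul]
      ring
    simp only [growSum, div_eq_inv_mul, shapeMean_mul, shapeMean_add, e1, e2]
    push_cast
    ring

/-- Bridge between attaching to a labelled vertex and the label-free `growSum`. -/
lemma LTree.sum_grow {t : LTree} (ht : t.Nodup) (b : ℕ) (θ : ℝ) (F : Shape → ℝ) :
    ∑ a ∈ t.labels, (if a = t.root then θ else 1) * F (t.grow a b).shape
      = growSum t.shape θ F := by
  induction t generalizing θ F with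
  | leaf c => simp [LTree.labels, LTree.root, LTree.grow, LTree.shape, growSum]
  | join r s ihr ihs =>
    obtain ⟨h1, h2, h3⟩ := ht
    simp only [LTree.labels, LTree.shape, growSum, LTree.grow]
    rw [Finset.sum_union h3, ← ihr h1, ← ihs h2]
    congr 1
    · refine Finset.sum_congr rfl fun a ha => ?_
      rw [LTree.grow_of_notMem (Finset.disjoint_left.1 h3 ha)]
      rfl
    · refine Finset.sum_congr rfl fun a ha => ?_
      have h := Finset.disjoint_right.1 h3 ha
      have hr : a ≠ (LTree.join r s).root := fun e => h (e ▸ r.root_mem)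
      rw [LTree.grow_of_notMem h, if_neg hr, ite_self]

/-! ### The limit of the urn -/

/-- The rising factorial `x (x + 1) ⋯ (x + q - 1)`. -/
def rise (x : ℝ) (q : ℕ) : ℝ := ∏ l ∈ Finset.range q, (x + l)

lemma rise_pos {x : ℝ} (hx : 0 < x) (q : ℕ) : 0 < rise x q :=
  Finset.prod_pos fun l _ => by positivity

lemma mul_rise_add_one (x : ℝ) (q : ℕ) : x * rise (x + 1) q = rise x q * (x + q) := by
  have h1 : rise x (q + 1) = rise x q * (x + q) := Finset.prod_range_succ _ _
  rw [← h1, rise, rise, Finset.prod_range_succ', mul_comm]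
  congr 1
  · refine Finset.prod_congr rfl fun l _ => ?_
    push_cast
    ring
  · simp

lemma rise_one (q : ℕ) : rise 1 q = (q.factorial : ℝ) := by
  induction q with
  | zero => simp [rise]
  | succ q ih =>
    rw [rise, Finset.prod_range_succ, ← rise, ih, Nat.factorial_succ]
    push_cast
    ring

lemma Gamma_add_nat {x : ℝ} (hx : 0 < x) (q : ℕ) :
    Real.Gamma (x + q) = rise x q * Real.Gamma x := by
  induction q with
  | zero => simp [rise]
  | succ q ih =>
    have : x + q ≠ 0 := by positivity
    rw [Nat.cast_succ, ← add_assoc, Real.Gamma_add_one this, ih, rise, rise,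
      Finset.prod_range_succ]
    ring

/-- Rising factorials of the second colour are eigenfunctions of the urn: a draw at total weight `θ
+ m + 1` multiplies their mean by `(θ + m + 1 + q) / (θ + m + 1)`. Hence all moments are explicit.
-/
lemma urnMean_rise {θ : ℝ} (hθ : 0 < θ) (m q : ℕ) :
    urnMean θ m (fun _ j => rise (j + 1) q)
      = q.factorial * rise (θ + m + 1) q / rise (θ + 1) q := by
  have h0 := (rise_pos (show 0 < θ + 1 by positivity) q).ne'
  induction m with
  | zero =>
    simp only [urnMean, Nat.cast_zero, zero_add, add_zero, rise_one]
    field_simp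
  | succ m ih =>
    have hm : θ + m + 1 ≠ 0 := by positivity
    have e := mul_rise_add_one (θ + m + 1) q
    have : urnMean θ (m + 1) (fun _ j => rise (j + 1) q)
        = (θ + m + 1 + q) / (θ + m + 1) * urnMean θ m (fun _ j => rise (j + 1) q) := by
      rw [urnMean, ← urnMean_mul]
      refine urnMean_congr hθ fun i j hij => ?_
      have e' := mul_rise_add_one ((j : ℝ) + 1) q
      have hm' : (m : ℝ) = i + j := by rw [← hij]; push_cast; rfl
      rw [div_mul_eq_mul_div]
      congr 1
      push_cast
      rw [e', hm']
      ring
    rw [this, ih]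
    push_cast
    rw [← add_assoc θ (m : ℝ) 1]
    have e2 : rise (θ + m + 1 + 1) q = rise (θ + m + 1) q * (θ + m + 1 + q) / (θ + m + 1) := by
      rw [← e]
      field_simp
    rw [e2]
    field_simp

lemma abs_rise_div_pow_sub_le (q : ℕ) :
    ∃ C : ℝ, 0 ≤ C ∧ ∀ k n : ℝ, 0 ≤ k → k ≤ n → 1 ≤ n →
      |rise k q / n ^ q - (k / n) ^ q| ≤ C / n := by
  induction q with
  | zero => exact ⟨0, le_rfl, fun k n _ _ _ => by simp [rise]⟩
  | succ q ih =>
    obtain ⟨C, hC, h⟩ := ih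
    -- The last factor `k + q` is split: `k / n ≤ 1` carries the old error `C / n`, and `q / n`
    -- multiplies a product bounded by `C + 1`.
    refine ⟨C + (C + 1) * q, by positivity, fun k n hk hkn hn => ?_⟩
    have hn0 : 0 < n := by linarith
    have h1 := h k n hk hkn hn
    have hx : k / n ≤ 1 := (div_le_one hn0).2 hkn
    have hx0 : 0 ≤ k / n := by positivity
    have e : rise k (q + 1) / n ^ (q + 1) - (k / n) ^ (q + 1)
        = (rise k q / n ^ q - (k / n) ^ q) * (k / n) + rise k q / n ^ q * (q / n) := by
      rw [rise, Finset.prod_range_succ, ← rise, div_pow, div_pow, pow_succ, pow_succ]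
      field_simp
      ring
    have hCn : C / n ≤ C := div_le_self hC hn
    have h2 : |rise k q / n ^ q| ≤ C + 1 := by
      have h3 : |(k / n) ^ q| ≤ 1 := by
        rw [abs_of_nonneg (by positivity)]
        exact pow_le_one₀ hx0 hx
      calc |rise k q / n ^ q|
          = |(rise k q / n ^ q - (k / n) ^ q) + (k / n) ^ q| := by ring_nf
        _ ≤ C / n + 1 := (abs_add_le _ _).trans (add_le_add h1 h3)
        _ ≤ C + 1 := by linarith
    rw [e]
    calc _ ≤ |rise k q / n ^ q - (k / n) ^ q| * (k / n) + |rise k q / n ^ q| * (q / n) := by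
          refine (abs_add_le _ _).trans ?_
          rw [abs_mul, abs_mul, abs_of_nonneg hx0, abs_of_nonneg (show 0 ≤ (q : ℝ) / n by positivity)]
      _ ≤ C / n * 1 + (C + 1) * (q / n) := by gcongr
      _ = (C + (C + 1) * q) / n := by ring

/-- The proportion of the second colour in the urn. -/
def share (m j : ℕ) : ℝ := (j + 1) / (m + 2)

lemma share_nonneg (m j : ℕ) : 0 ≤ share m j := by unfold share; positivity

/-- After `m` draws the parts have `i + 1` and `j + 1` of the `m + 2` vertices, so `share` is a
proportion of vertices and not of urn weights. -/
lemma one_sub_share {i j m : ℕ} (h : i + j = m) : 1 - share m j = (i + 1) / (m + 2) := by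
  rw [share, ← h]
  push_cast
  field_simp
  ring

lemma share_le_one {i j m : ℕ} (h : i + j = m) : share m j ≤ 1 := by
  have := one_sub_share h
  have h2 : (0 : ℝ) ≤ (i + 1) / (m + 2) := by positivity
  linarith

lemma tendsto_rise_div_pow (θ : ℝ) (q : ℕ) :
    Tendsto (fun m : ℕ => rise (θ + m + 1) q / ((m : ℝ) + 2) ^ q) atTop (𝓝 1) := by
  have h : ∀ l : ℕ, Tendsto (fun m : ℕ => (θ + m + 1 + l) / ((m : ℝ) + 2)) atTop (𝓝 1) := by
    intro l
    have h1 : Tendsto (fun m : ℕ => 1 + (θ + l - 1) / ((m : ℝ) + 2)) atTop (𝓝 (1 + 0)) := by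
      refine tendsto_const_nhds.add (tendsto_const_nhds.div_atTop ?_)
      exact tendsto_atTop_add_const_right _ _ tendsto_natCast_atTop_atTop
    rw [add_zero] at h1
    refine h1.congr fun m => ?_
    field_simp
    ring
  have := tendsto_finsetProd (Finset.range q) fun l _ => h l
  simp only [Finset.prod_const_one] at this
  refine this.congr fun m => ?_
  rw [Finset.prod_div_distrib, Finset.prod_const, Finset.card_range, rise]

lemma tendsto_urnMean_pow {θ : ℝ} (hθ : 0 < θ) (q : ℕ) :
    Tendsto (fun m => urnMean θ m fun _ j => share m j ^ q) atTop
      (𝓝 (q.factorial / rise (θ + 1) q)) := by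
  have h1 : Tendsto (fun m : ℕ => urnMean θ m fun _ j => rise (j + 1) q / ((m : ℝ) + 2) ^ q) atTop
      (𝓝 (q.factorial / rise (θ + 1) q)) := by
    have := (tendsto_rise_div_pow θ q).const_mul ((q.factorial : ℝ) / rise (θ + 1) q)
    rw [mul_one] at this
    refine this.congr fun m => ?_
    simp only [div_eq_inv_mul _ (((m : ℝ) + 2) ^ q)]
    rw [urnMean_mul, urnMean_rise hθ]
    ring
  obtain ⟨C, hC, hb⟩ := abs_rise_div_pow_sub_le q
  have hb' : ∀ m i j : ℕ, i + j = m →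
      |rise (j + 1) q / ((m : ℝ) + 2) ^ q - share m j ^ q| ≤ C / (m + 2) := by
    intro m i j hij
    refine hb _ _ (by positivity) ?_ (by linarith [(Nat.cast_nonneg m : (0 : ℝ) ≤ m)])
    rw [← hij]
    push_cast
    linarith [(Nat.cast_nonneg i : (0 : ℝ) ≤ i)]
  have hC0 : Tendsto (fun m : ℕ => C / ((m : ℝ) + 2)) atTop (𝓝 0) :=
    tendsto_const_nhds.div_atTop
      (tendsto_atTop_add_const_right _ _ tendsto_natCast_atTop_atTop)
  refine tendsto_of_tendsto_of_tendsto_of_le_of_le (f := fun m => urnMean θ m fun _ j => share m j ^ q)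
    (g := fun m : ℕ => (urnMean θ m fun _ j => rise (j + 1) q / ((m : ℝ) + 2) ^ q) - C / (m + 2))
    (h := fun m : ℕ => (urnMean θ m fun _ j => rise (j + 1) q / ((m : ℝ) + 2) ^ q) + C / (m + 2))
    (by simpa using h1.sub hC0) (by simpa using h1.add hC0) (fun m => ?_) (fun m => ?_)
  · rw [sub_le_iff_le_add]
    calc _ ≤ urnMean θ m (fun _ j => share m j ^ q + C / (m + 2)) :=
          urnMean_mono hθ fun i j hij => by linarith [(abs_le.1 (hb' m i j hij)).2]
      _ = _ := by rw [urnMean_add, urnMean_const hθ]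
  · calc _ ≤ urnMean θ m (fun _ j => rise (j + 1) q / ((m : ℝ) + 2) ^ q + C / (m + 2)) :=
          urnMean_mono hθ fun i j hij => by linarith [(abs_le.1 (hb' m i j hij)).1]
      _ = _ := by rw [urnMean_add, urnMean_const hθ]

lemma ae_betaMeasure (θ : ℝ) : ∀ᵐ x ∂betaMeasure 1 θ, 0 < x ∧ x < 1 := by
  rw [betaMeasure, ae_withDensity_iff' (by unfold betaPDF; fun_prop)]
  refine ae_of_all _ fun x hx => ?_
  by_contra h
  exact hx (by simp [betaPDF_eq, h])

/-- Multiplying the Beta(1, θ) density by `x ^ q` gives a multiple of the Beta(1 + q, θ) density.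
The values agree with the limiting moments of the urn. -/
lemma integral_pow_betaMeasure {θ : ℝ} (hθ : 0 < θ) (q : ℕ) :
    ∫ x, x ^ q ∂betaMeasure 1 θ = q.factorial / rise (θ + 1) q := by
  have hq : (0 : ℝ) < 1 + q := by positivity
  have hm : ∀ α, Measurable (betaPDF α θ) := fun α => (measurable_betaPDFReal α θ).ennreal_ofReal
  rw [betaMeasure, integral_withDensity_eq_integral_toReal_smul (hm 1)
    (ae_of_all _ fun x => ENNReal.ofReal_lt_top)]
  have h1 : ∀ x, (betaPDF 1 θ x).toReal • x ^ q
      = beta (1 + q) θ / beta 1 θ * (betaPDF (1 + q) θ x).toReal := by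
    intro x
    have hb := (beta_pos hq hθ).ne'
    by_cases h : 0 < x ∧ x < 1
    · rw [betaPDF, betaPDF, ENNReal.toReal_ofReal (betaPDFReal_pos h.1 h.2 one_pos hθ).le,
        ENNReal.toReal_ofReal (betaPDFReal_pos h.1 h.2 hq hθ).le]
      simp only [betaPDFReal, h, and_self, if_true, smul_eq_mul]
      have : x ^ ((1 : ℝ) + q - 1) = x ^ q := by
        rw [add_sub_cancel_left, Real.rpow_natCast]
      rw [this]
      field_simp
      simp
    · simp [betaPDF_eq, h]
  simp_rw [h1]
  rw [integral_const_mul]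
  have h2 : ∫ x, (betaPDF (1 + q) θ x).toReal = 1 := by
    rw [integral_toReal (hm _).aemeasurable (ae_of_all _ fun x => ENNReal.ofReal_lt_top),
      lintegral_betaPDF_eq_one hq hθ, ENNReal.toReal_one]
  rw [h2, mul_one, beta, beta, show (1 : ℝ) + q + θ = (θ + 1) + q by ring,
    Gamma_add_nat one_pos, Gamma_add_nat (by positivity), rise_one, Real.Gamma_one, add_comm 1 θ]
  have := (Real.Gamma_pos_of_pos hθ).ne'
  have := (Real.Gamma_pos_of_pos (show 0 < θ + 1 by positivity)).ne'
  have := (rise_pos (show 0 < θ + 1 by positivity) q).ne'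
  field_simp

lemma integrable_betaMeasure {θ : ℝ} (hθ : 0 < θ) {g : ℝ → ℝ} (hg : Measurable g) {C : ℝ}
    (hC : ∀ x, 0 ≤ x → x ≤ 1 → |g x| ≤ C) : Integrable g (betaMeasure 1 θ) := by
  have := isProbabilityMeasureBeta one_pos hθ
  refine Integrable.of_bound hg.aestronglyMeasurable C ?_
  filter_upwards [ae_betaMeasure θ] with x hx
  exact hC x hx.1.le hx.2.le

/-- Method of moments: convergence holds for polynomials, and Weierstrass approximation on `[0, 1]`
extends it to continuous functions. -/
lemma tendsto_urnMean {θ : ℝ} (hθ : 0 < θ) {g : ℝ → ℝ} (hg : Continuous g) :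
    Tendsto (fun m => urnMean θ m fun _ j => g (share m j)) atTop
      (𝓝 (∫ x, g x ∂betaMeasure 1 θ)) := by
  have := isProbabilityMeasureBeta one_pos hθ
  have hInt : ∀ f : ℝ → ℝ, Continuous f → Integrable f (betaMeasure 1 θ) := by
    intro f hf
    obtain ⟨C, hC⟩ := isCompact_Icc.exists_bound_of_continuousOn (s := Set.Icc (0 : ℝ) 1)
      hf.continuousOn
    exact integrable_betaMeasure hθ hf.measurable fun x h0 h1 => hC x ⟨h0, h1⟩
  have hpoly : ∀ P : Polynomial ℝ, Tendsto (fun m => urnMean θ m fun _ j => P.eval (share m j))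
      atTop (𝓝 (∫ x, P.eval x ∂betaMeasure 1 θ)) := by
    intro P
    simp_rw [Polynomial.eval_eq_sum_range, urnMean_sum, urnMean_mul]
    rw [integral_finsetSum _ fun i _ => hInt _ (by fun_prop)]
    refine tendsto_finsetSum _ fun i _ => ?_
    rw [integral_const_mul, integral_pow_betaMeasure hθ]
    exact (tendsto_urnMean_pow hθ i).const_mul _
  rw [Metric.tendsto_atTop]
  intro ε hε
  obtain ⟨P, hP⟩ := exists_polynomial_near_of_continuousOn 0 1 g hg.continuousOn (ε / 3)
    (by positivity)
  obtain ⟨N, hN⟩ := Metric.tendsto_atTop.1 (hpoly P) (ε / 3) (by positivity)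
  refine ⟨N, fun m hm => ?_⟩
  have h1 : |(∫ x, P.eval x ∂betaMeasure 1 θ) - ∫ x, g x ∂betaMeasure 1 θ| ≤ ε / 3 := by
    rw [← integral_sub (hInt _ (by fun_prop)) (hInt _ hg)]
    have hb : ∀ᵐ x ∂betaMeasure 1 θ, ‖P.eval x - g x‖ ≤ ε / 3 := by
      filter_upwards [ae_betaMeasure θ] with x hx
      exact (hP x ⟨hx.1.le, hx.2.le⟩).le
    simpa using norm_integral_le_of_norm_le_const hb
  have h2 : |urnMean θ m (fun _ j => g (share m j)) - urnMean θ m (fun _ j => P.eval (share m j))|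
      ≤ ε / 3 := by
    have hj : ∀ i j, i + j = m → |P.eval (share m j) - g (share m j)| < ε / 3 :=
      fun i j hij => hP _ ⟨share_nonneg m j, share_le_one hij⟩
    rw [abs_sub_le_iff]
    constructor
    · rw [sub_le_iff_le_add, ← urnMean_const hθ m (ε / 3), ← urnMean_add]
      exact urnMean_mono hθ fun i j hij => by linarith [(abs_lt.1 (hj i j hij)).1]
    · rw [sub_le_iff_le_add, ← urnMean_const hθ m (ε / 3), ← urnMean_add]
      exact urnMean_mono hθ fun i j hij => by linarith [(abs_lt.1 (hj i j hij)).2]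
  have h3 := hN m hm
  rw [Real.dist_eq] at h3 ⊢
  rw [abs_le] at h1 h2
  rw [abs_lt] at h3 ⊢
  constructor <;> linarith [h1.1, h1.2, h2.1, h2.2, h3.1, h3.2]

/-- The Beta law has no mass at the endpoints, so high powers of `g` vanish almost surely. These
powers replace indicators of small parts by continuous functions. -/
lemma tendsto_integral_pow_betaMeasure {θ : ℝ} (hθ : 0 < θ) {g : ℝ → ℝ} (hg : Measurable g)
    (h0 : ∀ x, 0 < x → x < 1 → 0 ≤ g x ∧ g x < 1) :
    Tendsto (fun M : ℕ => ∫ x, g x ^ M ∂betaMeasure 1 θ) atTop (𝓝 0) := by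
  have := isProbabilityMeasureBeta one_pos hθ
  rw [← integral_zero ℝ ℝ (μ := betaMeasure 1 θ)]
  refine tendsto_integral_of_dominated_convergence (fun _ => 1)
    (fun M => (hg.pow_const M).aestronglyMeasurable) (integrable_const _) (fun M => ?_) ?_
  · filter_upwards [ae_betaMeasure θ] with x hx
    obtain ⟨h1, h2⟩ := h0 x hx.1 hx.2
    rw [Real.norm_eq_abs, abs_of_nonneg (by positivity)]
    exact pow_le_one₀ h1 h2.le
  · filter_upwards [ae_betaMeasure θ] with x hx
    obtain ⟨h1, h2⟩ := h0 x hx.1 hx.2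
    exact tendsto_pow_atTop_nhds_zero_of_lt_one h1 h2

/-- A null sequence evaluated at a count that is of order `m` with high probability. -/
lemma tendsto_urnMean_comp_zero {θ : ℝ} (hθ : 0 < θ) {g : ℝ → ℝ} (hg : Continuous g)
    (h0 : ∀ x, 0 < x → x < 1 → 0 ≤ g x ∧ g x < 1) (c : ℕ → ℕ → ℕ)
    (hc : ∀ m i j, i + j = m → g (share m j) = 1 - ((c i j : ℝ) + 1) / (m + 2) ∧ c i j ≤ m)
    {ε : ℕ → ℝ} (hε0 : ∀ k, 0 ≤ ε k) (hε : Tendsto ε atTop (𝓝 0)) :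
    Tendsto (fun m => urnMean θ m fun i j => ε (c i j)) atTop (𝓝 0) := by
  obtain ⟨C, hC⟩ := hε.bddAbove_range
  have hC' : ∀ k, ε k ≤ C := fun k => hC ⟨k, rfl⟩
  have hC0 : 0 ≤ C := (hε0 0).trans (hC' 0)
  rw [Metric.tendsto_atTop]
  intro η hη
  obtain ⟨K, hK⟩ := Metric.tendsto_atTop.1 hε (η / 4) (by positivity)
  obtain ⟨M, hM⟩ := ((Metric.tendsto_atTop.1 (tendsto_integral_pow_betaMeasure hθ hg.measurable h0)
    (η / (4 * (2 * C + 1))) (by positivity))).imp fun M h => h M le_rfl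
  have h1 := tendsto_urnMean hθ (g := fun x => g x ^ M) (by fun_prop)
  obtain ⟨N, hN⟩ := Metric.tendsto_atTop.1 h1 (η / (4 * (2 * C + 1))) (by positivity)
  have h2 : Tendsto (fun m : ℕ => (1 - (K : ℝ) / (m + 2)) ^ M) atTop (𝓝 ((1 - 0) ^ M)) :=
    (tendsto_const_nhds.sub (tendsto_const_nhds.div_atTop
      (tendsto_atTop_add_const_right _ _ tendsto_natCast_atTop_atTop))).pow M
  rw [sub_zero, one_pow] at h2
  obtain ⟨N', hN'⟩ := eventually_atTop.1
    ((h2.eventually (lt_mem_nhds (show (1 / 2 : ℝ) < 1 by norm_num))).and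
      (eventually_ge_atTop K))
  refine ⟨max N N', fun m hm => ?_⟩
  have hm1 := hN m (le_of_max_le_left hm)
  obtain ⟨hm2, hm3⟩ := hN' m (le_of_max_le_right hm)
  have hub : urnMean θ m (fun i j => ε (c i j))
      ≤ η / 4 + 2 * C * urnMean θ m (fun _ j => g (share m j) ^ M) := by
    rw [← urnMean_mul, ← urnMean_const hθ m (η / 4), ← urnMean_add]
    refine urnMean_mono hθ fun i j hij => ?_
    obtain ⟨hg1, hcm⟩ := hc m i j hij
    have hnn : (0 : ℝ) ≤ g (share m j) := by
      rw [hg1, sub_nonneg, div_le_one (by positivity)]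
      have : (c i j : ℝ) ≤ m := by exact_mod_cast hcm
      linarith
    rcases lt_or_ge (c i j) K with hlt | hge
    -- Markov-type bound: if the count is below `K`, then `g ^ M ≥ 1/2` for large `m`, so `ε ≤ C ≤ 2
    -- C g ^ M`; the mean of `g ^ M` is small by the choice of `M`.
    · have h3 : (1 - (K : ℝ) / (m + 2)) ≤ g (share m j) := by
        rw [hg1]
        gcongr
        exact_mod_cast hlt
      have h4 : (0 : ℝ) ≤ 1 - (K : ℝ) / (m + 2) := by
        rw [sub_nonneg, div_le_one (by positivity)]
        have : (K : ℝ) ≤ m := by exact_mod_cast hm3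
        linarith
      have h5 : (1 / 2 : ℝ) ≤ g (share m j) ^ M := hm2.le.trans (pow_le_pow_left₀ h4 h3 M)
      have h6 := hC' (c i j)
      nlinarith
    · have h3 := hK _ hge
      rw [Real.dist_eq, sub_zero, abs_of_nonneg (hε0 _)] at h3
      have h4 : 0 ≤ 2 * C * g (share m j) ^ M := by positivity
      linarith
  have hlb : 0 ≤ urnMean θ m (fun i j => ε (c i j)) := by
    rw [← urnMean_const hθ m 0]
    exact urnMean_mono hθ fun i j _ => hε0 _
  rw [Real.dist_eq, sub_zero, abs_of_nonneg hlb]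
  rw [Real.dist_eq] at hM hm1
  rw [sub_zero] at hM
  have h5 : urnMean θ m (fun _ j => g (share m j) ^ M) ≤ 2 * (η / (4 * (2 * C + 1))) := by
    have := (abs_lt.1 hm1).2
    have := (abs_lt.1 hM).2
    linarith
  have h6 : 2 * C * (2 * (η / (4 * (2 * C + 1)))) ≤ η / 2 := by
    rw [show 2 * C * (2 * (η / (4 * (2 * C + 1)))) = (2 * C / (2 * C + 1)) * (η / 2) by
      field_simp; ring]
    have : 2 * C / (2 * C + 1) ≤ 1 := (div_le_one (by positivity)).2 (by linarith)
    nlinarith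
  have h7 : 2 * C * urnMean θ m (fun _ j => g (share m j) ^ M)
      ≤ 2 * C * (2 * (η / (4 * (2 * C + 1)))) := by gcongr
  linarith

lemma tendsto_urnMean_right_zero {θ : ℝ} (hθ : 0 < θ) {ε : ℕ → ℝ} (hε0 : ∀ k, 0 ≤ ε k)
    (hε : Tendsto ε atTop (𝓝 0)) :
    Tendsto (fun m => urnMean θ m fun _ j => ε j) atTop (𝓝 0) :=
  tendsto_urnMean_comp_zero hθ (g := fun x => 1 - x) (by fun_prop)
    (fun x h0 h1 => ⟨by linarith, by linarith⟩) (fun _ j => j)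
    (fun m i j hij => ⟨rfl, by omega⟩) hε0 hε

lemma tendsto_urnMean_left_zero {θ : ℝ} (hθ : 0 < θ) {ε : ℕ → ℝ} (hε0 : ∀ k, 0 ≤ ε k)
    (hε : Tendsto ε atTop (𝓝 0)) :
    Tendsto (fun m => urnMean θ m fun i _ => ε i) atTop (𝓝 0) :=
  tendsto_urnMean_comp_zero hθ (g := fun x => x) (by fun_prop)
    (fun x h0 h1 => ⟨by linarith, by linarith⟩) (fun i _ => i)
    (fun m i j hij => ⟨by rw [← one_sub_share hij]; ring, by omega⟩) hε0 hε

/-! ### Hoppe sequences -/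

section Regular

variable {Ω : Type*} [MeasurableSpace Ω] {θ : ℝ} {J : ℕ → Ω → ℕ} {P : Measure Ω}

/-- A Hoppe sequence whose values are admissible parents at every sample point. -/
structure IsRegularHoppe (θ : ℝ) (J : ℕ → Ω → ℕ) (P : Measure Ω) : Prop
    extends IsHoppeSequence θ J P where
  isParent : ∀ ω, IsParent fun k => J k ω

/-- The probability that vertex `m + 1` is attached to vertex `a`. -/
def attachProb (θ : ℝ) (m a : ℕ) : ℝ := (if a = 0 then θ else 1) / (θ + m)

lemma attachProb_nonneg (hθ : 0 < θ) (m a : ℕ) : 0 ≤ attachProb θ m a := by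
  unfold attachProb
  split_ifs <;> positivity

lemma sum_attachProb (hθ : 0 < θ) (m : ℕ) :
    ∑ a ∈ Finset.range (m + 1), attachProb θ m a = 1 := by
  have : θ + m ≠ 0 := by positivity
  rw [Finset.sum_range_succ']
  simp only [attachProb, Nat.add_eq_zero_iff, one_ne_zero, and_false, if_false, if_true,
    Finset.sum_const, Finset.card_range, nsmul_eq_mul]
  field_simp
  ring

lemma IsHoppeSequence.prob (h : IsHoppeSequence θ J P) (m : ℕ) {a : ℕ} (ha : a < m + 1) :
    P.real {ω | J (m + 1) ω = a} = attachProb θ m a := by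
  unfold attachProb
  rcases Nat.eq_zero_or_pos a with rfl | h0
  · rw [h.prob_zero (m + 1) (by omega)]
    push_cast
    ring_nf
  · rw [h.prob_pos (m + 1) a h0 ha, if_neg h0.ne']
    push_cast
    ring_nf

/-- The prescribed masses on `{0, …, m}` already sum to `1`, so other values occur with probability
zero. -/
lemma IsHoppeSequence.ae_lt [IsProbabilityMeasure P] (hθ : 0 < θ) (h : IsHoppeSequence θ J P) :
    ∀ᵐ ω ∂P, IsParent fun k => J k ω := by
  rw [show (∀ᵐ ω ∂P, IsParent fun k => J k ω) ↔ ∀ᵐ ω ∂P, ∀ m, J (m + 1) ω < m + 1 from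
    Filter.eventually_congr (ae_of_all _ fun ω => ⟨fun h m => h (m + 1) (by omega),
      fun h k hk => by obtain ⟨m, rfl⟩ : ∃ m, k = m + 1 := ⟨k - 1, by omega⟩; exact h m⟩)]
  rw [ae_all_iff]
  intro m
  have hm := h.measurable (m + 1) (by omega)
  have hmeas : MeasurableSet {ω | J (m + 1) ω < m + 1} := hm measurableSet_Iio
  have hset : {ω | J (m + 1) ω < m + 1} = ⋃ a ∈ Finset.range (m + 1), {ω | J (m + 1) ω = a} := by
    ext ω
    simp
  have : P.real {ω | J (m + 1) ω < m + 1} = 1 := by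
    rw [hset, measureReal_biUnion_finset]
    · rw [← sum_attachProb hθ m]
      exact Finset.sum_congr rfl fun a ha => h.prob m (Finset.mem_range.1 ha)
    · intro a _ b _ hab
      refine Set.disjoint_left.2 fun ω h1 h2 => hab ?_
      simp only [Set.mem_ofPred_eq] at h1 h2
      exact h1.symm.trans h2
    · exact fun a _ => hm (measurableSet_singleton a)
  rw [Measure.real, ENNReal.toReal_eq_one_iff] at this
  exact (mem_ae_iff_prob_eq_one hmeas).2 this

lemma tree_congr {p q : ℕ → ℕ} (h : ∀ k, 1 ≤ k → p k = q k) (n : ℕ) : tree p n = tree q n := by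
  unfold tree
  congr 1
  ext k j
  exact and_congr_right fun hk => by rw [h _ hk]

lemma IsHoppeSequence.exists_regular [IsProbabilityMeasure P] (hθ : 0 < θ)
    (h : IsHoppeSequence θ J P) :
    ∃ J' : ℕ → Ω → ℕ, IsRegularHoppe θ J' P ∧
      ∀ n, standardized J' P n =ᵐ[P] standardized J P n := by
  -- Inadmissible values are redirected to the root. Applying a fixed function to each coordinate
  -- keeps independence, and almost surely nothing changes.
  let f : ℕ → ℕ → ℕ := fun k a => if a < k then a else 0
  have hae : ∀ᵐ ω ∂P, ∀ k, 1 ≤ k → f k (J k ω) = J k ω := by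
    filter_upwards [h.ae_lt hθ] with ω hω k hk
    exact if_pos (hω k hk)
  have hae' : ∀ k, 1 ≤ k → ∀ a, P.real {ω | f k (J k ω) = a} = P.real {ω | J k ω = a} := by
    intro k hk a
    refine measureReal_congr ?_
    filter_upwards [hae] with ω hω
    change (f k (J k ω) = a) = (J k ω = a)
    rw [hω k hk]
  refine ⟨fun k ω => f k (J k ω), ⟨⟨fun n hn => ?_, ?_, fun n hn => ?_, fun n k hk hkn => ?_⟩, ?_⟩,
    fun n => ?_⟩
  · exact (measurable_of_countable (f n)).comp (h.measurable n hn)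
  · exact h.indep.comp (fun n => f (n + 1)) fun n => measurable_of_countable _
  · rw [hae' n hn, h.prob_zero n hn]
  · rw [hae' n (by omega), h.prob_pos n k hk hkn]
  · intro ω k hk
    simp only [f]
    split_ifs <;> omega
  · have e : ∀ᵐ ω ∂P, wienerIndex (fun k => f k (J k ω)) n = wienerIndex (fun k => J k ω) n ∧
        totalLength (fun k => f k (J k ω)) n = totalLength (fun k => J k ω) n := by
      filter_upwards [hae] with ω hω
      simp only [wienerIndex, totalLength]
      rw [tree_congr hω n]
      exact ⟨rfl, rfl⟩
    have i1 := integral_congr_ae (μ := P) (f := fun ω => (wienerIndex (fun k => f k (J k ω)) n : ℝ))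
      (g := fun ω => (wienerIndex (fun k => J k ω) n : ℝ))
      (by filter_upwards [e] with ω hω; rw [hω.1])
    have i2 := integral_congr_ae (μ := P) (f := fun ω => (totalLength (fun k => f k (J k ω)) n : ℝ))
      (g := fun ω => (totalLength (fun k => J k ω) n : ℝ))
      (by filter_upwards [e] with ω hω; rw [hω.2])
    filter_upwards [e] with ω hω
    simp only [standardized]
    rw [i1, i2, hω.1, hω.2]

/-- The law of the parent of vertex `m + 1`. -/
def parentLaw (θ : ℝ) (m : ℕ) : Measure ℕ :=
  ∑ a ∈ Finset.range (m + 1), ENNReal.ofReal (attachProb θ m a) • Measure.dirac a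

lemma parentLaw_real_singleton (hθ : 0 < θ) (m : ℕ) {a : ℕ} (ha : a < m + 1) :
    (parentLaw θ m).real {a} = attachProb θ m a := by
  simp only [parentLaw, Measure.real, Measure.coe_finsetSum, Finset.sum_apply, Measure.smul_apply,
    smul_eq_mul, Measure.dirac_apply, Set.indicator_apply, Set.mem_singleton_iff, Pi.one_apply]
  simp [ha, ENNReal.toReal_ofReal (attachProb_nonneg hθ m a)]

lemma isProbabilityMeasure_parentLaw (hθ : 0 < θ) (m : ℕ) :
    IsProbabilityMeasure (parentLaw θ m) := by
  constructor
  simp only [parentLaw, Measure.coe_finsetSum, Finset.sum_apply, Measure.smul_apply,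
    smul_eq_mul, measure_univ, mul_one]
  rw [← ENNReal.ofReal_sum_of_nonneg fun a _ => attachProb_nonneg hθ m a, sum_attachProb hθ,
    ENNReal.ofReal_one]

/-- The limit laws must exist independently of any given sequence, so one realization is needed. The
coordinate `m` of the product space is the parent of vertex `m + 1`. -/
lemma exists_hoppeSequence (hθ : 0 < θ) :
    ∃ (P : Measure (ℕ → ℕ)) (_ : IsProbabilityMeasure P) (J : ℕ → (ℕ → ℕ) → ℕ),
      IsHoppeSequence θ J P := by
  have := isProbabilityMeasure_parentLaw hθ
  have hp : ∀ m a, a < m + 1 →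
      (Measure.infinitePi (parentLaw θ)).real {ω : ℕ → ℕ | ω m = a} = attachProb θ m a := by
    intro m a ha
    rw [← parentLaw_real_singleton hθ m ha, ← Measure.infinitePi_map_eval (parentLaw θ) m,
      map_measureReal_apply (measurable_pi_apply m) (measurableSet_singleton a)]
    rfl
  refine ⟨Measure.infinitePi (parentLaw θ), inferInstance, fun n ω => ω (n - 1),
    fun n _ => measurable_pi_apply _, ?_, fun n hn => ?_, fun n k hk hkn => ?_⟩
  · exact iIndepFun_infinitePi (X := fun _ x => x) fun _ => measurable_id
  · obtain ⟨m, rfl⟩ : ∃ m, n = m + 1 := ⟨n - 1, by omega⟩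
    rw [Nat.add_sub_cancel, hp m 0 (by omega), attachProb, if_pos rfl]
    push_cast
    ring_nf
  · obtain ⟨m, rfl⟩ : ∃ m, n = m + 1 := ⟨n - 1, by omega⟩
    rw [Nat.add_sub_cancel, hp m k hkn, attachProb, if_neg (by omega)]
    push_cast
    ring_nf

/-! ### Conditioning on the first vertices -/

/-- `Φ p` depends only on `p 1, …, p m`. -/
def DependsUpTo {β : Type*} (m : ℕ) (Φ : (ℕ → ℕ) → β) : Prop :=
  ∀ p q : ℕ → ℕ, (∀ k, 1 ≤ k → k ≤ m → p k = q k) → Φ p = Φ q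

lemma DependsUpTo.mono {β : Type*} {m n : ℕ} {Φ : (ℕ → ℕ) → β} (h : DependsUpTo m Φ)
    (hmn : m ≤ n) : DependsUpTo n Φ :=
  fun p q hpq => h p q fun k h1 h2 => hpq k h1 (h2.trans hmn)

/-- A parent function with prescribed values at `1, …, m`. -/
def extendParent (m : ℕ) (g : Finset.range m → ℕ) (k : ℕ) : ℕ :=
  if h : k - 1 ∈ Finset.range m then g ⟨k - 1, h⟩ else 0

lemma DependsUpTo.eq_extend {Ω β : Type*} {J : ℕ → Ω → ℕ} {m : ℕ} {Φ : (ℕ → ℕ) → β}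
    (h : DependsUpTo m Φ) (ω : Ω) : Φ (fun k => J k ω) = Φ (extendParent m fun i => J (i + 1) ω) := by
  refine h _ _ fun k h1 h2 => ?_
  have hk : k - 1 ∈ Finset.range m := Finset.mem_range.2 (by omega)
  rw [extendParent, dif_pos hk]
  simp only
  rw [Nat.sub_add_cancel h1]

/-- Only finitely many admissible choices of the first `m` parents exist, so every functional of
them is bounded and all integrability questions at finite size disappear. -/
lemma IsRegularHoppe.exists_bound (hJ : IsRegularHoppe θ J P) {m : ℕ} {Φ : (ℕ → ℕ) → ℝ}
    (h : DependsUpTo m Φ) : ∃ C, ∀ ω, |Φ fun k => J k ω| ≤ C := by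
  have hfin : {g : Finset.range m → ℕ | ∀ i : Finset.range m, g i ∈ Set.Iic (i : ℕ)}.Finite :=
    Set.Finite.pi' fun i => Set.finite_Iic _
  obtain ⟨C, hC⟩ := ((hfin.image fun g => |Φ (extendParent m g)|).bddAbove)
  refine ⟨C, fun ω => ?_⟩
  rw [h.eq_extend]
  refine hC ⟨_, fun i => ?_, rfl⟩
  exact Nat.lt_succ_iff.1 (hJ.isParent ω (i + 1) (by omega))

lemma IsRegularHoppe.measurable_comp (hJ : IsRegularHoppe θ J P) {m : ℕ} {Φ : (ℕ → ℕ) → ℝ}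
    (h : DependsUpTo m Φ) : Measurable fun ω => Φ fun k => J k ω := by
  simp_rw [h.eq_extend]
  refine (measurable_of_countable fun g : Finset.range m → ℕ => Φ (extendParent m g)).comp ?_
  exact measurable_pi_lambda _ fun i => hJ.measurable _ (by omega)

lemma IsRegularHoppe.memLp [IsProbabilityMeasure P] (hJ : IsRegularHoppe θ J P) {m : ℕ}
    {Φ : (ℕ → ℕ) → ℝ} (h : DependsUpTo m Φ) (q : ENNReal) :
    MemLp (fun ω => Φ fun k => J k ω) q P := by
  obtain ⟨C, hC⟩ := hJ.exists_bound h
  exact MemLp.of_bound (hJ.measurable_comp h).aestronglyMeasurable C (ae_of_all _ hC)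

lemma IsRegularHoppe.integrable [IsProbabilityMeasure P] (hJ : IsRegularHoppe θ J P) {m : ℕ}
    {Φ : (ℕ → ℕ) → ℝ} (h : DependsUpTo m Φ) : Integrable (fun ω => Φ fun k => J k ω) P :=
  memLp_one_iff_integrable.1 (hJ.memLp h 1)

lemma IsRegularHoppe.indepFun (hJ : IsRegularHoppe θ J P) {m : ℕ}
    {Φ : (ℕ → ℕ) → ℝ} (h : DependsUpTo m Φ) :
    IndepFun (fun ω => Φ fun k => J k ω) (J (m + 1)) P := by
  have h1 := hJ.indep.indepFun_finset (Finset.range m) {m} (by simp)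
    fun n => hJ.measurable _ (by omega)
  have h2 := h1.comp (φ := fun g : Finset.range m → ℕ => Φ (extendParent m g))
    (ψ := fun g : ({m} : Finset ℕ) → ℕ => g ⟨m, Finset.mem_singleton_self m⟩)
    (measurable_of_countable _) (measurable_of_countable _)
  rw [show (fun ω => Φ fun k => J k ω) = _ from funext fun ω => h.eq_extend ω]
  exact h2

/-- Integrating out the parent of vertex `m + 1`. -/
lemma IsRegularHoppe.integral_step [IsProbabilityMeasure P] (hJ : IsRegularHoppe θ J P) {m : ℕ}
    {Φ : (ℕ → ℕ) → ℕ → ℝ} (h : ∀ a, DependsUpTo m fun p => Φ p a) :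
    ∫ ω, Φ (fun k => J k ω) (J (m + 1) ω) ∂P
      = ∫ ω, ∑ a ∈ Finset.range (m + 1), attachProb θ m a * Φ (fun k => J k ω) a ∂P := by
  have hm := hJ.measurable (m + 1) (by omega)
  -- Decomposing over the value of the next parent turns the integrand into products of independent
  -- factors.
  have e : ∀ ω, Φ (fun k => J k ω) (J (m + 1) ω) = ∑ a ∈ Finset.range (m + 1),
      Φ (fun k => J k ω) a * Set.indicator {a} (fun _ => (1 : ℝ)) (J (m + 1) ω) := by
    intro ω
    rw [Finset.sum_eq_single (J (m + 1) ω)]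
    · simp
    · intro b _ hb
      simp [hb.symm]
    · intro hb
      exact absurd (Finset.mem_range.2 (hJ.isParent ω (m + 1) (by omega))) hb
  have hind : ∀ a : ℕ, Measurable (Set.indicator {a} (fun _ : ℕ => (1 : ℝ))) :=
    fun a => measurable_of_countable _
  simp_rw [e]
  rw [integral_finsetSum, integral_finsetSum]
  · refine Finset.sum_congr rfl fun a ha => ?_
    have hi := ((hJ.indepFun (h a)).comp measurable_id (hind a))
    have := hi.integral_mul_eq_mul_integral (hJ.measurable_comp (h a)).aestronglyMeasurable
      ((hind a).comp hm).aestronglyMeasurable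
    simp only [Pi.mul_apply, Function.comp_apply, id] at this
    have e2 : ∫ ω, Set.indicator {a} (fun _ => (1 : ℝ)) (J (m + 1) ω) ∂P = attachProb θ m a := by
      rw [← hJ.prob m (Finset.mem_range.1 ha)]
      have : (fun ω => Set.indicator {a} (fun _ => (1 : ℝ)) (J (m + 1) ω))
          = Set.indicator {ω | J (m + 1) ω = a} (1 : Ω → ℝ) := by
        ext ω
        simp [Set.indicator_apply]
      exact (congrArg (integral P) this).trans
        (integral_indicator_one (hm (measurableSet_singleton a)))
    refine Eq.trans this ?_
    rw [integral_const_mul, e2, mul_comm]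
  · exact fun a _ => (hJ.integrable (h a)).const_mul _
  · intro a _
    refine (hJ.integrable (h a)).mul_bdd (c := 1) ((hind a).comp hm).aestronglyMeasurable
      (ae_of_all _ fun ω => ?_)
    simp only [Set.indicator_apply]
    split_ifs <;> simp

lemma ltree_congr (m : ℕ) : DependsUpTo m fun p => ltree p m := by
  intro p q h
  induction m with
  | zero => rfl
  | succ m ih =>
    simp only [ltree]
    rw [h (m + 1) (by omega) le_rfl]
    congr 1
    exact ih fun k h1 h2 => h k h1 (by omega)

lemma dependsUpTo_ltree {β : Type*} (m : ℕ) (f : LTree → β) :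
    DependsUpTo m fun p => f (ltree p m) :=
  fun p q h => congrArg f (ltree_congr m p q h)

/-- The right side knows nothing of `J` or `P`; through this identity statements are transferred
between probability spaces. -/
lemma IsRegularHoppe.integral_shape [IsProbabilityMeasure P] (hJ : IsRegularHoppe θ J P) (m : ℕ)
    (F : Shape → ℝ) :
    ∫ ω, F (ltree (fun k => J k ω) m).shape ∂P = shapeMean θ m F := by
  induction m generalizing F with
  | zero => simp [ltree, LTree.shape, shapeMean]
  | succ m ih =>
    rw [shapeMean, ← ih]
    refine (hJ.integral_step (Φ := fun p a => F ((ltree p m).grow a (m + 1)).shape)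
      fun a => dependsUpTo_ltree m fun t => F (t.grow a (m + 1)).shape).trans ?_
    refine integral_congr_ae (ae_of_all _ fun ω => ?_)
    have := LTree.sum_grow (ltree_nodup (hJ.isParent ω) m) (m + 1) θ F
    simp only [ltree_root, ltree_labels (hJ.isParent ω)] at this
    simp only [← this, attachProb, Finset.sum_div]
    exact Finset.sum_congr rfl fun a _ => by ring

end Regular

/-! ### Convergence in `L²` -/

section L2

variable {Ω : Type*} [MeasurableSpace Ω] {P : Measure Ω}

lemma inner_toLp {f g : Ω → ℝ} (hf : MemLp f 2 P) (hg : MemLp g 2 P) :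
    inner ℝ (hf.toLp f) (hg.toLp g) = ∫ ω, f ω * g ω ∂P := by
  rw [L2.inner_def]
  refine integral_congr_ae ?_
  filter_upwards [hf.coeFn_toLp, hg.coeFn_toLp] with ω h1 h2
  rw [h1, h2]
  simp [mul_comm]

lemma norm_sq_toLp {f : Ω → ℝ} (hf : MemLp f 2 P) : ‖hf.toLp f‖ ^ 2 = ∫ ω, f ω ^ 2 ∂P := by
  rw [← real_inner_self_eq_norm_sq, inner_toLp]
  simp_rw [sq]

lemma tendsto_toLp {f : ℕ → Ω → ℝ} {g : Ω → ℝ} (hf : ∀ n, MemLp (f n) 2 P) (hg : MemLp g 2 P)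
    (h : Tendsto (fun n => ∫ ω, (f n ω - g ω) ^ 2 ∂P) atTop (𝓝 0)) :
    Tendsto (fun n => (hf n).toLp (f n)) atTop (𝓝 (hg.toLp g)) := by
  rw [tendsto_iff_norm_sub_tendsto_zero]
  have : ∀ n, ‖(hf n).toLp (f n) - hg.toLp g‖ = √(∫ ω, (f n ω - g ω) ^ 2 ∂P) := by
    intro n
    rw [← MemLp.toLp_sub, ← Real.sqrt_sq (norm_nonneg _), norm_sq_toLp]
    rfl
  simp_rw [this]
  simpa using h.sqrt

lemma tendsto_integral_mul {f f' : ℕ → Ω → ℝ} {g g' : Ω → ℝ} (hf : ∀ n, MemLp (f n) 2 P)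
    (hg : MemLp g 2 P) (hf' : ∀ n, MemLp (f' n) 2 P) (hg' : MemLp g' 2 P)
    (h : Tendsto (fun n => ∫ ω, (f n ω - g ω) ^ 2 ∂P) atTop (𝓝 0))
    (h' : Tendsto (fun n => ∫ ω, (f' n ω - g' ω) ^ 2 ∂P) atTop (𝓝 0)) :
    Tendsto (fun n => ∫ ω, f n ω * f' n ω ∂P) atTop (𝓝 (∫ ω, g ω * g' ω ∂P)) := by
  have := (tendsto_toLp hf hg h).inner (𝕜 := ℝ) (tendsto_toLp hf' hg' h')
  simpa only [inner_toLp] using this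

/-- Used to pass from the martingale normalization to division by `n` and `n²`, and to remove the
path-length correction from the Wiener martingale. -/
lemma tendsto_sq_combination {f f' : ℕ → Ω → ℝ} {g g' : Ω → ℝ} (hf : ∀ n, MemLp (f n) 2 P)
    (hg : MemLp g 2 P) (hf' : ∀ n, MemLp (f' n) 2 P) (hg' : MemLp g' 2 P)
    (h : Tendsto (fun n => ∫ ω, (f n ω - g ω) ^ 2 ∂P) atTop (𝓝 0))
    (h' : Tendsto (fun n => ∫ ω, (f' n ω - g' ω) ^ 2 ∂P) atTop (𝓝 0)) {a b : ℕ → ℝ}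
    (ha : Tendsto a atTop (𝓝 1)) (hb : Tendsto b atTop (𝓝 0)) :
    Tendsto (fun n => ∫ ω, (a n * f n ω + b n * f' n ω - g ω) ^ 2 ∂P) atTop (𝓝 0) := by
  have h1 := (ha.smul (tendsto_toLp hf hg h)).add (hb.smul (tendsto_toLp hf' hg' h'))
  rw [one_smul, zero_smul, add_zero] at h1
  have h2 := (tendsto_iff_norm_sub_tendsto_zero.1 h1).pow 2
  rw [zero_pow two_ne_zero] at h2
  refine h2.congr fun n => ?_
  rw [← MemLp.toLp_const_smul, ← MemLp.toLp_const_smul, ← MemLp.toLp_add, ← MemLp.toLp_sub,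
    norm_sq_toLp]
  rfl

lemma sq_integral_le [IsProbabilityMeasure P] {f : Ω → ℝ} (hf : MemLp f 2 P) :
    (∫ ω, f ω ∂P) ^ 2 ≤ ∫ ω, f ω ^ 2 ∂P := by
  have := variance_nonneg f P
  rw [variance_eq_sub hf] at this
  simp only [Pi.pow_apply] at this
  linarith

lemma integral_abs_le_sqrt [IsProbabilityMeasure P] {f : Ω → ℝ} (hf : MemLp f 2 P) :
    ∫ ω, |f ω| ∂P ≤ √(∫ ω, f ω ^ 2 ∂P) := by
  apply Real.le_sqrt_of_sq_le
  simpa using sq_integral_le hf.norm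

lemma norm_sum_sq_of_orthogonal {E : Type*} [NormedAddCommGroup E] [InnerProductSpace ℝ E]
    {u : ℕ → E} (hu : ∀ i j, i ≠ j → inner ℝ (u i) (u j) = 0) (s : Finset ℕ) :
    ‖∑ i ∈ s, u i‖ ^ 2 = ∑ i ∈ s, ‖u i‖ ^ 2 := by
  induction s using Finset.induction_on with
  | empty => simp
  | insert a s ha ih =>
    rw [Finset.sum_insert ha, Finset.sum_insert ha, norm_add_sq_real, ih, inner_sum,
      Finset.sum_eq_zero fun i hi => hu a i (by rintro rfl; exact ha hi)]
    ring

/-- By Pythagoras the Cauchy criterion for `∑ u i` is that for `∑ ‖u i‖ ^ 2`. -/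
lemma summable_of_orthogonal {E : Type*} [NormedAddCommGroup E] [InnerProductSpace ℝ E]
    [CompleteSpace E] {u : ℕ → E} (hu : ∀ i j, i ≠ j → inner ℝ (u i) (u j) = 0)
    (hs : Summable fun i => ‖u i‖ ^ 2) : Summable u := by
  rw [summable_iff_vanishing_norm] at hs ⊢
  intro ε hε
  obtain ⟨s, hs⟩ := hs (ε ^ 2) (by positivity)
  refine ⟨s, fun t ht => ?_⟩
  have := hs t ht
  rw [← norm_sum_sq_of_orthogonal hu, Real.norm_of_nonneg (by positivity)] at this
  exact lt_of_pow_lt_pow_left₀ 2 hε.le this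

end L2

/-! ### Martingales along the growth of the tree -/

section Martingale

variable {Ω : Type*} [MeasurableSpace Ω] {θ : ℝ} {J : ℕ → Ω → ℕ} {P : Measure Ω}

/-- `X m` is a function of the tree with `m + 1` vertices, vanishing for `m = 0`, and its increments
are the centered multiples `κ m * (Y m - E Y m)` of functions `Y m` of the parent of the next
vertex. -/
structure IsTreeMartingale (θ : ℝ) (X : ℕ → (ℕ → ℕ) → ℝ) (Y : ℕ → (ℕ → ℕ) → ℕ → ℝ)
    (κ : ℕ → ℝ) : Prop where
  dependsUpTo : ∀ m, DependsUpTo m (X m)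
  dependsUpTo_increment : ∀ m, DependsUpTo m (Y m)
  zero : ∀ p, X 0 p = 0
  step : ∀ m p, IsParent p → X (m + 1) p = X m p + κ m * (Y m p (p (m + 1))
    - ∑ a ∈ Finset.range (m + 1), attachProb θ m a * Y m p a)

variable {X : ℕ → (ℕ → ℕ) → ℝ} {Y : ℕ → (ℕ → ℕ) → ℕ → ℝ} {κ : ℕ → ℝ}

/-- The increment of a tree martingale as a function of the parent of the next vertex. -/
def increment (θ : ℝ) (Y : ℕ → (ℕ → ℕ) → ℕ → ℝ) (κ : ℕ → ℝ) (m : ℕ) (p : ℕ → ℕ) (a : ℕ) : ℝ :=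
  κ m * (Y m p a - ∑ b ∈ Finset.range (m + 1), attachProb θ m b * Y m p b)

lemma sum_attachProb_increment (hθ : 0 < θ) (m : ℕ) (p : ℕ → ℕ) :
    ∑ a ∈ Finset.range (m + 1), attachProb θ m a * increment θ Y κ m p a = 0 := by
  simp only [increment, mul_sub, mul_left_comm _ (κ m), ← Finset.mul_sum, Finset.sum_sub_distrib,
    ← Finset.sum_mul, sum_attachProb hθ, one_mul, sub_self]

/-- The conditional variance is at most the conditional second moment. -/
lemma sum_attachProb_increment_sq_le (hθ : 0 < θ) (m : ℕ) (p : ℕ → ℕ) :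
    ∑ a ∈ Finset.range (m + 1), attachProb θ m a * increment θ Y κ m p a ^ 2
      ≤ κ m ^ 2 * ∑ a ∈ Finset.range (m + 1), attachProb θ m a * Y m p a ^ 2 := by
  set μ := ∑ b ∈ Finset.range (m + 1), attachProb θ m b * Y m p b with hμ
  have e : ∀ a, attachProb θ m a * increment θ Y κ m p a ^ 2
      = κ m ^ 2 * (attachProb θ m a * Y m p a ^ 2 - 2 * μ * (attachProb θ m a * Y m p a)
        + μ ^ 2 * attachProb θ m a) := by
    intro a
    rw [increment, ← hμ]
    ring
  simp_rw [e]
  rw [← Finset.mul_sum, Finset.sum_add_distrib, Finset.sum_sub_distrib, ← Finset.mul_sum,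
    ← Finset.mul_sum, sum_attachProb hθ, ← hμ]
  gcongr
  nlinarith [sq_nonneg μ]

lemma IsTreeMartingale.increment_dependsUpTo (hX : IsTreeMartingale θ X Y κ) (m : ℕ) :
    DependsUpTo m (increment θ Y κ m) := by
  intro p q h
  ext a
  simp only [increment]
  rw [hX.dependsUpTo_increment m p q h]

lemma IsTreeMartingale.increment_dependsUpTo_succ (hX : IsTreeMartingale θ X Y κ) (m : ℕ) :
    DependsUpTo (m + 1) fun p => increment θ Y κ m p (p (m + 1)) := by
  intro p q h
  simp only
  rw [h (m + 1) (by omega) le_rfl,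
    hX.increment_dependsUpTo m p q fun k h1 h2 => h k h1 (by omega)]

variable [IsProbabilityMeasure P]

/-- Given the past the increment has mean zero. With `Φ = 1` this centers the martingale, and with
`Φ` an earlier increment it gives orthogonality. -/
lemma IsTreeMartingale.integral_mul_increment (hX : IsTreeMartingale θ X Y κ) (hθ : 0 < θ)
    (hJ : IsRegularHoppe θ J P) {m : ℕ} {Φ : (ℕ → ℕ) → ℝ} (hΦ : DependsUpTo m Φ) :
    ∫ ω, Φ (fun k => J k ω) * increment θ Y κ m (fun k => J k ω) (J (m + 1) ω) ∂P = 0 := by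
  rw [hJ.integral_step (Φ := fun p a => Φ p * increment θ Y κ m p a)]
  · simp_rw [mul_left_comm _ (Φ _), ← Finset.mul_sum, sum_attachProb_increment hθ, mul_zero,
      integral_zero]
  · intro a p q h
    simp only
    rw [hΦ p q h, hX.increment_dependsUpTo m p q h]

lemma IsTreeMartingale.eq_sum (hX : IsTreeMartingale θ X Y κ) (m : ℕ) {p : ℕ → ℕ}
    (hp : IsParent p) : X m p = ∑ i ∈ Finset.range m, increment θ Y κ i p (p (i + 1)) := by
  induction m with
  | zero => simp [hX.zero]
  | succ m ih => 
    rw [Finset.sum_range_succ, ← ih, hX.step m p hp]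
    rfl

lemma IsTreeMartingale.integral_eq_zero (hX : IsTreeMartingale θ X Y κ) (hθ : 0 < θ)
    (hJ : IsRegularHoppe θ J P) (m : ℕ) : ∫ ω, X m (fun k => J k ω) ∂P = 0 := by
  simp_rw [fun ω => hX.eq_sum m (hJ.isParent ω)]
  rw [integral_finsetSum]
  · refine Finset.sum_eq_zero fun i _ => ?_
    simpa using hX.integral_mul_increment hθ hJ (m := i) (Φ := fun _ => 1) fun _ _ _ => rfl
  · exact fun i _ => hJ.integrable (hX.increment_dependsUpTo_succ i)

lemma IsTreeMartingale.exists_limit (hX : IsTreeMartingale θ X Y κ) (hθ : 0 < θ)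
    (hJ : IsRegularHoppe θ J P)
    (hsum : Summable fun m => κ m ^ 2 * ∫ ω, ∑ a ∈ Finset.range (m + 1),
      attachProb θ m a * Y m (fun k => J k ω) a ^ 2 ∂P) :
    ∃ Z : Ω → ℝ, Measurable Z ∧ MemLp Z 2 P ∧ ∫ ω, Z ω ∂P = 0 ∧
      Tendsto (fun m => ∫ ω, (X m (fun k => J k ω) - Z ω) ^ 2 ∂P) atTop (𝓝 0) := by
  have hmem : ∀ i, MemLp (fun ω => increment θ Y κ i (fun k => J k ω) (J (i + 1) ω)) 2 P :=
    fun i => hJ.memLp (hX.increment_dependsUpTo_succ i) 2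
  let u : ℕ → Lp ℝ 2 P := fun i => (hmem i).toLp _
  have horth' : ∀ i j, i < j → inner ℝ (u i) (u j) = 0 := by
    intro i j hij
    rw [inner_toLp]
    exact hX.integral_mul_increment hθ hJ (Φ := fun p => increment θ Y κ i p (p (i + 1)))
      ((hX.increment_dependsUpTo_succ i).mono hij)
  have horth : ∀ i j, i ≠ j → inner ℝ (u i) (u j) = 0 := by
    intro i j hij
    rcases hij.lt_or_gt with h | h
    · exact horth' i j h
    · rw [real_inner_comm]
      exact horth' j i h
  have hsq : ∀ i, ‖u i‖ ^ 2 ≤ κ i ^ 2 * ∫ ω, ∑ a ∈ Finset.range (i + 1),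
      attachProb θ i a * Y i (fun k => J k ω) a ^ 2 ∂P := by
    intro i
    rw [norm_sq_toLp, ← integral_const_mul,
      hJ.integral_step (Φ := fun p a => increment θ Y κ i p a ^ 2)
        fun a p q h => by simp only; rw [hX.increment_dependsUpTo i p q h]]
    refine integral_mono ?_ ?_ fun ω => sum_attachProb_increment_sq_le hθ i _
    · refine hJ.integrable (m := i) (Φ := fun p => ∑ a ∈ Finset.range (i + 1),
        attachProb θ i a * increment θ Y κ i p a ^ 2) fun p q h => ?_
      exact Finset.sum_congr rfl fun a _ => by rw [hX.increment_dependsUpTo i p q h]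
    · refine hJ.integrable (m := i) (Φ := fun p => κ i ^ 2 * ∑ a ∈ Finset.range (i + 1),
        attachProb θ i a * Y i p a ^ 2) fun p q h => ?_
      simp only
      congr 1
      exact Finset.sum_congr rfl fun a _ => by rw [hX.dependsUpTo_increment i p q h]
  have hs : Summable u := summable_of_orthogonal horth
    (hsum.of_nonneg_of_le (fun i => by positivity) hsq)
  have hXmem : ∀ m, MemLp (fun ω => X m (fun k => J k ω)) 2 P :=
    fun m => hJ.memLp (hX.dependsUpTo m) 2
  have hpart : ∀ m, (hXmem m).toLp _ = ∑ i ∈ Finset.range m, u i := by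
    intro m
    induction m with
    | zero =>
      rw [Finset.sum_range_zero, ← MemLp.toLp_zero (MemLp.zero (p := 2) (μ := P) (ε := ℝ))]
      exact MemLp.toLp_congr _ _ (ae_of_all _ fun ω => hX.zero _)
    | succ m ih =>
      rw [Finset.sum_range_succ, ← ih, ← MemLp.toLp_add]
      refine MemLp.toLp_congr _ _ (ae_of_all _ fun ω => ?_)
      exact hX.step m _ (hJ.isParent ω)
  have hZ := Lp.memLp (∑' i, u i)
  have hlim : Tendsto (fun m => ∫ ω, (X m (fun k => J k ω) - (∑' i, u i : Lp ℝ 2 P) ω) ^ 2 ∂P) atTop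
      (𝓝 0) := by
    have h1 := (tendsto_iff_norm_sub_tendsto_zero.1 hs.hasSum.tendsto_sum_nat).pow 2
    rw [zero_pow two_ne_zero] at h1
    refine h1.congr fun m => ?_
    have h2 : (∑ i ∈ Finset.range m, u i) - ∑' i, u i = ((hXmem m).sub hZ).toLp _ := by
      rw [← hpart, MemLp.toLp_sub (hXmem m) hZ, Lp.toLp_coeFn]
    rw [h2, norm_sq_toLp]
    rfl
  refine ⟨_, (Lp.stronglyMeasurable _).measurable, hZ, ?_, hlim⟩
  -- Since `X m` has mean zero, the squared mean of the limit is at most the `L²` error.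
  have h3 : ∀ m, (∫ ω, (∑' i, u i : Lp ℝ 2 P) ω ∂P) ^ 2
      ≤ ∫ ω, (X m (fun k => J k ω) - (∑' i, u i : Lp ℝ 2 P) ω) ^ 2 ∂P := by
    intro m
    have := sq_integral_le ((hXmem m).sub hZ)
    simp only [Pi.sub_apply] at this
    rw [integral_sub ((hXmem m).integrable (by norm_num)) (hZ.integrable (by norm_num)),
      hX.integral_eq_zero hθ hJ, zero_sub, neg_sq] at this
    exact this
  have h4 := ge_of_tendsto' hlim h3
  exact pow_eq_zero_iff two_ne_zero |>.1 (le_antisymm h4 (sq_nonneg _))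

end Martingale

/-! ### Path length and Wiener index as martingales -/

namespace LTree

/-- Sum of the distances from `a` to all vertices. -/
def distSum (t : LTree) (a : ℕ) : ℝ := ∑ x ∈ t.labels, (t.dist a x : ℝ)

/-- Sum of the squared distances to the root. -/
def sqDepth (t : LTree) : ℝ := ∑ x ∈ t.labels, (t.depth x : ℝ) ^ 2

variable {t : LTree} {a b : ℕ}

lemma pathLength_grow (ht : t.Nodup) (hb : b ∉ t.labels) (ha : a ∈ t.labels) :
    (t.grow a b).shape.pathLength = t.shape.pathLength + t.depth a + 1 := by
  rw [pathLength_shape (ht.grow hb), pathLength_shape ht, labels_grow ha, Finset.sum_insert hb,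
    depth_grow_new ht hb ha, Finset.sum_congr rfl fun x hx => by rw [depth_grow hb hx]]
  push_cast
  ring

lemma sqDepth_grow (ht : t.Nodup) (hb : b ∉ t.labels) (ha : a ∈ t.labels) :
    (t.grow a b).sqDepth = t.sqDepth + (t.depth a + 1) ^ 2 := by
  rw [sqDepth, sqDepth, labels_grow ha, Finset.sum_insert hb,
    depth_grow_new ht hb ha, Finset.sum_congr rfl fun x hx => by rw [depth_grow hb hx]]
  push_cast
  ring

lemma wiener_grow (ht : t.Nodup) (hb : b ∉ t.labels) (ha : a ∈ t.labels) :
    (t.grow a b).shape.wiener = t.shape.wiener + t.distSum a + t.labels.card := by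
  have h1 := two_mul_wiener_shape (ht.grow (a := a) hb)
  have h2 := two_mul_wiener_shape ht
  have e : ∀ x ∈ t.labels, ((t.grow a b).dist x b : ℝ) = t.dist a x + 1 := fun x hx => by
    rw [dist_grow_new ht hb ha hx, dist_comm]
    push_cast
    ring
  have e2 : ∀ x ∈ t.labels, ∑ y ∈ insert b t.labels, ((t.grow a b).dist x y : ℝ)
      = (t.dist a x + 1) + ∑ y ∈ t.labels, (t.dist x y : ℝ) := fun x hx => by
    rw [Finset.sum_insert hb, e x hx]
    congr 1
    exact Finset.sum_congr rfl fun y hy => by rw [dist_grow hb hx hy]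
  have e3 : ∑ y ∈ insert b t.labels, ((t.grow a b).dist b y : ℝ)
      = t.distSum a + t.labels.card := by
    rw [Finset.sum_insert hb, dist_self, Nat.cast_zero, zero_add,
      Finset.sum_congr rfl fun y hy => by rw [dist_comm, e y hy], Finset.sum_add_distrib]
    simp [distSum]
  rw [labels_grow ha, Finset.sum_insert hb, e3, Finset.sum_congr rfl e2, Finset.sum_add_distrib,
    Finset.sum_add_distrib, ← h2] at h1
  simp only [Finset.sum_const, nsmul_eq_mul, mul_one] at h1
  rw [distSum] at h1 ⊢
  linarith

lemma dist_le_depth_add_depth (t : LTree) (x y : ℕ) : t.dist x y ≤ t.depth x + t.depth y := by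
  induction t with
  | leaf c => simp [dist]
  | join r s ihr ihs =>
    simp only [dist, depth]
    split_ifs <;> omega

/-- Every path is compared with the detour through the root. -/
lemma distSum_le (ht : t.Nodup) (a : ℕ) :
    t.distSum a ≤ t.labels.card * t.depth a + t.shape.pathLength := by
  rw [pathLength_shape ht]
  calc t.distSum a ≤ ∑ x ∈ t.labels, ((t.depth a : ℝ) + t.depth x) :=
        Finset.sum_le_sum fun x _ => by exact_mod_cast t.dist_le_depth_add_depth a x
    _ = _ := by rw [Finset.sum_add_distrib]; simp

lemma distSum_nonneg (t : LTree) (a : ℕ) : 0 ≤ t.distSum a :=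
  Finset.sum_nonneg fun _ _ => Nat.cast_nonneg _

lemma sq_pathLength_le (ht : t.Nodup) : t.shape.pathLength ^ 2 ≤ t.labels.card * t.sqDepth := by
  rw [pathLength_shape ht]
  exact sq_sum_le_card_mul_sum_sq

lemma distSum_root (ht : t.Nodup) : t.distSum t.root = t.shape.pathLength := by
  rw [pathLength_shape ht]
  exact Finset.sum_congr rfl fun x hx => by rw [dist_root t hx]

end LTree

/-! ### Conditional means under one growth step, and the two martingales. -/

lemma sum_attachProb_mul (θ : ℝ) (m : ℕ) (f : ℕ → ℝ) :
    ∑ a ∈ Finset.range (m + 1), attachProb θ m a * f a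
      = (∑ a ∈ Finset.range (m + 1), f a + (θ - 1) * f 0) / (θ + m) := by
  rw [Finset.sum_range_succ', Finset.sum_range_succ']
  simp only [attachProb, Nat.add_eq_zero_iff, one_ne_zero, and_false, if_false, if_true,
    div_mul_eq_mul_div, one_mul, ← Finset.sum_div]
  ring

/-- The partial sums `1 / (θ + 1) + ⋯ + 1 / (θ + m)`. -/
def harmonicSum (θ : ℝ) (m : ℕ) : ℝ := ∑ j ∈ Finset.range m, 1 / (θ + j + 1)

lemma harmonicSum_succ (θ : ℝ) (m : ℕ) :
    harmonicSum θ (m + 1) = harmonicSum θ m + 1 / (θ + m + 1) := Finset.sum_range_succ _ _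

lemma harmonicSum_nonneg {θ : ℝ} (hθ : 0 < θ) (m : ℕ) : 0 ≤ harmonicSum θ m :=
  Finset.sum_nonneg fun j _ => by positivity

/-- The expected Wiener index of the Hoppe tree with `m + 1` vertices, divided by
`(θ + m) (θ + m + 1)`. -/
def wienerConst (θ : ℝ) (m : ℕ) : ℝ :=
  harmonicSum θ m - (θ - 1) * harmonicSum θ m / (θ + m + 1) + 2 / (θ + m + 1) - 2 / (θ + 1)

/-- The martingale of the path length. -/
def pathMart (θ : ℝ) (m : ℕ) (p : ℕ → ℕ) : ℝ :=
  (ltree p m).shape.pathLength / (θ + m) - harmonicSum θ m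

/-- The martingale of the Wiener index. -/
def wienerMart (θ : ℝ) (m : ℕ) (p : ℕ → ℕ) : ℝ :=
  (ltree p m).shape.wiener / ((θ + m) * (θ + m + 1)) - wienerConst θ m
    + (θ - 1) * pathMart θ m p / (θ + m + 1)

section

variable {θ : ℝ} {p : ℕ → ℕ}

lemma ltree_parent_mem (hp : IsParent p) (m : ℕ) : p (m + 1) ∈ (ltree p m).labels := by
  simpa [ltree_labels hp] using hp (m + 1) (by omega)

lemma ltree_new_notMem (hp : IsParent p) (m : ℕ) : m + 1 ∉ (ltree p m).labels := by
  simp [ltree_labels hp]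

lemma ltree_depth_zero (m : ℕ) : (ltree p m).depth 0 = 0 := by
  simpa [ltree_root] using (ltree p m).depth_root

lemma ltree_distSum_zero (hp : IsParent p) (m : ℕ) :
    (ltree p m).distSum 0 = (ltree p m).shape.pathLength := by
  simpa [ltree_root] using LTree.distSum_root (ltree_nodup hp m)

/-- The root has depth zero, so its special weight leaves no trace in the sum. -/
lemma sum_attachProb_depth (hp : IsParent p) (m : ℕ) :
    ∑ a ∈ Finset.range (m + 1), attachProb θ m a * (ltree p m).depth a
      = (ltree p m).shape.pathLength / (θ + m) := by
  rw [sum_attachProb_mul, LTree.pathLength_shape (ltree_nodup hp m), ltree_labels hp,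
    ltree_depth_zero]
  simp

lemma sum_attachProb_sq_depth (hp : IsParent p) (m : ℕ) :
    ∑ a ∈ Finset.range (m + 1), attachProb θ m a * ((ltree p m).depth a : ℝ) ^ 2
      = (ltree p m).sqDepth / (θ + m) := by
  rw [sum_attachProb_mul θ m fun a => ((ltree p m).depth a : ℝ) ^ 2, LTree.sqDepth,
    ltree_labels hp, ltree_depth_zero]
  simp

/-- Here the root does contribute: its excess weight `θ - 1` multiplies its distance sum, the path
length. This drift is what the correction in `wienerMart` cancels. -/
lemma sum_attachProb_distSum (hp : IsParent p) (m : ℕ) :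
    ∑ a ∈ Finset.range (m + 1), attachProb θ m a * (ltree p m).distSum a
      = (2 * (ltree p m).shape.wiener + (θ - 1) * (ltree p m).shape.pathLength) / (θ + m) := by
  rw [sum_attachProb_mul, LTree.two_mul_wiener_shape (ltree_nodup hp m), ltree_distSum_zero hp,
    ltree_labels hp]
  simp_rw [LTree.distSum, ltree_labels hp]

lemma isTreeMartingale_pathMart (hθ : 0 < θ) :
    IsTreeMartingale θ (pathMart θ) (fun m p a => (ltree p m).depth a)
      (fun m => 1 / (θ + m + 1)) where
  dependsUpTo m := dependsUpTo_ltree m fun t => t.shape.pathLength / (θ + m) - harmonicSum θ m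
  dependsUpTo_increment m := dependsUpTo_ltree m fun t a => (t.depth a : ℝ)
  zero p := by simp [pathMart, ltree, LTree.shape, Shape.pathLength, harmonicSum]
  step m p hp := by
    rw [sum_attachProb_depth hp, pathMart, pathMart, ltree,
      LTree.pathLength_grow (ltree_nodup hp m) (ltree_new_notMem hp m) (ltree_parent_mem hp m),
      harmonicSum_succ]
    have : θ + m ≠ 0 := by positivity
    have : θ + m + 1 ≠ 0 := by positivity
    push_cast
    rw [← add_assoc]
    field_simp
    ring

/-- The factor `1 + 2 / (θ + m)` in the conditional mean dictates the normalization `(θ + m) (θ + m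
+ 1)`. The drift from the root is absorbed because `pathMart` is itself a martingale and `1 / (θ + m
+ 1)` decreases by `1 / ((θ + m + 1) (θ + m + 2))`; the deterministic rest defines `wienerConst`. -/
lemma isTreeMartingale_wienerMart (hθ : 0 < θ) :
    IsTreeMartingale θ (wienerMart θ)
      (fun m p a => (ltree p m).distSum a + (θ - 1) * (ltree p m).depth a)
      (fun m => 1 / ((θ + m + 1) * (θ + m + 2))) where
  dependsUpTo m := dependsUpTo_ltree m fun t => t.shape.wiener / ((θ + m) * (θ + m + 1))
    - wienerConst θ m + (θ - 1) * (t.shape.pathLength / (θ + m) - harmonicSum θ m) / (θ + m + 1)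
  dependsUpTo_increment m := dependsUpTo_ltree m fun t a => t.distSum a + (θ - 1) * (t.depth a : ℝ)
  zero p := by
    simp [wienerMart, pathMart, wienerConst, ltree, LTree.shape, Shape.pathLength, Shape.wiener,
      harmonicSum]
  step m p hp := by
    have h1 := (isTreeMartingale_pathMart hθ).step m p hp
    rw [sum_attachProb_depth hp] at h1
    have h2 : ∑ a ∈ Finset.range (m + 1), attachProb θ m a *
        ((ltree p m).distSum a + (θ - 1) * (ltree p m).depth a)
        = (2 * (ltree p m).shape.wiener + (θ - 1) * (ltree p m).shape.pathLength) / (θ + m)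
          + (θ - 1) * ((ltree p m).shape.pathLength / (θ + m)) := by
      rw [← sum_attachProb_distSum hp, ← sum_attachProb_depth hp, Finset.mul_sum,
        ← Finset.sum_add_distrib]
      exact Finset.sum_congr rfl fun a _ => by ring
    rw [h2, wienerMart, h1, wienerMart, ltree,
      LTree.wiener_grow (ltree_nodup hp m) (ltree_new_notMem hp m) (ltree_parent_mem hp m),
      ltree_labels hp, Finset.card_range, wienerConst, wienerConst, harmonicSum_succ, pathMart]
    have : θ + m ≠ 0 := by positivity
    have : θ + m + 1 ≠ 0 := by positivity
    have : θ + m + 2 ≠ 0 := by positivity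
    have : θ + 1 ≠ 0 := by positivity
    push_cast
    rw [show θ + ((m : ℝ) + 1) = θ + m + 1 by ring, show θ + (m : ℝ) + 1 + 1 = θ + m + 2 by ring]
    generalize (ltree p m).distSum (p (m + 1)) = S
    generalize ((ltree p m).depth (p (m + 1)) : ℝ) = D
    generalize (ltree p m).shape.wiener = W
    generalize (ltree p m).shape.pathLength = T
    generalize harmonicSum θ m = s
    field_simp
    ring

end

/-! ### Exact means and a second-moment bound for the depths. -/

section

variable {Ω : Type*} [MeasurableSpace Ω] {θ : ℝ} {J : ℕ → Ω → ℕ} {P : Measure Ω}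
  [IsProbabilityMeasure P]

lemma IsRegularHoppe.integrable_ltree (hJ : IsRegularHoppe θ J P) (m : ℕ) (f : LTree → ℝ) :
    Integrable (fun ω => f (ltree (fun k => J k ω) m)) P :=
  hJ.integrable (dependsUpTo_ltree m f)

lemma IsRegularHoppe.integral_pathLength (hθ : 0 < θ) (hJ : IsRegularHoppe θ J P) (m : ℕ) :
    ∫ ω, (ltree (fun k => J k ω) m).shape.pathLength ∂P = (θ + m) * harmonicSum θ m := by
  have h := (isTreeMartingale_pathMart hθ).integral_eq_zero hθ hJ m
  simp only [pathMart] at h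
  rw [integral_sub ((hJ.integrable_ltree m fun t => t.shape.pathLength).div_const _)
    (integrable_const _), integral_div, integral_const, probReal_univ, one_smul, sub_eq_zero] at h
  have : θ + m ≠ 0 := by positivity
  field_simp at h
  linarith

lemma IsRegularHoppe.integral_wiener (hθ : 0 < θ) (hJ : IsRegularHoppe θ J P) (m : ℕ) :
    ∫ ω, (ltree (fun k => J k ω) m).shape.wiener ∂P
      = (θ + m) * (θ + m + 1) * wienerConst θ m := by
  have h := (isTreeMartingale_wienerMart hθ).integral_eq_zero hθ hJ m
  have h2 := (isTreeMartingale_pathMart hθ).integral_eq_zero hθ hJ m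
  have hi := hJ.integrable ((isTreeMartingale_pathMart hθ).dependsUpTo m)
  have hw := hJ.integrable_ltree m fun t => t.shape.wiener
  simp only [wienerMart] at h
  have hw' : Integrable (fun ω => (ltree (fun k => J k ω) m).shape.wiener
      / ((θ + m) * (θ + m + 1)) - wienerConst θ m) P := (hw.div_const _).sub (integrable_const _)
  rw [integral_add hw' ((hi.const_mul _).div_const _),
    integral_sub (hw.div_const _)
    (integrable_const _), integral_div, integral_const, probReal_univ, one_smul, integral_div,
    integral_const_mul, h2, mul_zero, zero_div, add_zero, sub_eq_zero] at h
  have : θ + m ≠ 0 := by positivity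
  have : θ + m + 1 ≠ 0 := by positivity
  field_simp at h
  linarith

lemma IsRegularHoppe.integral_sqDepth_le (hθ : 0 < θ) (hJ : IsRegularHoppe θ J P) (m : ℕ) :
    ∫ ω, (ltree (fun k => J k ω) m).sqDepth ∂P
      ≤ (θ + m) * (harmonicSum θ m ^ 2 + harmonicSum θ m) := by
  induction m with
  | zero => simp [ltree, LTree.sqDepth, LTree.depth, harmonicSum]
  | succ m ih =>
    have h0 : 0 < θ + m := by positivity
    have e1 : ∫ ω, (ltree (fun k => J k ω) (m + 1)).sqDepth ∂P
        = ∫ ω, (ltree (fun k => J k ω) m).sqDepth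
          + ((ltree (fun k => J k ω) m).depth (J (m + 1) ω) + 1 : ℝ) ^ 2 ∂P := by
      refine integral_congr_ae (ae_of_all _ fun ω => ?_)
      have hp := hJ.isParent ω
      exact LTree.sqDepth_grow (ltree_nodup hp m) (ltree_new_notMem hp m) (ltree_parent_mem hp m)
    have e2 := hJ.integral_step (m := m)
      (Φ := fun p a => (ltree p m).sqDepth + ((ltree p m).depth a + 1 : ℝ) ^ 2)
      fun a => dependsUpTo_ltree m fun t => t.sqDepth + (t.depth a + 1 : ℝ) ^ 2
    -- Expanding `(depth + 1) ^ 2` closes the recursion on the sum of squared depths and the path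
    -- length, whose mean is known.
    have e3 : ∀ ω, ∑ a ∈ Finset.range (m + 1), attachProb θ m a *
        ((ltree (fun k => J k ω) m).sqDepth + ((ltree (fun k => J k ω) m).depth a + 1 : ℝ) ^ 2)
        = (1 + 1 / (θ + m)) * (ltree (fun k => J k ω) m).sqDepth
          + (2 / (θ + m) * (ltree (fun k => J k ω) m).shape.pathLength + 1) := by
      intro ω
      have hp := hJ.isParent ω
      have e4 : ∀ a, attachProb θ m a * ((ltree (fun k => J k ω) m).sqDepth
            + ((ltree (fun k => J k ω) m).depth a + 1 : ℝ) ^ 2)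
          = ((ltree (fun k => J k ω) m).sqDepth + 1) * attachProb θ m a
            + 2 * (attachProb θ m a * (ltree (fun k => J k ω) m).depth a)
            + attachProb θ m a * ((ltree (fun k => J k ω) m).depth a : ℝ) ^ 2 := by
        intro a
        ring
      simp_rw [e4]
      rw [Finset.sum_add_distrib, Finset.sum_add_distrib, ← Finset.mul_sum, ← Finset.mul_sum,
        sum_attachProb hθ, sum_attachProb_depth hp, sum_attachProb_sq_depth hp]
      ring
    simp_rw [e3] at e2
    have hq := hJ.integrable_ltree m fun t => t.sqDepth
    have hl := hJ.integrable_ltree m fun t => t.shape.pathLength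
    have hl' : Integrable (fun ω => 2 / (θ + m) * (ltree (fun k => J k ω) m).shape.pathLength + 1)
        P := (hl.const_mul _).add (integrable_const _)
    rw [integral_add (hq.const_mul _) hl',
      integral_add (hl.const_mul _) (integrable_const _), integral_const_mul, integral_const_mul,
      hJ.integral_pathLength hθ, integral_const, probReal_univ, one_smul] at e2
    rw [e1, e2, harmonicSum_succ]
    set s := harmonicSum θ m
    have h1 : (1 + 1 / (θ + m)) * ∫ ω, (ltree (fun k => J k ω) m).sqDepth ∂P
        ≤ (1 + 1 / (θ + m)) * ((θ + m) * (s ^ 2 + s)) := by gcongr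
    refine (add_le_add_left h1 _).trans ?_
    push_cast
    rw [show θ + ((m : ℝ) + 1) = θ + m + 1 by ring]
    have h2 : (1 + 1 / (θ + m)) * ((θ + m) * (s ^ 2 + s)) + (2 / (θ + m) * ((θ + m) * s) + 1)
        = (θ + m + 1) * (s ^ 2 + s) + 2 * s + 1 := by
      field_simp
      ring
    -- The claimed bound grows by exactly the recursion plus `1 / (θ + m + 1)`, which is the slack
    -- of the induction.
    have h3 : (θ + m + 1) * ((s + 1 / (θ + m + 1)) ^ 2 + (s + 1 / (θ + m + 1)))
        = (θ + m + 1) * (s ^ 2 + s) + 2 * s + 1 + 1 / (θ + m + 1) := by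
      have : θ + m + 1 ≠ 0 := by positivity
      field_simp
      ring
    rw [h2, h3]
    have : 0 ≤ 1 / (θ + m + 1) := by positivity
    linarith

end

/-! ### Growth of the harmonic sums and summability of the variances. -/

lemma harmonicSum_le {θ : ℝ} (hθ : 0 < θ) (m : ℕ) :
    harmonicSum θ m ≤ 1 + Real.log (m + 1) := by
  have h1 : harmonicSum θ m ≤ (harmonic m : ℝ) := by
    rw [harmonicSum, harmonic]
    push_cast
    refine Finset.sum_le_sum fun j _ => ?_
    rw [one_div]
    gcongr
    linarith
  have h2 : Real.log m ≤ Real.log (m + 1) := by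
    rcases Nat.eq_zero_or_pos m with rfl | hm
    · simp
    · gcongr
      linarith
  linarith [harmonic_le_one_add_log m]

lemma summable_harmonicSum {θ : ℝ} (hθ : 0 < θ) :
    Summable fun m : ℕ => (harmonicSum θ m ^ 2 + harmonicSum θ m) / ((m : ℝ) + 1) ^ 2 := by
  -- With `y = x ^ (1/4) ≥ 1` and `log x ≤ 4 y`, the harmonic sum is at most `5 y`, so its square
  -- plus itself is at most `25 y² + 5 y² = 30 y²`.
  have h1 : Summable fun m : ℕ => 30 * ((m : ℝ) + 1) ^ (-(3 / 2) : ℝ) := by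
    have := (summable_nat_add_iff 1).2 (Real.summable_nat_rpow.2 (show (-(3 / 2) : ℝ) < -1 by norm_num))
    refine Summable.mul_left _ ?_
    simpa using this
  refine h1.of_nonneg_of_le (fun m => ?_) fun m => ?_
  · have := harmonicSum_nonneg hθ m
    positivity
  · have hx : (1 : ℝ) ≤ (m : ℝ) + 1 := by linarith [(Nat.cast_nonneg m : (0 : ℝ) ≤ m)]
    set x := (m : ℝ) + 1
    have hx0 : 0 < x := by linarith
    have hs := harmonicSum_nonneg hθ m
    set y := x ^ (1 / 4 : ℝ) with hy
    have hy1 : 1 ≤ y := Real.one_le_rpow hx (by norm_num)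
    have h2 : harmonicSum θ m ≤ 5 * y := by
      have h3 := Real.log_le_rpow_div hx0.le (show (0 : ℝ) < 1 / 4 by norm_num)
      have h4 := harmonicSum_le hθ m
      rw [← hy] at h3
      have : y / (1 / 4) = 4 * y := by ring
      linarith
    have h3 : harmonicSum θ m ^ 2 + harmonicSum θ m ≤ 30 * y ^ 2 := by nlinarith
    have h4 : y ^ 2 / x ^ 2 = x ^ (-(3 / 2) : ℝ) := by
      rw [hy, ← Real.rpow_natCast, ← Real.rpow_mul hx0.le, ← Real.rpow_natCast x 2,
        ← Real.rpow_sub hx0]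
      norm_num
    rw [← h4, ← mul_div_assoc]
    gcongr

section

variable {Ω : Type*} [MeasurableSpace Ω] {θ : ℝ} {J : ℕ → Ω → ℕ} {P : Measure Ω}
  [IsProbabilityMeasure P]

lemma IsRegularHoppe.exists_limit_pathMart (hθ : 0 < θ) (hJ : IsRegularHoppe θ J P) :
    ∃ Z : Ω → ℝ, Measurable Z ∧ MemLp Z 2 P ∧ ∫ ω, Z ω ∂P = 0 ∧
      Tendsto (fun m => ∫ ω, (pathMart θ m (fun k => J k ω) - Z ω) ^ 2 ∂P) atTop (𝓝 0) := by
  refine (isTreeMartingale_pathMart hθ).exists_limit hθ hJ ?_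
  refine (summable_harmonicSum hθ).of_nonneg_of_le (fun m => ?_) fun m => ?_
  · exact mul_nonneg (sq_nonneg _) (integral_nonneg fun ω =>
      Finset.sum_nonneg fun a _ => mul_nonneg (attachProb_nonneg hθ m a) (sq_nonneg _))
  · have h0 : 0 < θ + m := by positivity
    simp_rw [fun ω => sum_attachProb_sq_depth (θ := θ) (hJ.isParent ω) m]
    rw [integral_div]
    have h1 : (∫ ω, (ltree (fun k => J k ω) m).sqDepth ∂P) / (θ + m)
        ≤ harmonicSum θ m ^ 2 + harmonicSum θ m := by
      rw [div_le_iff₀ h0, mul_comm]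
      exact hJ.integral_sqDepth_le hθ m
    have h2 : (1 / (θ + m + 1)) ^ 2 ≤ 1 / ((m : ℝ) + 1) ^ 2 := by
      rw [div_pow, one_pow]
      gcongr
      linarith
    have h3 := harmonicSum_nonneg hθ m
    calc _ ≤ 1 / ((m : ℝ) + 1) ^ 2 * (harmonicSum θ m ^ 2 + harmonicSum θ m) :=
          mul_le_mul h2 h1 (div_nonneg (integral_nonneg fun ω =>
            Finset.sum_nonneg fun a _ => sq_nonneg _) h0.le) (by positivity)
      _ = _ := by ring

/-- The distance sum is at most `m + 1` times the depth plus the path length. Then `(a + b)² ≤ 2a² +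
2b²`, and Cauchy–Schwarz bounds the squared path length, so only the squared depths remain. -/
lemma sum_attachProb_sq_distSum_le (hθ : 0 < θ) {p : ℕ → ℕ} (hp : IsParent p) (m : ℕ) :
    ∑ a ∈ Finset.range (m + 1), attachProb θ m a *
      ((ltree p m).distSum a + (θ - 1) * (ltree p m).depth a) ^ 2
      ≤ (2 * (m + 1 + |θ - 1|) ^ 2 / (θ + m) + 2 * (m + 1)) * (ltree p m).sqDepth := by
  set t := ltree p m with ht
  have hn : t.Nodup := ltree_nodup hp m
  have hcard : (t.labels.card : ℝ) = m + 1 := by simp [ht, ltree_labels hp]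
  have h1 : ∀ a, (t.distSum a + (θ - 1) * t.depth a) ^ 2
      ≤ 2 * (m + 1 + |θ - 1|) ^ 2 * (t.depth a : ℝ) ^ 2 + 2 * t.shape.pathLength ^ 2 := by
    intro a
    have hS := LTree.distSum_le hn a
    rw [hcard] at hS
    have hS0 := LTree.distSum_nonneg t a
    have hD : (0 : ℝ) ≤ t.depth a := Nat.cast_nonneg _
    have hT : 0 ≤ t.shape.pathLength := by
      rw [LTree.pathLength_shape hn]
      positivity
    have h2 : |t.distSum a + (θ - 1) * t.depth a|
        ≤ (m + 1 + |θ - 1|) * t.depth a + t.shape.pathLength := by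
      refine (abs_add_le _ _).trans ?_
      rw [abs_of_nonneg hS0, abs_mul, abs_of_nonneg hD]
      linarith
    have h3 : |t.distSum a + (θ - 1) * t.depth a| ^ 2
        ≤ ((m + 1 + |θ - 1|) * t.depth a + t.shape.pathLength) ^ 2 := by gcongr
    rw [sq_abs] at h3
    refine h3.trans ?_
    nlinarith [sq_nonneg ((m + 1 + |θ - 1|) * t.depth a - t.shape.pathLength)]
  calc _ ≤ ∑ a ∈ Finset.range (m + 1), attachProb θ m a *
        (2 * (m + 1 + |θ - 1|) ^ 2 * (t.depth a : ℝ) ^ 2 + 2 * t.shape.pathLength ^ 2) :=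
        Finset.sum_le_sum fun a _ => mul_le_mul_of_nonneg_left (h1 a) (attachProb_nonneg hθ m a)
    _ = 2 * (m + 1 + |θ - 1|) ^ 2 * (t.sqDepth / (θ + m)) + 2 * t.shape.pathLength ^ 2 := by
        have e : ∑ a ∈ Finset.range (m + 1), attachProb θ m a * (2 * t.shape.pathLength ^ 2)
            = 2 * t.shape.pathLength ^ 2 := by
          rw [← Finset.sum_mul, sum_attachProb hθ, one_mul]
        rw [← sum_attachProb_sq_depth hp, Finset.mul_sum]
        nth_rw 2 [← e]
        rw [← Finset.sum_add_distrib]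
        exact Finset.sum_congr rfl fun a _ => by rw [← ht]; ring
    _ ≤ 2 * (m + 1 + |θ - 1|) ^ 2 * (t.sqDepth / (θ + m)) + 2 * ((m + 1) * t.sqDepth) := by
        have := LTree.sq_pathLength_le hn
        rw [hcard] at this
        gcongr
    _ = _ := by ring

/-- The squared increments of the Wiener index have mean of order `m²` times the squared harmonic
sum, against a squared normalization of order `m⁻⁴`. -/
lemma IsRegularHoppe.exists_limit_wienerMart (hθ : 0 < θ) (hJ : IsRegularHoppe θ J P) :
    ∃ Z : Ω → ℝ, Measurable Z ∧ MemLp Z 2 P ∧ ∫ ω, Z ω ∂P = 0 ∧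
      Tendsto (fun m => ∫ ω, (wienerMart θ m (fun k => J k ω) - Z ω) ^ 2 ∂P) atTop (𝓝 0) := by
  refine (isTreeMartingale_wienerMart hθ).exists_limit hθ hJ ?_
  refine ((summable_harmonicSum hθ).mul_left (2 * (1 + |θ - 1|) ^ 2 + 2)).of_nonneg_of_le
    (fun m => ?_) fun m => ?_
  · exact mul_nonneg (sq_nonneg _) (integral_nonneg fun ω =>
      Finset.sum_nonneg fun a _ => mul_nonneg (attachProb_nonneg hθ m a) (sq_nonneg _))
  · have h0 : 0 < θ + m := by positivity
    set s := harmonicSum θ m ^ 2 + harmonicSum θ m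
    have hs : 0 ≤ s := by
      have := harmonicSum_nonneg hθ m
      positivity
    have h1 : ∫ ω, ∑ a ∈ Finset.range (m + 1), attachProb θ m a *
        ((ltree (fun k => J k ω) m).distSum a
          + (θ - 1) * (ltree (fun k => J k ω) m).depth a) ^ 2 ∂P
        ≤ (2 * (m + 1 + |θ - 1|) ^ 2 / (θ + m) + 2 * (m + 1)) * ((θ + m) * s) := by
      calc _ ≤ ∫ ω, (2 * (m + 1 + |θ - 1|) ^ 2 / (θ + m) + 2 * (m + 1))
            * (ltree (fun k => J k ω) m).sqDepth ∂P := by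
            refine integral_mono ?_ ((hJ.integrable_ltree m fun t => t.sqDepth).const_mul _)
              fun ω => sum_attachProb_sq_distSum_le hθ (hJ.isParent ω) m
            exact hJ.integrable_ltree m fun t => ∑ a ∈ Finset.range (m + 1), attachProb θ m a *
              (t.distSum a + (θ - 1) * t.depth a) ^ 2
        _ ≤ _ := by
            rw [integral_const_mul]
            gcongr
            exact hJ.integral_sqDepth_le hθ m
    have h2 : (2 * (m + 1 + |θ - 1|) ^ 2 / (θ + m) + 2 * (m + 1)) * ((θ + m) * s)
        ≤ (2 * (1 + |θ - 1|) ^ 2 + 2) * (θ + m + 1) ^ 2 * s := by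
      have e : (2 * (m + 1 + |θ - 1|) ^ 2 / (θ + m) + 2 * (m + 1)) * ((θ + m) * s)
          = (2 * (m + 1 + |θ - 1|) ^ 2 + 2 * ((m + 1) * (θ + m))) * s := by
        field_simp
      rw [e]
      have hm : (0 : ℝ) ≤ m := Nat.cast_nonneg _
      have e1 : (m + 1 + |θ - 1|) ^ 2 ≤ ((1 + |θ - 1|) * (θ + m + 1)) ^ 2 := by
        gcongr
        nlinarith [abs_nonneg (θ - 1)]
      have e2 : (m + 1) * (θ + m) ≤ (θ + m + 1) ^ 2 := by nlinarith
      refine mul_le_mul_of_nonneg_right ?_ hs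
      nlinarith
    have h3 : (1 / ((θ + m + 1) * (θ + m + 2))) ^ 2 * (θ + m + 1) ^ 2 ≤ 1 / ((m : ℝ) + 1) ^ 2 := by
      have : (1 / ((θ + m + 1) * (θ + m + 2))) ^ 2 * (θ + m + 1) ^ 2 = 1 / (θ + m + 2) ^ 2 := by
        field_simp
      rw [this]
      gcongr <;> linarith
    calc _ ≤ (1 / ((θ + m + 1) * (θ + m + 2))) ^ 2 *
          ((2 * (1 + |θ - 1|) ^ 2 + 2) * (θ + m + 1) ^ 2 * s) := by
          gcongr
          exact h1.trans h2
      _ = (2 * (1 + |θ - 1|) ^ 2 + 2) * s *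
          ((1 / ((θ + m + 1) * (θ + m + 2))) ^ 2 * (θ + m + 1) ^ 2) := by ring
      _ ≤ (2 * (1 + |θ - 1|) ^ 2 + 2) * s * (1 / ((m : ℝ) + 1) ^ 2) := by gcongr
      _ = _ := by ring

end

/-! ### Digamma function and expected values -/

lemma differentiableAt_Gamma_of_pos {x : ℝ} (hx : 0 < x) : DifferentiableAt ℝ Real.Gamma x :=
  Real.differentiableAt_Gamma fun m => by
    have : (0 : ℝ) ≤ m := Nat.cast_nonneg m
    linarith

lemma digamma_add_one {x : ℝ} (hx : 0 < x) : digamma (x + 1) = digamma x + 1 / x := by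
  have hG := Real.Gamma_pos_of_pos hx
  have h1 : HasDerivAt (fun y => Real.Gamma (y + 1)) (deriv Real.Gamma (x + 1)) x :=
    (differentiableAt_Gamma_of_pos (by linarith : 0 < x + 1)).hasDerivAt.comp_add_const x 1
  have h2 : HasDerivAt (fun y => y * Real.Gamma y) (1 * Real.Gamma x + x * deriv Real.Gamma x) x :=
    (hasDerivAt_id x).mul (differentiableAt_Gamma_of_pos hx).hasDerivAt
  have h3 : (fun y => Real.Gamma (y + 1)) =ᶠ[𝓝 x] fun y => y * Real.Gamma y := by
    filter_upwards [lt_mem_nhds hx] with y hy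
    exact Real.Gamma_add_one hy.ne'
  have h4 := h1.unique (h2.congr_of_eventuallyEq h3)
  rw [digamma, digamma, logDeriv_apply, logDeriv_apply, h4, Real.Gamma_add_one hx.ne']
  field_simp
  ring

lemma hasDerivAt_log_Gamma {x : ℝ} (hx : 0 < x) :
    HasDerivAt (Real.log ∘ Real.Gamma) (digamma x) x := by
  have := (differentiableAt_Gamma_of_pos hx).hasDerivAt.log (Real.Gamma_pos_of_pos hx).ne'
  exact this

/-- `log Γ` is convex and its slope over `[x, x + 1]` is `log x`, which lies between the derivatives
at the endpoints. -/
lemma digamma_bounds {x : ℝ} (hx : 0 < x) :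
    digamma x ≤ Real.log x ∧ Real.log x ≤ digamma (x + 1) := by
  have hc := Real.convexOn_log_Gamma
  have hx1 : 0 < x + 1 := by linarith
  have hs : slope (Real.log ∘ Real.Gamma) x (x + 1) = Real.log x := by
    rw [slope_def_field, Function.comp, Function.comp, Real.Gamma_add_one hx.ne',
      Real.log_mul hx.ne' (Real.Gamma_pos_of_pos hx).ne']
    ring
  constructor
  · rw [← hs]
    exact hc.le_slope_of_hasDerivAt hx hx1 (by linarith) (hasDerivAt_log_Gamma hx)
  · rw [← hs]
    exact hc.slope_le_of_hasDerivAt hx hx1 (by linarith) (hasDerivAt_log_Gamma hx1)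

lemma harmonicSum_eq {θ : ℝ} (hθ : 0 < θ) (m : ℕ) :
    harmonicSum θ m = digamma (θ + m + 1) - digamma (θ + 1) := by
  induction m with
  | zero => simp [harmonicSum]
  | succ m ih =>
    rw [harmonicSum_succ, ih]
    push_cast
    rw [← add_assoc, digamma_add_one (show 0 < θ + m + 1 by positivity)]
    ring

lemma tendsto_harmonicSum_sub_log {θ : ℝ} (hθ : 0 < θ) :
    Tendsto (fun m : ℕ => harmonicSum θ m - Real.log (m + 1)) atTop (𝓝 (-digamma (θ + 1))) := by
  have hlog : ∀ c : ℝ, 0 < c →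
      Tendsto (fun m : ℕ => Real.log (c + m) - Real.log (m + 1)) atTop (𝓝 0) := by
    intro c hc
    have h1 : Tendsto (fun m : ℕ => 1 + (c - 1) / ((m : ℝ) + 1)) atTop (𝓝 (1 + 0)) :=
      tendsto_const_nhds.add (tendsto_const_nhds.div_atTop
        (tendsto_atTop_add_const_right _ _ tendsto_natCast_atTop_atTop))
    rw [add_zero] at h1
    have h2 := h1.log one_ne_zero
    rw [Real.log_one] at h2
    refine h2.congr fun m => ?_
    rw [← Real.log_div (by positivity) (by positivity)]
    congr 1
    field_simp
    ring
  have h0 := hlog θ hθ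
  have h1 := hlog (θ + 1) (by positivity)
  have h2 : Tendsto (fun m : ℕ => digamma (θ + m + 1) - Real.log (m + 1)) atTop (𝓝 0) := by
    refine tendsto_of_tendsto_of_tendsto_of_le_of_le h0 h1 (fun m => ?_) fun m => ?_
    · simp only
      linarith [(digamma_bounds (show 0 < θ + m by positivity)).2]
    · simp only
      rw [show θ + 1 + (m : ℝ) = θ + m + 1 by ring]
      linarith [(digamma_bounds (show 0 < θ + m + 1 by positivity)).1]
  have h3 := h2.sub_const (digamma (θ + 1))
  rw [zero_sub] at h3
  refine h3.congr fun m => ?_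
  rw [harmonicSum_eq hθ]
  ring

lemma tendsto_harmonicSum_div {θ : ℝ} (hθ : 0 < θ) :
    Tendsto (fun m : ℕ => harmonicSum θ m / ((m : ℝ) + 1)) atTop (𝓝 0) := by
  have hx : Tendsto (fun m : ℕ => (m : ℝ) + 1) atTop atTop :=
    tendsto_atTop_add_const_right _ _ tendsto_natCast_atTop_atTop
  have h1 : Tendsto (fun m : ℕ => Real.log ((m : ℝ) + 1) / ((m : ℝ) + 1)) atTop (𝓝 0) :=
    (Real.isLittleO_log_id_atTop.tendsto_div_nhds_zero).comp hx
  have h2 : Tendsto (fun m : ℕ => (harmonicSum θ m - Real.log (m + 1)) / ((m : ℝ) + 1)) atTop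
      (𝓝 0) := (tendsto_harmonicSum_sub_log hθ).div_atTop hx
  have := h1.add h2
  rw [add_zero] at this
  refine this.congr fun m => ?_
  ring

/-- The expected path length of the Hoppe tree with `m + 1` vertices. -/
def meanPath (θ : ℝ) (m : ℕ) : ℝ := (θ + m) * harmonicSum θ m

/-- The expected Wiener index of the Hoppe tree with `m + 1` vertices. -/
def meanWiener (θ : ℝ) (m : ℕ) : ℝ := (θ + m) * (θ + m + 1) * wienerConst θ m

/-- Error term in the expansion of `meanPath`. -/
def pathError (θ : ℝ) (m : ℕ) : ℝ :=
  meanPath θ m / ((m : ℝ) + 1) - Real.log (m + 1) + digamma (θ + 1)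

/-- Error term in the expansion of `meanWiener`. -/
def wienerError (θ : ℝ) (m : ℕ) : ℝ :=
  meanWiener θ m / ((m : ℝ) + 1) ^ 2 - Real.log (m + 1) + digamma (θ + 1) + 2 / (θ + 1)

/-- With `n = m + 1` this says `E T / n = log n - Ψ(θ + 1) + o(1)`. -/
lemma tendsto_pathError {θ : ℝ} (hθ : 0 < θ) : Tendsto (pathError θ) atTop (𝓝 0) := by
  have h := ((tendsto_harmonicSum_sub_log hθ).add_const (digamma (θ + 1))).add
    ((tendsto_harmonicSum_div hθ).const_mul (θ - 1))
  rw [neg_add_cancel, mul_zero, add_zero] at h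
  refine h.congr fun m => ?_
  rw [pathError, meanPath]
  field_simp
  ring

lemma tendsto_wienerError {θ : ℝ} (hθ : 0 < θ) : Tendsto (wienerError θ) atTop (𝓝 0) := by
  have hx : Tendsto (fun m : ℕ => (m : ℝ) + 1) atTop atTop :=
    tendsto_atTop_add_const_right _ _ tendsto_natCast_atTop_atTop
  have hc : ∀ c : ℝ, Tendsto (fun m : ℕ => c / ((m : ℝ) + 1)) atTop (𝓝 0) :=
    fun c => tendsto_const_nhds.div_atTop hx
  -- With `n = m + 1`, the harmonic sum appears in the scaled mean with the factor `(θ + m) (m + 2)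
  -- / n² = 1 + (θ + (θ - 1) / n) / n`, and `-2 / (θ + 1)` with the factor `(θ + m) m / n² = (1 + (θ
  -- - 1) / n) (1 - 1 / n)`.
  have h := ((tendsto_harmonicSum_sub_log hθ).add_const (digamma (θ + 1))).add
    ((tendsto_harmonicSum_div hθ).mul ((hc (θ - 1)).const_add θ))
  have h2 := (((hc (θ - 1)).const_add 1).mul ((hc 1).const_sub 1)).const_sub 1
  have h3 := h.add (h2.const_mul (2 / (θ + 1)))
  simp only [neg_add_cancel, add_zero, zero_mul, sub_zero, mul_one, sub_self, mul_zero] at h3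
  refine h3.congr fun m => ?_
  rw [wienerError, meanWiener, wienerConst]
  have h1 : θ + m + 1 ≠ 0 := by positivity
  field_simp
  ring

/-- The additive term in the recursion for the standardized pair, for the splitting into trees
with `i + 1` and `j + 1` vertices. -/
def toll (θ : ℝ) (i j : ℕ) : ℝ × ℝ :=
  ((meanWiener θ i + meanWiener 1 j + (j + 1) * meanPath θ i + (i + 1) * meanPath 1 j
      + (i + 1) * (j + 1) - meanWiener θ (i + j + 1)) / ((i : ℝ) + j + 2) ^ 2,
   (meanPath θ i + meanPath 1 j + (j + 1) - meanPath θ (i + j + 1)) / ((i : ℝ) + j + 2))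

/-- An exact identity. The logarithms combine as `(1 - v) log (i + 1) + v log (j + 1) - log (m +
2)`, which is the entropy at `v = share m j`, and the digamma constants leave `(Ψ(θ + 1) - Ψ(2)) v`.
-/
lemma toll_snd {θ : ℝ} {i j m : ℕ} (h : i + j = m) :
    (toll θ i j).2 = (bHoppe θ (share m j)).2
      + ((1 - share m j) * pathError θ i + share m j * pathError 1 j - pathError θ (m + 1)) := by
  subst h
  have e1 : share (i + j) j = ((j : ℝ) + 1) / (i + j + 2) := by simp [share]
  have e2 : 1 - share (i + j) j = ((i : ℝ) + 1) / (i + j + 2) := by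
    rw [one_sub_share rfl]
    simp
  simp only [bHoppe, entropy]
  rw [e2, e1, Real.log_div (by positivity) (by positivity),
    Real.log_div (by positivity) (by positivity), toll, pathError, pathError, pathError,
    show (1 : ℝ) + 1 = 2 by norm_num]
  push_cast
  rw [show (i : ℝ) + j + 1 + 1 = i + j + 2 by ring]
  field_simp
  ring

/-- The squared and mixed weights of each logarithm add up to `1 - v` and `v`, so the same entropy
appears. The constants `-2 / (θ + 1)` and `-1` of the Wiener means, with `v (1 - v)` from the cut
edge, produce the polynomial part of `b*`. -/
lemma toll_fst {θ : ℝ} (hθ : 0 < θ) {i j m : ℕ} (h : i + j = m) :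
    (toll θ i j).1 = (bHoppe θ (share m j)).1
      + ((1 - share m j) ^ 2 * wienerError θ i + share m j ^ 2 * wienerError 1 j
        + share m j * (1 - share m j) * (pathError θ i + pathError 1 j)
        - wienerError θ (m + 1)) := by
  subst h
  have e1 : share (i + j) j = ((j : ℝ) + 1) / (i + j + 2) := by simp [share]
  have e2 : 1 - share (i + j) j = ((i : ℝ) + 1) / (i + j + 2) := by
    rw [one_sub_share rfl]
    simp
  have h0 : θ + 1 ≠ 0 := by positivity
  simp only [bHoppe, entropy]
  rw [e2, e1, Real.log_div (by positivity) (by positivity),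
    Real.log_div (by positivity) (by positivity), toll, pathError, pathError, wienerError,
    wienerError, wienerError, show (1 : ℝ) + 1 = 2 by norm_num]
  push_cast
  rw [show (i : ℝ) + j + 1 + 1 = i + j + 2 by ring]
  field_simp
  ring

/-! ### The limit vector -/

/-- The standardized pair, as a function of the shape of the tree with `m + 1` vertices. -/
def normShape (θ : ℝ) (m : ℕ) (t : Shape) : ℝ × ℝ :=
  ((t.wiener - meanWiener θ m) / ((m : ℝ) + 1) ^ 2,
   (t.pathLength - meanPath θ m) / ((m : ℝ) + 1))

section

variable {Ω : Type*} [MeasurableSpace Ω] {θ : ℝ} {J : ℕ → Ω → ℕ} {P : Measure Ω}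
  {Z : Ω → ℝ × ℝ}

lemma IsRegularHoppe.measurable_normShape (hJ : IsRegularHoppe θ J P) (m : ℕ) :
    Measurable fun ω => normShape θ m (ltree (fun k => J k ω) m).shape :=
  (hJ.measurable_comp (dependsUpTo_ltree m fun t => (normShape θ m t.shape).1)).prodMk
    (hJ.measurable_comp (dependsUpTo_ltree m fun t => (normShape θ m t.shape).2))

/-- The `L¹` distance between the standardized pair and its limit. -/
def l1Error (θ : ℝ) (J : ℕ → Ω → ℕ) (P : Measure Ω) (Z : Ω → ℝ × ℝ) (m : ℕ) : ℝ :=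
  ∫ ω, (|(normShape θ m (ltree (fun k => J k ω) m).shape).1 - (Z ω).1|
    + |(normShape θ m (ltree (fun k => J k ω) m).shape).2 - (Z ω).2|) ∂P

lemma l1Error_nonneg (m : ℕ) : 0 ≤ l1Error θ J P Z m :=
  integral_nonneg fun ω => by positivity

variable [IsProbabilityMeasure P]

lemma IsRegularHoppe.standardized_succ (hθ : 0 < θ) (hJ : IsRegularHoppe θ J P) (m : ℕ) (ω : Ω) :
    standardized J P (m + 1) ω = normShape θ m (ltree (fun k => J k ω) m).shape := by
  have h1 : ∀ ω, (wienerIndex (fun k => J k ω) (m + 1) : ℝ)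
      = (ltree (fun k => J k ω) m).shape.wiener := fun ω => by
    rw [← wiener_shapeOf (hJ.isParent ω) (by omega)]
    rfl
  have h2 : ∀ ω, (totalLength (fun k => J k ω) (m + 1) : ℝ)
      = (ltree (fun k => J k ω) m).shape.pathLength := fun ω => by
    rw [← pathLength_shapeOf (hJ.isParent ω) (by omega)]
    rfl
  simp only [standardized, h1, h2]
  rw [hJ.integral_wiener hθ, hJ.integral_pathLength hθ, normShape, meanWiener, meanPath]
  push_cast
  rfl

/-- `Z` is the limit in `L²` of the standardized pairs of the Hoppe tree with parents `J`. -/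
structure IsL2Limit (θ : ℝ) (J : ℕ → Ω → ℕ) (P : Measure Ω) (Z : Ω → ℝ × ℝ) : Prop where
  regular : IsRegularHoppe θ J P
  measurable : Measurable Z
  memLp_fst : MemLp (fun ω => (Z ω).1) 2 P
  memLp_snd : MemLp (fun ω => (Z ω).2) 2 P
  integral_fst : ∫ ω, (Z ω).1 ∂P = 0
  integral_snd : ∫ ω, (Z ω).2 ∂P = 0
  tendsto_fst : Tendsto (fun m => ∫ ω,
    ((normShape θ m (ltree (fun k => J k ω) m).shape).1 - (Z ω).1) ^ 2 ∂P) atTop (𝓝 0)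
  tendsto_snd : Tendsto (fun m => ∫ ω,
    ((normShape θ m (ltree (fun k => J k ω) m).shape).2 - (Z ω).2) ^ 2 ∂P) atTop (𝓝 0)

lemma tendsto_add_nat_div (c : ℝ) :
    Tendsto (fun m : ℕ => (c + m) / ((m : ℝ) + 1)) atTop (𝓝 1) := by
  have h1 : Tendsto (fun m : ℕ => 1 + (c - 1) / ((m : ℝ) + 1)) atTop (𝓝 (1 + 0)) :=
    tendsto_const_nhds.add (tendsto_const_nhds.div_atTop
      (tendsto_atTop_add_const_right _ _ tendsto_natCast_atTop_atTop))
  rw [add_zero] at h1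
  refine h1.congr fun m => ?_
  field_simp
  ring

lemma IsRegularHoppe.exists_isL2Limit (hθ : 0 < θ) (hJ : IsRegularHoppe θ J P) :
    ∃ Z : Ω → ℝ × ℝ, IsL2Limit θ J P Z := by
  obtain ⟨X, hX0, hX1, hX2, hX3⟩ := hJ.exists_limit_wienerMart hθ
  obtain ⟨Y, hY0, hY1, hY2, hY3⟩ := hJ.exists_limit_pathMart hθ
  have hXm : ∀ m, MemLp (fun ω => wienerMart θ m (fun k => J k ω)) 2 P :=
    fun m => hJ.memLp ((isTreeMartingale_wienerMart hθ).dependsUpTo m) 2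
  have hYm : ∀ m, MemLp (fun ω => pathMart θ m (fun k => J k ω)) 2 P :=
    fun m => hJ.memLp ((isTreeMartingale_pathMart hθ).dependsUpTo m) 2
  refine ⟨fun ω => (X ω, Y ω), hJ, hX0.prodMk hY0, hX1, hY1, hX2, hY2, ?_, ?_⟩
  -- The first factor changes the normalization to `(m + 1)²`; the second, with `1 - θ`, subtracts
  -- the path-length correction, which is of lower order.
  · have ha : Tendsto (fun m : ℕ => (θ + m) / ((m : ℝ) + 1) * ((θ + 1 + m) / ((m : ℝ) + 1))) atTop
        (𝓝 1) := by
      simpa using (tendsto_add_nat_div θ).mul (tendsto_add_nat_div (θ + 1))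
    have hb : Tendsto (fun m : ℕ => (θ + m) / ((m : ℝ) + 1) * ((1 - θ) / ((m : ℝ) + 1))) atTop
        (𝓝 0) := by
      have h1 : Tendsto (fun m : ℕ => (1 - θ) / ((m : ℝ) + 1)) atTop (𝓝 0) :=
        tendsto_const_nhds.div_atTop
          (tendsto_atTop_add_const_right _ _ tendsto_natCast_atTop_atTop)
      simpa using (tendsto_add_nat_div θ).mul h1
    refine (tendsto_sq_combination hXm hX1 hYm hY1 hX3 hY3 ha hb).congr fun m => ?_
    refine integral_congr_ae (ae_of_all _ fun ω => ?_)
    simp only [normShape, wienerMart, meanWiener]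
    have : θ + m ≠ 0 := by positivity
    have : θ + m + 1 ≠ 0 := by positivity
    congr 2
    rw [show θ + 1 + (m : ℝ) = θ + m + 1 by ring]
    field_simp
    ring
  · refine (tendsto_sq_combination hYm hY1 hYm hY1 hY3 hY3 (tendsto_add_nat_div θ)
      (tendsto_const_nhds (x := (0 : ℝ)))).congr fun m => ?_
    refine integral_congr_ae (ae_of_all _ fun ω => ?_)
    simp only [normShape, pathMart, meanPath]
    have : θ + m ≠ 0 := by positivity
    congr 2
    field_simp
    ring

lemma IsRegularHoppe.memLp_normShape (hJ : IsRegularHoppe θ J P) (m : ℕ) :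
    MemLp (fun ω => (normShape θ m (ltree (fun k => J k ω) m).shape).1) 2 P ∧
      MemLp (fun ω => (normShape θ m (ltree (fun k => J k ω) m).shape).2) 2 P :=
  ⟨hJ.memLp (dependsUpTo_ltree m fun t => (normShape θ m t.shape).1) 2,
    hJ.memLp (dependsUpTo_ltree m fun t => (normShape θ m t.shape).2) 2⟩

lemma IsL2Limit.integrable_error (hZ : IsL2Limit θ J P Z) (m : ℕ) :
    Integrable (fun ω => |(normShape θ m (ltree (fun k => J k ω) m).shape).1 - (Z ω).1|
      + |(normShape θ m (ltree (fun k => J k ω) m).shape).2 - (Z ω).2|) P := by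
  obtain ⟨h1, h2⟩ := hZ.regular.memLp_normShape m
  exact (((h1.sub hZ.memLp_fst).integrable (by norm_num)).abs).add
    (((h2.sub hZ.memLp_snd).integrable (by norm_num)).abs)

lemma IsL2Limit.tendsto_l1Error (hZ : IsL2Limit θ J P Z) :
    Tendsto (l1Error θ J P Z) atTop (𝓝 0) := by
  have h := hZ.tendsto_fst.sqrt.add hZ.tendsto_snd.sqrt
  rw [Real.sqrt_zero, add_zero] at h
  refine squeeze_zero l1Error_nonneg (fun m => ?_) h
  obtain ⟨h1, h2⟩ := hZ.regular.memLp_normShape m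
  have h3 := h1.sub hZ.memLp_fst
  have h4 := h2.sub hZ.memLp_snd
  refine (integral_add (h3.integrable (by norm_num)).abs
    (h4.integrable (by norm_num)).abs).trans_le ?_
  exact add_le_add (integral_abs_le_sqrt h3) (integral_abs_le_sqrt h4)

/-! ### Weak convergence and equality of laws through bounded Lipschitz functions. -/

lemma norm_le_abs_add_abs (x : ℝ × ℝ) : ‖x‖ ≤ |x.1| + |x.2| := by
  rw [Prod.norm_def, Real.norm_eq_abs, Real.norm_eq_abs]
  exact max_le (by linarith [abs_nonneg x.2]) (by linarith [abs_nonneg x.1])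

/-- Bounded Lipschitz test functions. -/
structure IsTest (f : ℝ × ℝ → ℝ) (C L : ℝ) : Prop where
  bound : ∀ x, |f x| ≤ C
  lip : ∀ x y, |f x - f y| ≤ L * ‖x - y‖
  nonneg : 0 ≤ L

lemma IsTest.continuous {f : ℝ × ℝ → ℝ} {C L : ℝ} (hf : IsTest f C L) : Continuous f :=
  (LipschitzWith.of_dist_le_mul (K := ⟨L, hf.nonneg⟩) fun x y => by
    rw [Real.dist_eq, dist_eq_norm]; exact hf.lip x y).continuous

lemma IsTest.integrable {f : ℝ × ℝ → ℝ} {C L : ℝ} (hf : IsTest f C L) {α : Type*}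
    [MeasurableSpace α] {μ : Measure α} [IsFiniteMeasure μ] {X : α → ℝ × ℝ} (hX : Measurable X) :
    Integrable (fun a => f (X a)) μ :=
  Integrable.of_bound (hf.continuous.measurable.comp hX).aestronglyMeasurable C
    (ae_of_all _ fun a => hf.bound (X a))

lemma exists_isTest {f : ℝ × ℝ → ℝ} (h1 : ∃ C : ℝ, ∀ x y, dist (f x) (f y) ≤ C)
    (h2 : ∃ L, LipschitzWith L f) : ∃ C L, IsTest f C L := by
  obtain ⟨C, hC⟩ := h1
  obtain ⟨L, hL⟩ := h2
  refine ⟨|f 0| + C, L, fun x => ?_, fun x y => ?_, L.2⟩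
  · have h := hC x 0
    rw [Real.dist_eq] at h
    linarith [abs_sub_abs_le_abs_sub (f x) (f 0)]
  · have h := hL.dist_le_mul x y
    rwa [Real.dist_eq, dist_eq_norm] at h

lemma tendsto_probabilityMeasure_of_isTest {μ : ℕ → ProbabilityMeasure (ℝ × ℝ)}
    {ν : ProbabilityMeasure (ℝ × ℝ)}
    (h : ∀ f C L, IsTest f C L → Tendsto (fun n => ∫ x, f x ∂(μ n : Measure (ℝ × ℝ))) atTop
      (𝓝 (∫ x, f x ∂(ν : Measure (ℝ × ℝ))))) :
    Tendsto μ atTop (𝓝 ν) := by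
  rw [tendsto_iff_forall_lipschitz_integral_tendsto]
  intro f h1 h2
  obtain ⟨C, L, hf⟩ := exists_isTest h1 h2
  exact h f C L hf

/-- The constant sequence `μ` converges weakly to `ν`, and weak limits are unique. -/
lemma probabilityMeasure_ext_of_isTest {μ ν : ProbabilityMeasure (ℝ × ℝ)}
    (h : ∀ f C L, IsTest f C L →
      ∫ x, f x ∂(μ : Measure (ℝ × ℝ)) = ∫ x, f x ∂(ν : Measure (ℝ × ℝ))) : μ = ν := by
  refine tendsto_nhds_unique (tendsto_const_nhds (x := μ) (f := atTop (α := ℕ)))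
    (tendsto_probabilityMeasure_of_isTest fun f C L hf => ?_)
  rw [h f C L hf]
  exact tendsto_const_nhds

lemma IsL2Limit.tendsto_shapeMean (hZ : IsL2Limit θ J P Z) {f : ℝ × ℝ → ℝ} {C L : ℝ}
    (hf : IsTest f C L) :
    Tendsto (fun m => shapeMean θ m fun t => f (normShape θ m t)) atTop
      (𝓝 (∫ ω, f (Z ω) ∂P)) := by
  simp_rw [← hZ.regular.integral_shape]
  rw [tendsto_iff_norm_sub_tendsto_zero]
  have h := hZ.tendsto_l1Error.const_mul L
  rw [mul_zero] at h
  refine squeeze_zero (fun m => norm_nonneg _) (fun m => ?_) h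
  rw [← integral_sub (hf.integrable (hZ.regular.measurable_normShape m))
    (hf.integrable hZ.measurable), l1Error, ← integral_const_mul]
  refine norm_integral_le_of_norm_le ((hZ.integrable_error m).const_mul L)
    (ae_of_all _ fun ω => ?_)
  rw [Real.norm_eq_abs]
  refine (hf.lip _ _).trans (mul_le_mul_of_nonneg_left ?_ hf.nonneg)
  exact norm_le_abs_add_abs _

/-- The law `ρ` is the limit of the standardized pairs, with second moments. -/
structure IsLimitLaw (θ : ℝ) (ρ : ProbabilityMeasure (ℝ × ℝ)) : Prop where
  centered : IsCenteredL2 (ρ : Measure (ℝ × ℝ))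
  test : ∀ f C L, IsTest f C L → Tendsto (fun m => shapeMean θ m fun t => f (normShape θ m t))
    atTop (𝓝 (∫ x, f x ∂(ρ : Measure (ℝ × ℝ))))
  moment_fst : Tendsto (fun m => shapeMean θ m fun t => (normShape θ m t).1 ^ 2) atTop
    (𝓝 (∫ x, x.1 ^ 2 ∂(ρ : Measure (ℝ × ℝ))))
  moment_snd : Tendsto (fun m => shapeMean θ m fun t => (normShape θ m t).2 ^ 2) atTop
    (𝓝 (∫ x, x.2 ^ 2 ∂(ρ : Measure (ℝ × ℝ))))
  moment_mixed : Tendsto (fun m => shapeMean θ m fun t => (normShape θ m t).1 * (normShape θ m t).2)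
    atTop (𝓝 (∫ x, x.1 * x.2 ∂(ρ : Measure (ℝ × ℝ))))

/-- The law of a limit vector. -/
def IsL2Limit.law (hZ : IsL2Limit θ J P Z) : ProbabilityMeasure (ℝ × ℝ) :=
  ⟨P.map Z, Measure.isProbabilityMeasure_map hZ.measurable.aemeasurable⟩

lemma IsL2Limit.coe_law (hZ : IsL2Limit θ J P Z) : (hZ.law : Measure (ℝ × ℝ)) = P.map Z := rfl

lemma IsL2Limit.integral_law (hZ : IsL2Limit θ J P Z) {f : ℝ × ℝ → ℝ} (hf : Continuous f) :
    ∫ x, f x ∂(hZ.law : Measure (ℝ × ℝ)) = ∫ ω, f (Z ω) ∂P := by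
  rw [hZ.coe_law, integral_map hZ.measurable.aemeasurable hf.aestronglyMeasurable]

/-- Second moments, pure and mixed, are inner products in `L²` and so continuous under `L²`
convergence. -/
lemma IsL2Limit.isLimitLaw (hZ : IsL2Limit θ J P Z) : IsLimitLaw θ hZ.law where
  centered :=
    { memLp_fst := (memLp_map_measure_iff continuous_fst.aestronglyMeasurable
        hZ.measurable.aemeasurable).2 hZ.memLp_fst
      memLp_snd := (memLp_map_measure_iff continuous_snd.aestronglyMeasurable
        hZ.measurable.aemeasurable).2 hZ.memLp_snd
      integral_fst := by rw [hZ.integral_law continuous_fst, hZ.integral_fst]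
      integral_snd := by rw [hZ.integral_law continuous_snd, hZ.integral_snd] }
  test f C L hf := by
    rw [hZ.integral_law hf.continuous]
    exact hZ.tendsto_shapeMean hf
  moment_fst := by
    rw [hZ.integral_law (by fun_prop)]
    have hm := fun m => (hZ.regular.memLp_normShape m).1
    refine (tendsto_integral_mul hm hZ.memLp_fst hm hZ.memLp_fst hZ.tendsto_fst
      hZ.tendsto_fst).congr' ?_ |>.trans (by simp_rw [sq]; rfl)
    refine Eventually.of_forall fun m => ?_
    simp only [← sq]
    exact hZ.regular.integral_shape m fun t => (normShape θ m t).1 ^ 2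
  moment_snd := by
    rw [hZ.integral_law (by fun_prop)]
    have hm := fun m => (hZ.regular.memLp_normShape m).2
    refine (tendsto_integral_mul hm hZ.memLp_snd hm hZ.memLp_snd hZ.tendsto_snd
      hZ.tendsto_snd).congr' ?_ |>.trans (by simp_rw [sq]; rfl)
    refine Eventually.of_forall fun m => ?_
    simp only [← sq]
    exact hZ.regular.integral_shape m fun t => (normShape θ m t).2 ^ 2
  moment_mixed := by
    rw [hZ.integral_law (by fun_prop)]
    refine (tendsto_integral_mul (fun m => (hZ.regular.memLp_normShape m).1) hZ.memLp_fst
      (fun m => (hZ.regular.memLp_normShape m).2) hZ.memLp_snd hZ.tendsto_fst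
      hZ.tendsto_snd).congr fun m => ?_
    exact hZ.regular.integral_shape m fun t => (normShape θ m t).1 * (normShape θ m t).2

lemma IsLimitLaw.convergesWithSecondMoments_of_regular (hθ : 0 < θ)
    {ρ : ProbabilityMeasure (ℝ × ℝ)} (hρ : IsLimitLaw θ ρ) (hJ : IsRegularHoppe θ J P) :
    ConvergesWithSecondMoments (standardized J P) P (ρ : Measure (ℝ × ℝ)) := by
  -- Size zero involves division by zero and gives the value `0`; all other sizes are written `m +
  -- 1`.
  have hzero : ∀ ω, standardized J P 0 ω = 0 := fun ω => by simp [standardized]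
  have e : ∀ m, standardized J P (m + 1)
      = fun ω => normShape θ m (ltree (fun k => J k ω) m).shape :=
    fun m => funext (hJ.standardized_succ hθ m)
  have hmeas : ∀ n, Measurable (standardized J P n) := by
    rintro (_ | m)
    · rw [show standardized J P 0 = fun _ => 0 from funext hzero]
      exact measurable_const
    · rw [e m]
      exact hJ.measurable_normShape m
  refine ⟨⟨fun n => (hmeas n).aemeasurable, aemeasurable_id, ?_⟩, ?_, ?_, hρ.centered.memLp_fst,
    hρ.centered.memLp_snd, ?_, ?_, ?_⟩
  · refine tendsto_probabilityMeasure_of_isTest fun f C L hf => ?_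
    simp only [ProbabilityMeasure.coe_mk, Measure.map_id]
    rw [← tendsto_add_atTop_iff_nat 1]
    refine (hρ.test f C L hf).congr fun m => ?_
    rw [integral_map (hmeas _).aemeasurable hf.continuous.aestronglyMeasurable, e m]
    exact (hJ.integral_shape m fun t => f (normShape θ m t)).symm
  · rintro (_ | m)
    · simp [hzero]
    · rw [e m]
      exact (hJ.memLp_normShape m).1
  · rintro (_ | m)
    · simp [hzero]
    · rw [e m]
      exact (hJ.memLp_normShape m).2
  · rw [← tendsto_add_atTop_iff_nat 1]
    refine hρ.moment_fst.congr fun m => ?_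
    rw [e m]
    exact (hJ.integral_shape m fun t => (normShape θ m t).1 ^ 2).symm
  · rw [← tendsto_add_atTop_iff_nat 1]
    refine hρ.moment_snd.congr fun m => ?_
    rw [e m]
    exact (hJ.integral_shape m fun t => (normShape θ m t).2 ^ 2).symm
  · rw [← tendsto_add_atTop_iff_nat 1]
    refine hρ.moment_mixed.congr fun m => ?_
    rw [e m]
    exact (hJ.integral_shape m fun t => (normShape θ m t).1 * (normShape θ m t).2).symm

lemma ConvergesWithSecondMoments.congr {X Y : ℕ → Ω → ℝ × ℝ} {μ : Measure (ℝ × ℝ)}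
    [IsProbabilityMeasure μ] (h : ConvergesWithSecondMoments X P μ)
    (hXY : ∀ n, X n =ᵐ[P] Y n) : ConvergesWithSecondMoments Y P μ where
  inDistribution := h.inDistribution.congr hXY (ae_eq_refl _)
  memLp_fst n := (h.memLp_fst n).ae_eq ((hXY n).fun_comp Prod.fst)
  memLp_snd n := (h.memLp_snd n).ae_eq ((hXY n).fun_comp Prod.snd)
  memLp_limit_fst := h.memLp_limit_fst
  memLp_limit_snd := h.memLp_limit_snd
  moment_fst := h.moment_fst.congr fun n =>
    integral_congr_ae ((hXY n).fun_comp fun x : ℝ × ℝ => x.1 ^ 2)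
  moment_snd := h.moment_snd.congr fun n =>
    integral_congr_ae ((hXY n).fun_comp fun x : ℝ × ℝ => x.2 ^ 2)
  moment_mixed := h.moment_mixed.congr fun n =>
    integral_congr_ae ((hXY n).fun_comp fun x : ℝ × ℝ => x.1 * x.2)

lemma IsLimitLaw.convergesWithSecondMoments (hθ : 0 < θ) {ρ : ProbabilityMeasure (ℝ × ℝ)}
    (hρ : IsLimitLaw θ ρ) (hJ : IsHoppeSequence θ J P) :
    ConvergesWithSecondMoments (standardized J P) P (ρ : Measure (ℝ × ℝ)) := by
  obtain ⟨J', hJ', h⟩ := hJ.exists_regular hθ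
  exact (hρ.convergesWithSecondMoments_of_regular hθ hJ').congr h

end

lemma exists_isL2Limit {θ : ℝ} (hθ : 0 < θ) :
    ∃ (P : Measure (ℕ → ℕ)) (_ : IsProbabilityMeasure P) (J : ℕ → (ℕ → ℕ) → ℕ)
      (Z : (ℕ → ℕ) → ℝ × ℝ), IsL2Limit θ J P Z := by
  obtain ⟨P, hP, J, hJ⟩ := exists_hoppeSequence hθ
  obtain ⟨J', hJ', -⟩ := hJ.exists_regular hθ
  obtain ⟨Z, hZ⟩ := hJ'.exists_isL2Limit hθ
  exact ⟨P, hP, J', Z, hZ⟩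

/-! ### The fixed-point equation -/

lemma continuous_entropy : Continuous entropy := by
  unfold entropy
  have h1 := Real.continuous_mul_log
  exact h1.add (h1.comp (continuous_const.sub continuous_id))

lemma continuous_bHoppe (θ : ℝ) : Continuous (bHoppe θ) := by
  unfold bHoppe
  have := continuous_entropy
  fun_prop

lemma continuous_hoppeStep (θ : ℝ) : Continuous fun q : ℝ × (ℝ × ℝ) × (ℝ × ℝ) =>
    applyA q.1 q.2.1 + (applyB q.1 q.2.2 + bHoppe θ q.1) := by
  have := continuous_bHoppe θ
  unfold applyA applyB
  fun_prop

lemma abs_applyA_le {v : ℝ} (h0 : 0 ≤ v) (h1 : v ≤ 1) (x : ℝ × ℝ) :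
    ‖applyA v x‖ ≤ |x.1| + |x.2| := by
  have hw : 0 ≤ 1 - v := by linarith
  have hx := abs_nonneg x.1
  have hy := abs_nonneg x.2
  have a1 : (1 - v) ^ 2 ≤ 1 := pow_le_one₀ hw (by linarith)
  have a2 : v * (1 - v) ≤ 1 := by nlinarith
  rw [applyA, Prod.norm_def, Real.norm_eq_abs, Real.norm_eq_abs]
  refine max_le ((abs_add_le _ _).trans ?_) ?_
  · rw [abs_mul, abs_mul, abs_of_nonneg (show 0 ≤ (1 - v) ^ 2 by positivity),
      abs_of_nonneg (show 0 ≤ v * (1 - v) by positivity)]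
    exact add_le_add (mul_le_of_le_one_left hx a1) (mul_le_of_le_one_left hy a2)
  · rw [abs_mul, abs_of_nonneg hw]
    nlinarith

lemma applyB_eq (v : ℝ) (x : ℝ × ℝ) : applyB v x = applyA (1 - v) x := by
  simp only [applyA, applyB, sub_sub_cancel]
  rw [mul_comm v (1 - v)]

lemma abs_applyB_le {v : ℝ} (h0 : 0 ≤ v) (h1 : v ≤ 1) (x : ℝ × ℝ) :
    ‖applyB v x‖ ≤ |x.1| + |x.2| := by
  rw [applyB_eq]
  exact abs_applyA_le (by linarith) (by linarith) x

lemma applyA_sub (v : ℝ) (x y : ℝ × ℝ) : applyA v x - applyA v y = applyA v (x - y) := by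
  ext <;> simp [applyA] <;> ring

lemma applyB_sub (v : ℝ) (x y : ℝ × ℝ) : applyB v x - applyB v y = applyB v (x - y) := by
  ext <;> simp [applyB] <;> ring

/-- The standardized pair of a tree in terms of those of the two parts. -/
lemma normShape_join {θ : ℝ} {i j m : ℕ} (h : i + j = m) {r s : Shape} (hr : r.size = i + 1)
    (hs : s.size = j + 1) :
    normShape θ (m + 1) (.join r s) = applyA (share m j) (normShape θ i r)
      + (applyB (share m j) (normShape 1 j s) + toll θ i j) := by
  subst h
  have e1 : share (i + j) j = ((j : ℝ) + 1) / (i + j + 2) := by simp [share]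
  have e3 : (((i + j + 1 : ℕ) : ℝ) + 1) = i + j + 2 := by push_cast; ring
  ext
  · simp only [normShape, applyA, applyB, toll, Prod.fst_add, e1, e3, Shape.wiener, hr, hs]
    field_simp
    ring
  · simp only [normShape, applyA, applyB, toll, Prod.snd_add, e1, e3, Shape.pathLength, hs]
    field_simp
    ring

/-! ### Passing to the limit in the splitting recursion. -/

section

variable {θ : ℝ} {Ω₁ Ω₂ : Type*} [MeasurableSpace Ω₁] [MeasurableSpace Ω₂]
  {J₁ : ℕ → Ω₁ → ℕ} {J₂ : ℕ → Ω₂ → ℕ} {P₁ : Measure Ω₁} {P₂ : Measure Ω₂}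
  [IsProbabilityMeasure P₁] [IsProbabilityMeasure P₂] {Z₁ : Ω₁ → ℝ × ℝ} {Z₂ : Ω₂ → ℝ × ℝ}

/-- Bound for the difference between the toll and its limit. -/
def tollError (θ : ℝ) (i : ℕ) : ℝ := 2 * |wienerError θ i| + 2 * |pathError θ i|

lemma tollError_nonneg (θ : ℝ) (i : ℕ) : 0 ≤ tollError θ i := by unfold tollError; positivity

lemma tendsto_tollError (hθ : 0 < θ) : Tendsto (tollError θ) atTop (𝓝 0) := by
  have := ((tendsto_wienerError hθ).abs.const_mul 2).add ((tendsto_pathError hθ).abs.const_mul 2)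
  rw [abs_zero, mul_zero, add_zero] at this
  exact this

lemma norm_toll_sub_le (hθ : 0 < θ) {i j m : ℕ} (h : i + j = m) :
    ‖toll θ i j - bHoppe θ (share m j)‖
      ≤ tollError θ i + tollError 1 j + tollError θ (m + 1) := by
  have h0 := share_nonneg m j
  have h1 := share_le_one h
  have e1 := toll_fst hθ h
  have e2 := toll_snd (θ := θ) h
  set v := share m j
  have hw : 0 ≤ 1 - v := by linarith
  have a1 : (1 - v) ^ 2 ≤ 1 := pow_le_one₀ hw (by linarith)
  have a2 : v ^ 2 ≤ 1 := pow_le_one₀ h0 h1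
  have a3 : v * (1 - v) ≤ 1 := by nlinarith
  have a4 : 0 ≤ v * (1 - v) := by positivity
  have key : ∀ c x : ℝ, 0 ≤ c → c ≤ 1 → |c * x| ≤ |x| := by
    intro c x hc hc'
    rw [abs_mul, abs_of_nonneg hc]
    exact mul_le_of_le_one_left (abs_nonneg x) hc'
  refine (norm_le_abs_add_abs _).trans ?_
  rw [Prod.fst_sub, Prod.snd_sub, e1, e2, add_sub_cancel_left, add_sub_cancel_left]
  have b1 := key _ (wienerError θ i) (by positivity) a1
  have b2 := key _ (wienerError 1 j) (by positivity) a2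
  have b3 := key _ (pathError θ i) a4 a3
  have b4 := key _ (pathError 1 j) a4 a3
  have b5 := key _ (pathError θ i) hw (by linarith)
  have b6 := key _ (pathError 1 j) h0 h1
  have c1 : |(1 - v) ^ 2 * wienerError θ i + v ^ 2 * wienerError 1 j
      + v * (1 - v) * (pathError θ i + pathError 1 j) - wienerError θ (m + 1)|
      ≤ |wienerError θ i| + |wienerError 1 j| + (|pathError θ i| + |pathError 1 j|)
        + |wienerError θ (m + 1)| := by
    refine (abs_sub _ _).trans (add_le_add_left ((abs_add_le _ _).trans (add_le_add
      ((abs_add_le _ _).trans (add_le_add b1 b2)) ?_)) _)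
    rw [mul_add]
    exact (abs_add_le _ _).trans (add_le_add b3 b4)
  have c2 : |(1 - v) * pathError θ i + v * pathError 1 j - pathError θ (m + 1)|
      ≤ |pathError θ i| + |pathError 1 j| + |pathError θ (m + 1)| :=
    (abs_sub _ _).trans (add_le_add_left ((abs_add_le _ _).trans (add_le_add b5 b6)) _)
  unfold tollError
  linarith [abs_nonneg (wienerError θ i), abs_nonneg (wienerError 1 j),
    abs_nonneg (wienerError θ (m + 1)), abs_nonneg (pathError θ (m + 1))]

/-- The conditional expectation of `f` given the proportion `v`, in the limit. -/
def limitMean (θ : ℝ) (P₁ : Measure Ω₁) (P₂ : Measure Ω₂) (Z₁ : Ω₁ → ℝ × ℝ) (Z₂ : Ω₂ → ℝ × ℝ)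
    (f : ℝ × ℝ → ℝ) (v : ℝ) : ℝ :=
  ∫ z, f (applyA v (Z₁ z.1) + (applyB v (Z₂ z.2) + bHoppe θ v)) ∂(P₁.prod P₂)

lemma measurable_affineStep {α : Type*} [MeasurableSpace α] (v : ℝ) (b : ℝ × ℝ)
    {X Y : α → ℝ × ℝ} (hX : Measurable X) (hY : Measurable Y) :
    Measurable fun a => applyA v (X a) + (applyB v (Y a) + b) := by
  have hA : Continuous (applyA v) := by unfold applyA; fun_prop
  have hB : Continuous (applyB v) := by unfold applyB; fun_prop
  exact (hA.measurable.comp hX).add ((hB.measurable.comp hY).add measurable_const)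

lemma measurable_hoppeStep {α : Type*} [MeasurableSpace α] (θ v : ℝ) {X Y : α → ℝ × ℝ}
    (hX : Measurable X) (hY : Measurable Y) :
    Measurable fun a => applyA v (X a) + (applyB v (Y a) + bHoppe θ v) :=
  measurable_affineStep v (bHoppe θ v) hX hY

/-- Continuity in the proportion is what permits the urn limit to be applied to it. -/
lemma continuous_limitMean (h₁ : Measurable Z₁) (h₂ : Measurable Z₂) {f : ℝ × ℝ → ℝ} {C L : ℝ}
    (hf : IsTest f C L) : Continuous (limitMean θ P₁ P₂ Z₁ Z₂ f) := by
  refine continuous_of_dominated (bound := fun _ => C) (fun v => ?_) (fun v => ?_)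
    (integrable_const _) (ae_of_all _ fun z => ?_)
  · exact (hf.continuous.measurable.comp (measurable_hoppeStep θ v (h₁.comp measurable_fst)
      (h₂.comp measurable_snd))).aestronglyMeasurable
  · exact ae_of_all _ fun z => hf.bound _
  · exact hf.continuous.comp ((continuous_hoppeStep θ).comp
      (continuous_id.prodMk (continuous_const (y := (Z₁ z.1, Z₂ z.2)))))

/-- On the product space both parts sit next to their limits. The maps `A(v)` and `B(v)` do not
enlarge the `L¹` error, so the Lipschitz constant bounds the difference by the errors of the two
parts and of the toll. -/
lemma shapeMean_join_sub_limitMean_le (hθ : 0 < θ) (h₁ : IsL2Limit θ J₁ P₁ Z₁)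
    (h₂ : IsL2Limit 1 J₂ P₂ Z₂) {f : ℝ × ℝ → ℝ} {C L : ℝ} (hf : IsTest f C L)
    {i j m : ℕ} (h : i + j = m) :
    |(shapeMean θ i fun r => shapeMean 1 j fun s => f (normShape θ (m + 1) (.join r s)))
        - limitMean θ P₁ P₂ Z₁ Z₂ f (share m j)|
      ≤ L * ((l1Error θ J₁ P₁ Z₁ i + tollError θ i) + (l1Error 1 J₂ P₂ Z₂ j + tollError 1 j)
        + tollError θ (m + 1)) := by
  set X : Ω₁ → ℝ × ℝ := fun ω => normShape θ i (ltree (fun k => J₁ k ω) i).shape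
  set Y : Ω₂ → ℝ × ℝ := fun ω => normShape 1 j (ltree (fun k => J₂ k ω) j).shape
  set v := share m j with hv
  have h0 : 0 ≤ v := share_nonneg m j
  have h1 : v ≤ 1 := share_le_one h
  have hX : Measurable X := h₁.regular.measurable_normShape i
  have hY : Measurable Y := h₂.regular.measurable_normShape j
  have hmeas : Measurable fun z : Ω₁ × Ω₂ => applyA v (X z.1) + (applyB v (Y z.2) + toll θ i j) :=
    measurable_affineStep v (toll θ i j) (hX.comp measurable_fst) (hY.comp measurable_snd)
  have hmeas' : Measurable fun z : Ω₁ × Ω₂ =>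
      applyA v (Z₁ z.1) + (applyB v (Z₂ z.2) + bHoppe θ v) :=
    measurable_hoppeStep θ v (h₁.measurable.comp measurable_fst)
      (h₂.measurable.comp measurable_snd)
  have e1 : (shapeMean θ i fun r => shapeMean 1 j fun s => f (normShape θ (m + 1) (.join r s)))
      = ∫ z, f (applyA v (X z.1) + (applyB v (Y z.2) + toll θ i j)) ∂(P₁.prod P₂) := by
    rw [integral_prod _ (hf.integrable hmeas), ← h₁.regular.integral_shape]
    refine integral_congr_ae (ae_of_all _ fun ω => ?_)
    simp only
    rw [← h₂.regular.integral_shape]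
    refine integral_congr_ae (ae_of_all _ fun ω' => ?_)
    simp only
    rw [normShape_join h]
    · rw [LTree.size_shape (ltree_nodup (h₁.regular.isParent ω) i),
        ltree_labels (h₁.regular.isParent ω)]
      simp
    · rw [LTree.size_shape (ltree_nodup (h₂.regular.isParent ω') j),
        ltree_labels (h₂.regular.isParent ω')]
      simp
  set D₁ : Ω₁ → ℝ := fun ω => |(X ω).1 - (Z₁ ω).1| + |(X ω).2 - (Z₁ ω).2|
  set D₂ : Ω₂ → ℝ := fun ω => |(Y ω).1 - (Z₂ ω).1| + |(Y ω).2 - (Z₂ ω).2|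
  have hD₁ : Integrable (fun z : Ω₁ × Ω₂ => D₁ z.1) (P₁.prod P₂) :=
    (h₁.integrable_error i).comp_fst P₂
  have hD₂ : Integrable (fun z : Ω₁ × Ω₂ => D₂ z.2) (P₁.prod P₂) :=
    (h₂.integrable_error j).comp_snd P₁
  set T := tollError θ i + tollError 1 j + tollError θ (m + 1)
  have e2 : ∫ z, L * ((D₁ z.1 + D₂ z.2) + T) ∂(P₁.prod P₂)
      = L * ((l1Error θ J₁ P₁ Z₁ i + tollError θ i) + (l1Error 1 J₂ P₂ Z₂ j + tollError 1 j)
        + tollError θ (m + 1)) := by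
    have i1 : ∫ z, D₁ z.1 ∂(P₁.prod P₂) = l1Error θ J₁ P₁ Z₁ i := by
      rw [integral_fun_fst, probReal_univ, one_smul]
      rfl
    have i2 : ∫ z, D₂ z.2 ∂(P₁.prod P₂) = l1Error 1 J₂ P₂ Z₂ j := by
      rw [integral_fun_snd, probReal_univ, one_smul]
      rfl
    have hD : Integrable (fun z : Ω₁ × Ω₂ => D₁ z.1 + D₂ z.2) (P₁.prod P₂) := hD₁.add hD₂
    rw [integral_const_mul, integral_add hD (integrable_const _), integral_add hD₁ hD₂, i1, i2,
      integral_const, probReal_univ, one_smul]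
    ring
  rw [e1, limitMean, ← integral_sub (hf.integrable hmeas) (hf.integrable hmeas'), ← e2,
    ← Real.norm_eq_abs]
  refine norm_integral_le_of_norm_le (((hD₁.add hD₂).add (integrable_const T)).const_mul L)
    (ae_of_all _ fun z => ?_)
  rw [Real.norm_eq_abs]
  refine (hf.lip _ _).trans (mul_le_mul_of_nonneg_left ?_ hf.nonneg)
  have e3 : applyA v (X z.1) + (applyB v (Y z.2) + toll θ i j)
      - (applyA v (Z₁ z.1) + (applyB v (Z₂ z.2) + bHoppe θ v))
      = applyA v (X z.1 - Z₁ z.1) + applyB v (Y z.2 - Z₂ z.2) + (toll θ i j - bHoppe θ v) := by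
    rw [← applyA_sub, ← applyB_sub]
    abel
  rw [e3]
  refine (norm_add_le _ _).trans (add_le_add ((norm_add_le _ _).trans (add_le_add ?_ ?_)) ?_)
  · exact abs_applyA_le h0 h1 _
  · exact abs_applyB_le h0 h1 _
  · exact norm_toll_sub_le hθ h

lemma isProbabilityMeasure_hoppeMap (hθ : 0 < θ) (ν μ : Measure (ℝ × ℝ)) [IsProbabilityMeasure ν]
    [IsProbabilityMeasure μ] : IsProbabilityMeasure (hoppeMap θ ν μ) := by
  have := isProbabilityMeasureBeta one_pos hθ
  exact Measure.isProbabilityMeasure_map (continuous_hoppeStep θ).measurable.aemeasurable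

lemma integral_hoppeMap (hθ : 0 < θ) (ν μ : Measure (ℝ × ℝ)) [IsProbabilityMeasure ν]
    [IsProbabilityMeasure μ] {f : ℝ × ℝ → ℝ} {C L : ℝ} (hf : IsTest f C L) :
    ∫ x, f x ∂hoppeMap θ ν μ = ∫ v, ∫ z, f (applyA v z.1 + (applyB v z.2 + bHoppe θ v))
      ∂(μ.prod ν) ∂betaMeasure 1 θ := by
  have := isProbabilityMeasureBeta one_pos hθ
  rw [hoppeMap, integral_map (continuous_hoppeStep θ).measurable.aemeasurable
    hf.continuous.aestronglyMeasurable, integral_prod]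
  exact hf.integrable (continuous_hoppeStep θ).measurable

theorem IsL2Limit.hoppeMap_law (hθ : 0 < θ) (h₁ : IsL2Limit θ J₁ P₁ Z₁)
    (h₂ : IsL2Limit 1 J₂ P₂ Z₂) :
    hoppeMap θ (h₂.law : Measure (ℝ × ℝ)) (h₁.law : Measure (ℝ × ℝ)) = h₁.law := by
  have hp := isProbabilityMeasure_hoppeMap hθ (h₂.law : Measure (ℝ × ℝ))
    (h₁.law : Measure (ℝ × ℝ))
  suffices (⟨_, hp⟩ : ProbabilityMeasure (ℝ × ℝ)) = h₁.law from congrArg Subtype.val this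
  refine probabilityMeasure_ext_of_isTest fun f C L hf => ?_
  have e1 : ∫ x, f x ∂hoppeMap θ (h₂.law : Measure (ℝ × ℝ)) (h₁.law : Measure (ℝ × ℝ))
      = ∫ v, limitMean θ P₁ P₂ Z₁ Z₂ f v ∂betaMeasure 1 θ := by
    rw [integral_hoppeMap hθ _ _ hf]
    refine integral_congr_ae (ae_of_all _ fun v => ?_)
    simp only [limitMean]
    rw [h₁.coe_law, h₂.coe_law, Measure.map_prod_map _ _ h₁.measurable h₂.measurable,
      integral_map (h₁.measurable.prodMap h₂.measurable).aemeasurable]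
    · rfl
    · exact (hf.continuous.measurable.comp
        (measurable_hoppeStep θ v measurable_fst measurable_snd)).aestronglyMeasurable
  refine e1.trans ?_
  have hA : ∀ k, 0 ≤ l1Error θ J₁ P₁ Z₁ k + tollError θ k :=
    fun k => add_nonneg (l1Error_nonneg k) (tollError_nonneg θ k)
  have hB : ∀ k, 0 ≤ l1Error 1 J₂ P₂ Z₂ k + tollError 1 k :=
    fun k => add_nonneg (l1Error_nonneg k) (tollError_nonneg 1 k)
  have hA' : Tendsto (fun k => l1Error θ J₁ P₁ Z₁ k + tollError θ k) atTop (𝓝 0) := by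
    simpa using h₁.tendsto_l1Error.add (tendsto_tollError hθ)
  have hB' : Tendsto (fun k => l1Error 1 J₂ P₂ Z₂ k + tollError 1 k) atTop (𝓝 0) := by
    simpa using h₂.tendsto_l1Error.add (tendsto_tollError one_pos)
  have hlim := (((tendsto_urnMean_left_zero hθ hA hA').add
    (tendsto_urnMean_right_zero hθ hB hB')).add
      ((tendsto_add_atTop_iff_nat 1).2 (tendsto_tollError hθ))).const_mul L
  rw [add_zero, add_zero, mul_zero] at hlim
  have hmain := tendsto_urnMean hθ
    (continuous_limitMean (θ := θ) (P₁ := P₁) (P₂ := P₂) h₁.measurable h₂.measurable hf)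
  have hshape := (tendsto_add_atTop_iff_nat 1).2 (h₁.isLimitLaw.test f C L hf)
  -- The means of `f` at size `m + 2` have two limits: along the splitting, the integral against the
  -- image under `hoppeMap`; directly, the integral against the limit law. The errors vanish since
  -- small parts are rare in the urn.
  refine tendsto_nhds_unique (tendsto_of_tendsto_of_tendsto_of_le_of_le
    (by simpa using hmain.sub hlim) (by simpa using hmain.add hlim) (fun m => ?_) fun m => ?_)
    hshape
  all_goals
    simp only
    rw [shapeMean_succ_eq_urnMean hθ]
    have hsum : L * (urnMean θ m (fun i _ => l1Error θ J₁ P₁ Z₁ i + tollError θ i)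
        + urnMean θ m (fun _ j => l1Error 1 J₂ P₂ Z₂ j + tollError 1 j) + tollError θ (m + 1))
        = urnMean θ m fun i j => L * ((l1Error θ J₁ P₁ Z₁ i + tollError θ i)
          + (l1Error 1 J₂ P₂ Z₂ j + tollError 1 j) + tollError θ (m + 1)) := by
      rw [urnMean_mul]
      congr 1
      rw [urnMean_add θ m (fun i j => (l1Error θ J₁ P₁ Z₁ i + tollError θ i)
          + (l1Error 1 J₂ P₂ Z₂ j + tollError 1 j)) (fun _ _ => tollError θ (m + 1)),
        urnMean_const hθ, urnMean_add θ m (fun i _ => l1Error θ J₁ P₁ Z₁ i + tollError θ i)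
          (fun _ j => l1Error 1 J₂ P₂ Z₂ j + tollError 1 j)]
    rw [hsum]
  · rw [sub_le_iff_le_add, ← urnMean_add]
    refine urnMean_mono hθ fun i j hij => ?_
    linarith [(abs_le.1 (shapeMean_join_sub_limitMean_le hθ h₁ h₂ hf hij)).1]
  · rw [← urnMean_add]
    refine urnMean_mono hθ fun i j hij => ?_
    linarith [(abs_le.1 (shapeMean_join_sub_limitMean_le hθ h₁ h₂ hf hij)).2]

end

/-! ### Uniqueness for the Hoppe tree -/

/-- Both rows of `A(v)` have sum `1 - v`, so in the sup norm this is the contraction factor. -/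
lemma norm_applyA_le {v : ℝ} (h0 : 0 ≤ v) (h1 : v ≤ 1) (x : ℝ × ℝ) :
    ‖applyA v x‖ ≤ (1 - v) * ‖x‖ := by
  have hw : 0 ≤ 1 - v := by linarith
  have hx : |x.1| ≤ ‖x‖ := norm_fst_le x
  have hy : |x.2| ≤ ‖x‖ := norm_snd_le x
  rw [applyA, Prod.norm_def, Real.norm_eq_abs, Real.norm_eq_abs]
  refine max_le ((abs_add_le _ _).trans ?_) ?_
  · rw [abs_mul, abs_mul, abs_of_nonneg (show 0 ≤ (1 - v) ^ 2 by positivity),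
      abs_of_nonneg (show 0 ≤ v * (1 - v) by positivity)]
    calc (1 - v) ^ 2 * |x.1| + v * (1 - v) * |x.2|
        ≤ (1 - v) ^ 2 * ‖x‖ + v * (1 - v) * ‖x‖ := by gcongr
      _ = (1 - v) * ‖x‖ := by ring
  · rw [abs_mul, abs_of_nonneg hw]
    gcongr

lemma integral_one_sub_betaMeasure {θ : ℝ} (hθ : 0 < θ) :
    ∫ v, (1 - v) ∂betaMeasure 1 θ = θ / (θ + 1) := by
  have := isProbabilityMeasureBeta one_pos hθ
  have h := integral_pow_betaMeasure hθ 1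
  simp only [pow_one, Nat.factorial_one, Nat.cast_one, rise, Finset.prod_range_one, Nat.cast_zero,
    add_zero] at h
  have hi : Integrable (fun v : ℝ => v) (betaMeasure 1 θ) :=
    integrable_betaMeasure hθ measurable_id (C := 1) fun x h0 h1 => by rwa [abs_of_nonneg h0]
  rw [integral_sub (integrable_const _) hi, h, integral_const, probReal_univ, one_smul]
  field_simp
  ring

/-- The conditional expectation of `f (A(V) x + B(V) X + b*(V))`, where `X` has law `ν`. -/
def transfer (θ : ℝ) (ν : Measure (ℝ × ℝ)) (f : ℝ × ℝ → ℝ) (x : ℝ × ℝ) : ℝ :=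
  ∫ q, f (applyA q.1 x + (applyB q.1 q.2 + bHoppe θ q.1)) ∂((betaMeasure 1 θ).prod ν)

section

variable {θ : ℝ} {ν : Measure (ℝ × ℝ)} [IsProbabilityMeasure ν] {f : ℝ × ℝ → ℝ} {C L : ℝ}

lemma IsTest.transfer (hθ : 0 < θ) (hf : IsTest f C L) :
    IsTest (transfer θ ν f) C (L * (θ / (θ + 1))) := by
  have := isProbabilityMeasureBeta one_pos hθ
  have hm : ∀ x, Measurable fun q : ℝ × (ℝ × ℝ) =>
      applyA q.1 x + (applyB q.1 q.2 + bHoppe θ q.1) := fun x =>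
    ((continuous_hoppeStep θ).comp
      (continuous_fst.prodMk ((continuous_const (y := x)).prodMk continuous_snd))).measurable
  refine ⟨fun x => ?_, fun x y => ?_, by have := hf.nonneg; positivity⟩
  · have := norm_integral_le_of_norm_le_const (μ := (betaMeasure 1 θ).prod ν) (C := C)
      (f := fun q => f (applyA q.1 x + (applyB q.1 q.2 + bHoppe θ q.1)))
      (ae_of_all _ fun q => hf.bound _)
    rwa [probReal_univ, mul_one] at this
  · have hi : Integrable (fun v : ℝ => 1 - v) (betaMeasure 1 θ) :=
      integrable_betaMeasure hθ (by fun_prop) (C := 1) fun x h0 h1 => by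
        rw [abs_of_nonneg (by linarith)]; linarith
    have e : ∫ q : ℝ × (ℝ × ℝ), L * ((1 - q.1) * ‖x - y‖) ∂((betaMeasure 1 θ).prod ν)
        = L * (θ / (θ + 1)) * ‖x - y‖ := by
      rw [integral_const_mul, integral_mul_const,
        integral_fun_fst (μ := betaMeasure 1 θ) (ν := ν) (fun v : ℝ => 1 - v), probReal_univ,
        one_smul, integral_one_sub_betaMeasure hθ, mul_assoc]
    rw [HoppeTree.transfer, HoppeTree.transfer,
      ← integral_sub (hf.integrable (hm x)) (hf.integrable (hm y)), ← e, ← Real.norm_eq_abs]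
    refine norm_integral_le_of_norm_le (((hi.comp_fst ν).mul_const _).const_mul L) ?_
    filter_upwards [Measure.quasiMeasurePreserving_fst.ae (ae_betaMeasure θ)] with q hq
    refine (hf.lip _ _).trans (mul_le_mul_of_nonneg_left ?_ hf.nonneg)
    rw [add_sub_add_right_eq_sub, applyA_sub]
    exact norm_applyA_le hq.1.le hq.2.le _

/-- By Fubini, `transfer` is dual to `hoppeMap`. -/
lemma integral_transfer (hθ : 0 < θ) (hf : IsTest f C L) {μ : Measure (ℝ × ℝ)}
    [IsProbabilityMeasure μ] : ∫ x, transfer θ ν f x ∂μ = ∫ x, f x ∂hoppeMap θ ν μ := by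
  have := isProbabilityMeasureBeta one_pos hθ
  have hi : Integrable (fun q : (ℝ × ℝ) × ℝ × (ℝ × ℝ) =>
      f (applyA q.2.1 q.1 + (applyB q.2.1 q.2.2 + bHoppe θ q.2.1)))
      (μ.prod ((betaMeasure 1 θ).prod ν)) :=
    hf.integrable ((continuous_hoppeStep θ).comp (continuous_snd.fst.prodMk
      (continuous_fst.prodMk continuous_snd.snd))).measurable
  have hi' : Integrable (fun q : ((ℝ × ℝ) × ℝ) × (ℝ × ℝ) =>
      f (applyA q.1.2 q.1.1 + (applyB q.1.2 q.2 + bHoppe θ q.1.2)))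
      ((μ.prod (betaMeasure 1 θ)).prod ν) :=
    hf.integrable ((continuous_hoppeStep θ).comp (continuous_fst.snd.prodMk
      (continuous_fst.fst.prodMk continuous_snd))).measurable
  rw [integral_hoppeMap hθ ν μ hf]
  calc ∫ x, transfer θ ν f x ∂μ
      = ∫ x, ∫ v, ∫ y, f (applyA v x + (applyB v y + bHoppe θ v)) ∂ν ∂betaMeasure 1 θ ∂μ := by
        refine integral_congr_ae ?_
        filter_upwards [hi.prod_right_ae] with x hx
        exact integral_prod _ hx
    _ = ∫ v, ∫ x, ∫ y, f (applyA v x + (applyB v y + bHoppe θ v)) ∂ν ∂μ ∂betaMeasure 1 θ :=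
        integral_integral_swap hi'.integral_prod_left
    _ = _ := by
        refine integral_congr_ae (ae_of_all _ fun v => ?_)
        exact (integral_prod _ (hf.integrable
          (measurable_hoppeStep θ v measurable_fst measurable_snd))).symm

/-- The iterates keep their integral against `μ` while their Lipschitz constants tend to zero, so
they flatten to that integral. The uniform bound allows dominated convergence without moments of
`μ`. The sequence does not involve `μ`, whence uniqueness. -/
lemma tendsto_iterate_transfer (hθ : 0 < θ) (hf : IsTest f C L) {μ : Measure (ℝ × ℝ)}
    [IsProbabilityMeasure μ] (hμ : hoppeMap θ ν μ = μ) :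
    Tendsto (fun n => (transfer θ ν)^[n] f 0) atTop (𝓝 (∫ x, f x ∂μ)) := by
  have hn : ∀ n, IsTest ((transfer θ ν)^[n] f) C (L * (θ / (θ + 1)) ^ n) := by
    intro n
    induction n with
    | zero => simpa using hf
    | succ n ih =>
      rw [Function.iterate_succ_apply', pow_succ, ← mul_assoc]
      exact ih.transfer hθ
  have hInt : ∀ n, ∫ x, (transfer θ ν)^[n] f x ∂μ = ∫ x, f x ∂μ := by
    intro n
    induction n with
    | zero => rfl
    | succ n ih => rw [Function.iterate_succ_apply', integral_transfer hθ (hn n), hμ, ih]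
  have hr : Tendsto (fun n : ℕ => (θ / (θ + 1)) ^ n) atTop (𝓝 0) :=
    tendsto_pow_atTop_nhds_zero_of_lt_one (by positivity) ((div_lt_one (by positivity)).2 (by simp))
  have hlim : Tendsto (fun n => ∫ x, ((transfer θ ν)^[n] f x - (transfer θ ν)^[n] f 0) ∂μ) atTop
      (𝓝 (∫ _, 0 ∂μ)) := by
    refine tendsto_integral_of_dominated_convergence (fun _ => C + C)
      (fun n => ((hn n).continuous.sub continuous_const).aestronglyMeasurable)
      (integrable_const _) (fun n => ae_of_all _ fun x => ?_) (ae_of_all _ fun x => ?_)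
    · exact (norm_sub_le _ _).trans (add_le_add ((hn n).bound _) ((hn n).bound _))
    · have h := (hr.const_mul L).mul_const ‖x - 0‖
      rw [mul_zero, zero_mul] at h
      exact squeeze_zero_norm (fun n => (hn n).lip x 0) h
  have e : ∀ n, ∫ x, ((transfer θ ν)^[n] f x - (transfer θ ν)^[n] f 0) ∂μ
      = ∫ x, f x ∂μ - (transfer θ ν)^[n] f 0 := by
    intro n
    have hi : Integrable (fun x => (transfer θ ν)^[n] f x) μ := (hn n).integrable measurable_id
    rw [integral_sub hi (integrable_const _), integral_const,
      probReal_univ, one_smul, ← hInt n]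
  simp only [e, integral_zero] at hlim
  have h := (tendsto_const_nhds (x := ∫ x, f x ∂μ)).sub hlim
  simpa using h

end

theorem hoppeMap_fixedPoint_unique {θ : ℝ} (hθ : 0 < θ) {ν μ μ' : ProbabilityMeasure (ℝ × ℝ)}
    (h : hoppeMap θ (ν : Measure (ℝ × ℝ)) (μ : Measure (ℝ × ℝ)) = μ)
    (h' : hoppeMap θ (ν : Measure (ℝ × ℝ)) (μ' : Measure (ℝ × ℝ)) = μ') : μ' = μ :=
  probabilityMeasure_ext_of_isTest fun _ _ _ hf =>
    tendsto_nhds_unique (tendsto_iterate_transfer hθ hf h') (tendsto_iterate_transfer hθ hf h)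

/-! ### The random recursive tree -/

lemma bHoppe_one (v : ℝ) : bHoppe 1 v = bRecursive v := by
  rw [bHoppe, bRecursive, show (1 : ℝ) + 1 = 2 by norm_num]
  ext
  · simp only
    ring
  · simp only
    ring

lemma betaMeasure_one_one : betaMeasure 1 1 = volume.restrict (Set.Icc (0 : ℝ) 1) := by
  have h : betaPDF 1 1 = Set.indicator (Set.Ioo (0 : ℝ) 1) 1 := by
    ext x
    rw [betaPDF_eq]
    by_cases hx : 0 < x ∧ x < 1
    · rw [if_pos hx, Set.indicator_of_mem (by exact hx)]
      simp [beta, one_add_one_eq_two]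
    · rw [if_neg hx, Set.indicator_of_notMem (by exact hx)]
      simp
  rw [betaMeasure, h, withDensity_indicator_one measurableSet_Ioo,
    Measure.restrict_congr_set Ioo_ae_eq_Icc]

lemma recursiveMap_eq_hoppeMap (ν : Measure (ℝ × ℝ)) : recursiveMap ν = hoppeMap 1 ν ν := by
  simp only [recursiveMap, hoppeMap, betaMeasure_one_one, bHoppe_one, add_assoc]

/-- `γ` is a coupling of `ν` and `ρ`. -/
structure IsCoupling (γ : Measure ((ℝ × ℝ) × (ℝ × ℝ))) (ν ρ : Measure (ℝ × ℝ)) : Prop where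
  map_fst : γ.map Prod.fst = ν
  map_snd : γ.map Prod.snd = ρ

/-- The affine step of the recursive tree, applied to both components of a coupling. -/
def coupleStep (q : ℝ × ((ℝ × ℝ) × (ℝ × ℝ)) × ((ℝ × ℝ) × (ℝ × ℝ))) : (ℝ × ℝ) × (ℝ × ℝ) :=
  (applyA q.1 q.2.1.1 + (applyB q.1 q.2.2.1 + bHoppe 1 q.1),
   applyA q.1 q.2.1.2 + (applyB q.1 q.2.2.2 + bHoppe 1 q.1))

/-- Two independent copies of a coupling give a coupling of the images under `hoppeMap 1`. -/
def coupleMap (γ : Measure ((ℝ × ℝ) × (ℝ × ℝ))) : Measure ((ℝ × ℝ) × (ℝ × ℝ)) :=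
  ((betaMeasure 1 1).prod (γ.prod γ)).map coupleStep

lemma measurable_coupleStep : Measurable coupleStep := by
  have := continuous_bHoppe 1
  refine Continuous.measurable ?_
  unfold coupleStep applyA applyB
  fun_prop

/-- The expected squared distance between the two components. -/
def gap (γ : Measure ((ℝ × ℝ) × (ℝ × ℝ))) : ℝ :=
  ∫ z, ((z.1 - z.2).1 ^ 2 + (z.1 - z.2).2 ^ 2) ∂γ

lemma gap_nonneg (γ : Measure ((ℝ × ℝ) × (ℝ × ℝ))) : 0 ≤ gap γ :=
  integral_nonneg fun z => by positivity

/-- For centered square-integrable functions of independent variables, the second moment is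
additive. -/
lemma integral_add_sq_prod {α : Type*} [MeasurableSpace α] {γ : Measure α}
    [IsProbabilityMeasure γ] {F G : α → ℝ} (hF : MemLp F 2 γ) (hG : MemLp G 2 γ)
    (hF0 : ∫ z, F z ∂γ = 0) :
    Integrable (fun z : α × α => (F z.1 + G z.2) ^ 2) (γ.prod γ) ∧
      ∫ z, (F z.1 + G z.2) ^ 2 ∂(γ.prod γ) = ∫ z, F z ^ 2 ∂γ + ∫ z, G z ^ 2 ∂γ := by
  have i1 : Integrable (fun z : α × α => F z.1 ^ 2) (γ.prod γ) := hF.integrable_sq.comp_fst γ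
  have i2 : Integrable (fun z : α × α => G z.2 ^ 2) (γ.prod γ) := hG.integrable_sq.comp_snd γ
  have i3 : Integrable (fun z : α × α => F z.1 * G z.2) (γ.prod γ) :=
    (hF.integrable (by norm_num)).mul_prod (hG.integrable (by norm_num))
  have e : (fun z : α × α => (F z.1 + G z.2) ^ 2)
      = fun z => (F z.1 ^ 2 + G z.2 ^ 2) + 2 * (F z.1 * G z.2) := by
    ext z
    ring
  have i4 : Integrable (fun z : α × α => F z.1 ^ 2 + G z.2 ^ 2) (γ.prod γ) := i1.add i2
  rw [e]
  refine ⟨i4.add (i3.const_mul 2), ?_⟩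
  rw [integral_add i4 (i3.const_mul 2), integral_add i1 i2, integral_const_mul,
    integral_prod_mul, hF0, zero_mul, mul_zero, add_zero,
    integral_fun_fst (μ := γ) (ν := γ) (fun z => F z ^ 2),
    integral_fun_snd (μ := γ) (ν := γ) (fun z => G z ^ 2), probReal_univ, one_smul, one_smul]

lemma sq_applyA_le {v : ℝ} (h0 : 0 ≤ v) (h1 : v ≤ 1) (x : ℝ × ℝ) :
    (applyA v x).1 ^ 2 + (applyA v x).2 ^ 2
      ≤ (1 - v) ^ 2 * (1 + v) * (x.1 ^ 2 + x.2 ^ 2) := by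
  have hw : 0 ≤ 1 - v := by linarith
  -- The difference written as a sum of nonnegative terms. The factor `(1 - v)² (1 + v)` is chosen
  -- so that, added to its mirror image under `v ↦ 1 - v`, it gives `1 - v + v²`.
  have key : (1 - v) ^ 2 * (1 + v) * (x.1 ^ 2 + x.2 ^ 2)
      - ((applyA v x).1 ^ 2 + (applyA v x).2 ^ 2)
      = (1 - v) ^ 2 * (v * (1 - v) * (x.1 - x.2) ^ 2 + 2 * v * x.1 ^ 2) := by
    simp only [applyA]
    ring
  have : 0 ≤ (1 - v) ^ 2 * (v * (1 - v) * (x.1 - x.2) ^ 2 + 2 * v * x.1 ^ 2) := by positivity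
  linarith

/-! ### Contraction of couplings in the second moment. -/

section

variable {γ : Measure ((ℝ × ℝ) × (ℝ × ℝ))} {ν ν' : Measure (ℝ × ℝ)}

lemma IsCoupling.memLp_fst (h : IsCoupling γ ν ν') (hν : IsCenteredL2 ν) (hν' : IsCenteredL2 ν') :
    MemLp (fun z : (ℝ × ℝ) × (ℝ × ℝ) => (z.1 - z.2).1) 2 γ := by
  have h1 := hν.memLp_fst
  have h2 := hν'.memLp_fst
  rw [← h.map_fst, memLp_map_measure_iff continuous_fst.aestronglyMeasurable
    measurable_fst.aemeasurable] at h1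
  rw [← h.map_snd, memLp_map_measure_iff continuous_fst.aestronglyMeasurable
    measurable_snd.aemeasurable] at h2
  exact h1.sub h2

lemma IsCoupling.memLp_snd (h : IsCoupling γ ν ν') (hν : IsCenteredL2 ν) (hν' : IsCenteredL2 ν') :
    MemLp (fun z : (ℝ × ℝ) × (ℝ × ℝ) => (z.1 - z.2).2) 2 γ := by
  have h1 := hν.memLp_snd
  have h2 := hν'.memLp_snd
  rw [← h.map_fst, memLp_map_measure_iff continuous_snd.aestronglyMeasurable
    measurable_fst.aemeasurable] at h1
  rw [← h.map_snd, memLp_map_measure_iff continuous_snd.aestronglyMeasurable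
    measurable_snd.aemeasurable] at h2
  exact h1.sub h2

lemma IsCoupling.integral_sub (h : IsCoupling γ ν ν') {g : ℝ × ℝ → ℝ} (hg : Continuous g)
    (h1 : Integrable g ν) (h2 : Integrable g ν') :
    ∫ z, (g z.1 - g z.2) ∂γ = ∫ x, g x ∂ν - ∫ x, g x ∂ν' := by
  rw [← h.map_fst] at h1 ⊢
  rw [← h.map_snd] at h2 ⊢
  rw [integrable_map_measure hg.aestronglyMeasurable measurable_fst.aemeasurable] at h1
  rw [integrable_map_measure hg.aestronglyMeasurable measurable_snd.aemeasurable] at h2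
  rw [integral_map measurable_fst.aemeasurable hg.aestronglyMeasurable,
    integral_map measurable_snd.aemeasurable hg.aestronglyMeasurable]
  exact MeasureTheory.integral_sub h1 h2

lemma IsCoupling.integral_fst (h : IsCoupling γ ν ν') [IsFiniteMeasure ν] [IsFiniteMeasure ν']
    (hν : IsCenteredL2 ν) (hν' : IsCenteredL2 ν') : ∫ z, (z.1 - z.2).1 ∂γ = 0 := by
  have := h.integral_sub continuous_fst (hν.memLp_fst.integrable (by norm_num))
    (hν'.memLp_fst.integrable (by norm_num))
  rw [hν.integral_fst, hν'.integral_fst, sub_zero] at this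
  exact this

lemma IsCoupling.integral_snd (h : IsCoupling γ ν ν') [IsFiniteMeasure ν] [IsFiniteMeasure ν']
    (hν : IsCenteredL2 ν) (hν' : IsCenteredL2 ν') : ∫ z, (z.1 - z.2).2 ∂γ = 0 := by
  have := h.integral_sub continuous_snd (hν.memLp_snd.integrable (by norm_num))
    (hν'.memLp_snd.integrable (by norm_num))
  rw [hν.integral_snd, hν'.integral_snd, sub_zero] at this
  exact this

lemma IsCoupling.memLp_applyA (h : IsCoupling γ ν ν') (hν : IsCenteredL2 ν)
    (hν' : IsCenteredL2 ν') (v : ℝ) :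
    MemLp (fun z : (ℝ × ℝ) × (ℝ × ℝ) => (applyA v (z.1 - z.2)).1) 2 γ ∧
      MemLp (fun z : (ℝ × ℝ) × (ℝ × ℝ) => (applyA v (z.1 - z.2)).2) 2 γ :=
  ⟨((h.memLp_fst hν hν').const_mul _).add ((h.memLp_snd hν hν').const_mul _),
    (h.memLp_snd hν hν').const_mul _⟩

lemma IsCoupling.integral_sq_applyA_le (h : IsCoupling γ ν ν') (hν : IsCenteredL2 ν)
    (hν' : IsCenteredL2 ν') {v : ℝ} (h0 : 0 ≤ v) (h1 : v ≤ 1) :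
    ∫ z, (applyA v (z.1 - z.2)).1 ^ 2 ∂γ + ∫ z, (applyA v (z.1 - z.2)).2 ^ 2 ∂γ
      ≤ (1 - v) ^ 2 * (1 + v) * gap γ := by
  obtain ⟨a1, a2⟩ := h.memLp_applyA hν hν' v
  rw [← integral_add a1.integrable_sq a2.integrable_sq, gap, ← integral_const_mul]
  refine integral_mono (a1.integrable_sq.add a2.integrable_sq)
    (((h.memLp_fst hν hν').integrable_sq.add (h.memLp_snd hν hν').integrable_sq).const_mul _)
    fun z => sq_applyA_le h0 h1 _

variable [IsProbabilityMeasure γ]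

lemma IsCoupling.integral_applyA (h : IsCoupling γ ν ν') [IsFiniteMeasure ν] [IsFiniteMeasure ν']
    (hν : IsCenteredL2 ν) (hν' : IsCenteredL2 ν') (v : ℝ) :
    ∫ z, (applyA v (z.1 - z.2)).1 ∂γ = 0 ∧ ∫ z, (applyA v (z.1 - z.2)).2 ∂γ = 0 := by
  have i1 := (h.memLp_fst hν hν').integrable (by norm_num)
  have i2 := (h.memLp_snd hν hν').integrable (by norm_num)
  simp only [applyA]
  rw [integral_add (i1.const_mul _) (i2.const_mul _), integral_const_mul, integral_const_mul,
    integral_const_mul, h.integral_fst hν hν', h.integral_snd hν hν']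
  simp

lemma isProbabilityMeasure_coupleMap : IsProbabilityMeasure (coupleMap γ) := by
  have := isProbabilityMeasureBeta one_pos one_pos
  exact Measure.isProbabilityMeasure_map measurable_coupleStep.aemeasurable

lemma map_coupleMap {π : (ℝ × ℝ) × (ℝ × ℝ) → ℝ × ℝ} (hπ : Measurable π)
    (h : ∀ q, π (coupleStep q) = applyA q.1 (π q.2.1) + (applyB q.1 (π q.2.2) + bHoppe 1 q.1)) :
    (coupleMap γ).map π = hoppeMap 1 (γ.map π) (γ.map π) := by
  have := isProbabilityMeasureBeta one_pos one_pos
  have e : (betaMeasure 1 1).prod ((γ.map π).prod (γ.map π))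
      = ((betaMeasure 1 1).prod (γ.prod γ)).map (Prod.map id (Prod.map π π)) := by
    rw [Measure.map_prod_map _ _ hπ hπ, ← Measure.map_prod_map _ _ measurable_id
      (hπ.prodMap hπ), Measure.map_id]
  rw [coupleMap, hoppeMap, e, Measure.map_map hπ measurable_coupleStep,
    Measure.map_map (continuous_hoppeStep 1).measurable
      (measurable_id.prodMap (hπ.prodMap hπ))]
  congr 1
  exact funext h

/-- Both components use the same `V`, and each marginal evolves by `hoppeMap 1`; fixed points are
therefore kept as marginals. -/
lemma IsCoupling.coupleMap (h : IsCoupling γ ν ν') (hfix₁ : hoppeMap 1 ν ν = ν)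
    (hfix₂ : hoppeMap 1 ν' ν' = ν') : IsCoupling (coupleMap γ) ν ν' where
  map_fst := by rw [map_coupleMap measurable_fst fun _ => rfl, h.map_fst, hfix₁]
  map_snd := by rw [map_coupleMap measurable_snd fun _ => rfl, h.map_snd, hfix₂]

/-- The expected squared distance of the images, given the proportion `v`. -/
lemma IsCoupling.integral_step_le (h : IsCoupling γ ν ν') [IsFiniteMeasure ν] [IsFiniteMeasure ν']
    (hν : IsCenteredL2 ν) (hν' : IsCenteredL2 ν') {v : ℝ} (h0 : 0 ≤ v) (h1 : v ≤ 1) :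
    ∫ z, (((coupleStep (v, z)).1 - (coupleStep (v, z)).2).1 ^ 2
      + ((coupleStep (v, z)).1 - (coupleStep (v, z)).2).2 ^ 2) ∂(γ.prod γ)
      ≤ (1 - v + v ^ 2) * gap γ := by
  have e : ∀ z, (coupleStep (v, z)).1 - (coupleStep (v, z)).2
      = applyA v (z.1.1 - z.1.2) + applyA (1 - v) (z.2.1 - z.2.2) := by
    intro z
    simp only [coupleStep]
    rw [← applyB_eq, ← applyA_sub, ← applyB_sub]
    abel
  simp only [e, Prod.fst_add, Prod.snd_add]
  obtain ⟨a1, a2⟩ := h.memLp_applyA hν hν' v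
  obtain ⟨b1, b2⟩ := h.memLp_applyA hν hν' (1 - v)
  obtain ⟨c1, c2⟩ := h.integral_applyA hν hν' v
  obtain ⟨i1, s1⟩ := integral_add_sq_prod a1 b1 c1
  obtain ⟨i2, s2⟩ := integral_add_sq_prod a2 b2 c2
  rw [integral_add i1 i2, s1, s2]
  have d1 := h.integral_sq_applyA_le hν hν' h0 h1
  have d2 := h.integral_sq_applyA_le hν hν' (v := 1 - v) (by linarith) (by linarith)
  -- The two factors add up: `(1 - v)² (1 + v) + v² (2 - v) = 1 - v + v²`.
  nlinarith [d1, d2]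

lemma integral_one_sub_add_sq : ∫ v, (1 - v + v ^ 2) ∂betaMeasure 1 1 = 5 / 6 := by
  have := isProbabilityMeasureBeta one_pos one_pos
  have hi : ∀ q : ℕ, Integrable (fun v : ℝ => v ^ q) (betaMeasure 1 1) := fun q =>
    integrable_betaMeasure one_pos (by fun_prop) (C := 1) fun x h0 h1 => by
      rw [abs_of_nonneg (by positivity)]
      exact pow_le_one₀ h0 h1
  have h1 := integral_pow_betaMeasure one_pos 1
  have h2 := integral_pow_betaMeasure one_pos 2
  have i1 := hi 1
  simp only [pow_one] at h1 i1
  have i2 : Integrable (fun v : ℝ => 1 - v) (betaMeasure 1 1) := (integrable_const _).sub i1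
  rw [integral_add i2 (hi 2), integral_sub (integrable_const _) i1,
    h1, h2, integral_const, probReal_univ, one_smul]
  simp only [rise, Finset.prod_range_succ, Finset.prod_range_zero, Nat.factorial]
  norm_num

lemma IsCoupling.gap_coupleMap_le (h : IsCoupling γ ν ν') [IsFiniteMeasure ν] [IsFiniteMeasure ν']
    (hν : IsCenteredL2 ν) (hν' : IsCenteredL2 ν') (hfix : hoppeMap 1 ν ν = ν)
    (hfix' : hoppeMap 1 ν' ν' = ν') : gap (HoppeTree.coupleMap γ) ≤ 5 / 6 * gap γ := by
  have := isProbabilityMeasureBeta one_pos one_pos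
  have := isProbabilityMeasure_coupleMap (γ := γ)
  have h' := h.coupleMap hfix hfix'
  have hm : Continuous fun z : (ℝ × ℝ) × (ℝ × ℝ) => (z.1 - z.2).1 ^ 2 + (z.1 - z.2).2 ^ 2 := by
    fun_prop
  have hi : Integrable (fun z : (ℝ × ℝ) × (ℝ × ℝ) => (z.1 - z.2).1 ^ 2 + (z.1 - z.2).2 ^ 2)
      (HoppeTree.coupleMap γ) :=
    (h'.memLp_fst hν hν').integrable_sq.add (h'.memLp_snd hν hν').integrable_sq
  rw [HoppeTree.coupleMap, integrable_map_measure hm.aestronglyMeasurable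
    measurable_coupleStep.aemeasurable] at hi
  rw [gap, HoppeTree.coupleMap, integral_map measurable_coupleStep.aemeasurable
    hm.aestronglyMeasurable]
  refine (integral_prod _ hi).trans_le ?_
  rw [← integral_one_sub_add_sq, ← integral_mul_const]
  refine integral_mono_ae hi.integral_prod_left ((integrable_betaMeasure one_pos (by fun_prop)
    (C := 3) fun x h0 h1 => ?_).mul_const _) ?_
  · rw [abs_of_nonneg (by nlinarith)]
    nlinarith
  · filter_upwards [ae_betaMeasure 1] with v hv
    exact h.integral_step_le hν hν' hv.1.le hv.2.le

/-- A coupling with small `gap` forces the marginals to be close on Lipschitz functions. -/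
lemma IsCoupling.abs_integral_sub_le (h : IsCoupling γ ν ν') [IsProbabilityMeasure ν]
    [IsProbabilityMeasure ν'] (hν : IsCenteredL2 ν) (hν' : IsCenteredL2 ν') {f : ℝ × ℝ → ℝ}
    {C L : ℝ} (hf : IsTest f C L) :
    |∫ x, f x ∂ν - ∫ x, f x ∂ν'| ≤ L * (√(gap γ) + √(gap γ)) := by
  have m1 := h.memLp_fst hν hν'
  have m2 := h.memLp_snd hν hν'
  have i1 := (m1.integrable (by norm_num)).abs
  have i2 := (m2.integrable (by norm_num)).abs
  have s1 : ∫ z, (z.1 - z.2).1 ^ 2 ∂γ ≤ gap γ :=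
    integral_mono m1.integrable_sq (m1.integrable_sq.add m2.integrable_sq)
      fun z => le_add_of_nonneg_right (sq_nonneg _)
  have s2 : ∫ z, (z.1 - z.2).2 ^ 2 ∂γ ≤ gap γ :=
    integral_mono m2.integrable_sq (m1.integrable_sq.add m2.integrable_sq)
      fun z => le_add_of_nonneg_left (sq_nonneg _)
  rw [← h.integral_sub hf.continuous (hf.integrable measurable_id) (hf.integrable measurable_id),
    ← Real.norm_eq_abs]
  calc ‖∫ z, (f z.1 - f z.2) ∂γ‖
      ≤ ∫ z, L * (|(z.1 - z.2).1| + |(z.1 - z.2).2|) ∂γ := by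
        refine norm_integral_le_of_norm_le ((i1.add i2).const_mul L) (ae_of_all _ fun z => ?_)
        exact (hf.lip _ _).trans (mul_le_mul_of_nonneg_left (norm_le_abs_add_abs _) hf.nonneg)
    _ = L * (∫ z, |(z.1 - z.2).1| ∂γ + ∫ z, |(z.1 - z.2).2| ∂γ) := by
        rw [integral_const_mul, integral_add i1 i2]
    _ ≤ L * (√(gap γ) + √(gap γ)) := by
        refine mul_le_mul_of_nonneg_left (add_le_add ?_ ?_) hf.nonneg
        · exact (integral_abs_le_sqrt m1).trans (Real.sqrt_le_sqrt s1)
        · exact (integral_abs_le_sqrt m2).trans (Real.sqrt_le_sqrt s2)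

end

/-- Starting from the independent coupling, iteration of `coupleMap` drives the gap to zero
geometrically, so no optimal coupling is needed. -/
theorem recursiveMap_fixedPoint_unique {ν ν' : ProbabilityMeasure (ℝ × ℝ)}
    (hν : IsCenteredL2 (ν : Measure (ℝ × ℝ))) (hν' : IsCenteredL2 (ν' : Measure (ℝ × ℝ)))
    (h : recursiveMap (ν : Measure (ℝ × ℝ)) = ν)
    (h' : recursiveMap (ν' : Measure (ℝ × ℝ)) = ν') : ν' = ν := by
  rw [recursiveMap_eq_hoppeMap] at h h'
  set γ₀ : Measure ((ℝ × ℝ) × (ℝ × ℝ)) := (ν' : Measure (ℝ × ℝ)).prod (ν : Measure (ℝ × ℝ))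
  have hγ : ∀ n, IsProbabilityMeasure (coupleMap^[n] γ₀) ∧
      IsCoupling (coupleMap^[n] γ₀) (ν' : Measure (ℝ × ℝ)) (ν : Measure (ℝ × ℝ)) ∧
      gap (coupleMap^[n] γ₀) ≤ (5 / 6) ^ n * gap γ₀ := by
    intro n
    induction n with
    | zero =>
      refine ⟨inferInstanceAs (IsProbabilityMeasure (Measure.prod _ _)), ⟨?_, ?_⟩, by simp⟩
      · exact Measure.fst_prod
      · exact Measure.snd_prod
    | succ n ih =>
      obtain ⟨h1, h2, h3⟩ := ih
      rw [Function.iterate_succ_apply']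
      refine ⟨isProbabilityMeasure_coupleMap, h2.coupleMap h' h, ?_⟩
      refine (h2.gap_coupleMap_le hν' hν h' h).trans ?_
      rw [pow_succ]
      linarith
  have hlim : Tendsto (fun n => gap (coupleMap^[n] γ₀)) atTop (𝓝 0) := by
    have h0 := (tendsto_pow_atTop_nhds_zero_of_lt_one (r := (5 / 6 : ℝ)) (by norm_num)
      (by norm_num)).mul_const (gap γ₀)
    rw [zero_mul] at h0
    exact squeeze_zero (fun n => gap_nonneg _) (fun n => (hγ n).2.2) h0
  refine probabilityMeasure_ext_of_isTest fun f C L hf => ?_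
  have hz := (hlim.sqrt.add hlim.sqrt).const_mul L
  rw [Real.sqrt_zero, add_zero, mul_zero] at hz
  refine sub_eq_zero.1 (abs_nonpos_iff.1 (ge_of_tendsto' hz fun n => ?_))
  have := (hγ n).1
  exact (hγ n).2.1.abs_integral_sub_le hν' hν hf

end HoppeTree
end

theorem mainTheorem1 (θ : ℝ) (hθ : 0 < θ) :
    ∃ ν : ProbabilityMeasure (ℝ × ℝ),
      -- `ν` is the limit law of the random recursive tree (`θ = 1`), and it is the unique
      -- centered fixed point with finite second moments of the homogeneous equation
      (HoppeTree.IsCenteredL2 (ν : Measure (ℝ × ℝ)) ∧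
        HoppeTree.recursiveMap (ν : Measure (ℝ × ℝ)) = ν ∧
        ∀ ν' : ProbabilityMeasure (ℝ × ℝ), HoppeTree.IsCenteredL2 (ν' : Measure (ℝ × ℝ)) →
          HoppeTree.recursiveMap (ν' : Measure (ℝ × ℝ)) = ν' → ν' = ν) ∧
      (∀ (Ω : Type*) [MeasurableSpace Ω] (P : Measure Ω) [IsProbabilityMeasure P]
        (J : ℕ → Ω → ℕ), HoppeTree.IsHoppeSequence 1 J P →
          HoppeTree.ConvergesWithSecondMoments (HoppeTree.standardized J P) P
            (ν : Measure (ℝ × ℝ))) ∧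
      -- the Hoppe tree with parameter `θ`
      ∃ μ : ProbabilityMeasure (ℝ × ℝ),
        (∀ (Ω : Type*) [MeasurableSpace Ω] (P : Measure Ω) [IsProbabilityMeasure P]
          (J : ℕ → Ω → ℕ), HoppeTree.IsHoppeSequence θ J P →
            HoppeTree.ConvergesWithSecondMoments (HoppeTree.standardized J P) P
              (μ : Measure (ℝ × ℝ))) ∧
        HoppeTree.IsCenteredL2 (μ : Measure (ℝ × ℝ)) ∧
        HoppeTree.hoppeMap θ (ν : Measure (ℝ × ℝ)) (μ : Measure (ℝ × ℝ)) = μ ∧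
        ∀ μ' : ProbabilityMeasure (ℝ × ℝ),
          HoppeTree.hoppeMap θ (ν : Measure (ℝ × ℝ)) (μ' : Measure (ℝ × ℝ)) = μ' → μ' = μ := by
  obtain ⟨P, _, J, Z, hZ⟩ := HoppeTree.exists_isL2Limit one_pos
  obtain ⟨P', _, J', Z', hZ'⟩ := HoppeTree.exists_isL2Limit hθ
  have hν : HoppeTree.recursiveMap (hZ.law : Measure (ℝ × ℝ)) = hZ.law := by
    rw [HoppeTree.recursiveMap_eq_hoppeMap]
    -- For `θ = 1` both parts of the split tree are random recursive trees, so the same limit enters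
    -- twice.
    exact hZ.hoppeMap_law one_pos hZ
  have hμ := hZ'.hoppeMap_law hθ hZ
  exact ⟨hZ.law, ⟨hZ.isLimitLaw.centered, hν, fun ν' h1 h2 =>
      HoppeTree.recursiveMap_fixedPoint_unique hZ.isLimitLaw.centered h1 hν h2⟩,
    fun Ω _ Q _ I hI => hZ.isLimitLaw.convergesWithSecondMoments one_pos hI,
    hZ'.law, fun Ω _ Q _ I hI => hZ'.isLimitLaw.convergesWithSecondMoments hθ hI,
    hZ'.isLimitLaw.centered, hμ, fun μ' h => HoppeTree.hoppeMap_fixedPoint_unique hθ hμ h⟩
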